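/- Let $m\ge 0$ and let $(V,\rho)$ be a finite-dimensional real representation of $gl(m,\mathbb R)$. Let $sl_{m+1}=\mathbb R^m\oplus gl(m,\mathbb R)\oplus\mathbb R^{m*}$ be the realization of $sl(m+1,\mathbb R)$ in which $\mathbb R^m$ and $\mathbb R^{m*}$ are abelian subalgebras, $gl(m,\mathbb R)$ is a subalgebra acting naturally on both by the adjoint action, and $[h,\alpha]=\alpha(h)\mathbf 1+h\otimes\alpha$. It embeds in the Lie algebra of vector fields of $\mathbb R^m$ by $$(h,A,\alpha)\mapsto -h^i\partial_i-A^i_jx^j\partial_i+\alpha(x)x^i\partial_i .$$ We identify $X\in sl_{m+1}$ with its vector field, and write $DX=(\partial_jX^i)$. The algebra $sl_{m+1}$ acts on the space $C^\infty(\mathbb R^m,V)$ of smooth functions by the Lie derivative $L_X^\rho f=X.f-\rho(DX)f$. Let $\Lambda(\mathbb R^{m*},V)=\bigoplus_{u=0}^m\Lambda^u(\mathbb R^{m*},V)$ be the space of alternating multilinear maps from $\mathbb R^{m*}$ to $V$, with the $gl(m,\mathbb R)$-action deduced from $\rho$ and the natural action $A\cdot\alpha=-\alpha\circ A$ on $\mathbb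 R^{m*}$. For a Lie algebra $L$ and an $L$-module $M$, let $\Lambda(L,M)=\bigoplus_{n\ge 0}\Lambda^n(L,M)$ be the space of Chevalley–Eilenberg cochains (alternating $n$-linear maps $L^n\to M$), $\partial$ the Chevalley–Eilenberg coboundary operator, and $H(L,M)=\ker\partial/\operatorname{im}\partial$. Let $\chi:\Lambda(gl(m,\mathbb R),\Lambda(\mathbb R^{m*},V))\to\Lambda(sl_{m+1},C^\infty(\mathbb R^m,V))$ be the linear map which sends a $t$-cochain $\gamma$ with values in $\Lambda^u(\mathbb R^{m*},V)$ to the $(t+u)$-cochain $$(X_0,\dots,X_{t+u-1})\mapsto\frac{(-1)^t}{t!\,u!\,(m+1)^u}\sum_\nu \operatorname{sign}(\nu)\,\bigl(\gamma(DX_{\nu_0},\dots,DX_{\nu_{t-1}})\bigr)\bigl(d\operatorname{tr}(DX_{\nu_t}),\dots,d\operatorname{tr}(DX_{\nu_{t+u-1}})\bigr),$$ where $\nu$ runs through the permutations of the $t+u$ indices. Theorem 3.3. The map $\chi$ commutes with the coboundary operators, and the map induced in cohomology $$\chi_\#:H(gl(m,\mathbb R),\Lambda(\mathbb R^{m*},V))\to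 H(sl_{m+1},C^\infty(\mathbb R^m,V))$$ is a bijection. -/

import Mathlib

attribute [local instance] LieRing.ofAssociativeRing

open scoped ContDiff

noncomputable section

namespace ProjCoh

section General

variable {L M W : Type*} [LieRing L] [LieAlgebra ℝ L] [AddCommGroup M] [Module ℝ M]
  [AddCommGroup W] [Module ℝ W]

/-- For an endomorphism `f` of `W` and an alternating map `c` on `W`, the alternating map
`(w₀, …, w_{n-1}) ↦ ∑ j, c (w₀, …, f w_j, …, w_{n-1})`. -/
def altDer {n : ℕ} (f : Module.End ℝ W) (c : W [⋀^Fin n]→ₗ[ℝ] M) : W [⋀^Fin n]→ₗ[ℝ] M where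
  toFun w := ∑ j, c (Function.update w j (f (w j)))
  map_update_add' := by
    intro inst w i x y
    obtain rfl : inst = instDecidableEqFin n := Subsingleton.elim _ _
    rw [← Finset.sum_add_distrib]
    refine Finset.sum_congr rfl fun j _ => ?_
    rcases eq_or_ne j i with rfl | h
    · simp
    · simp only [Function.update_of_ne h, Function.update_comm h.symm, c.map_update_add]
  map_update_smul' := by
    intro inst w i r x
    obtain rfl : inst = instDecidableEqFin n := Subsingleton.elim _ _
    rw [Finset.smul_sum]
    refine Finset.sum_congr rfl fun j _ => ?_
    rcases eq_or_ne j i with rfl | h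
    · simp
    · simp only [Function.update_of_ne h, Function.update_comm h.symm, c.map_update_smul]
  map_eq_zero_of_eq' := by
    intro w i k hik hne
    rw [← Finset.add_sum_erase _ _ (Finset.mem_univ i),
      ← Finset.add_sum_erase _ _ (Finset.mem_erase.2 ⟨hne.symm, Finset.mem_univ k⟩),
      Finset.sum_eq_zero, add_zero]
    · have : Function.update w k (f (w k)) =
          Function.update w i (f (w i)) ∘ Equiv.swap i k := by
        ext l
        rcases eq_or_ne l i with rfl | hl
        · simp [Function.update_of_ne hne, Function.update_of_ne hne.symm, hik]
        rcases eq_or_ne l k with rfl | hl'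
        · simp [hik]
        · simp [Equiv.swap_apply_of_ne_of_ne hl hl', hl, hl']
      rw [this, c.map_swap _ hne, add_neg_cancel]
    · intro j hj
      simp only [Finset.mem_erase, Finset.mem_univ, and_true] at hj
      exact c.map_eq_zero_of_eq _ (by simp [Function.update_of_ne hj.1.symm,
        Function.update_of_ne hj.2.symm, hik]) hne

theorem altDer_apply {n : ℕ} (f : Module.End ℝ W) (c : W [⋀^Fin n]→ₗ[ℝ] M) (w : Fin n → W) :
    altDer f c w = ∑ j, c (Function.update w j (f (w j))) := rfl

theorem altDer_comm {n : ℕ} (f g : Module.End ℝ W) (c : W [⋀^Fin n]→ₗ[ℝ] M) :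
    altDer f (altDer g c) - altDer g (altDer f c) = altDer (g * f - f * g) c := by
  have key : ∀ (f g : Module.End ℝ W) (w : Fin n → W), altDer f (altDer g c) w =
      ∑ j, c (Function.update w j (g (f (w j)))) +
      ∑ j, ∑ k ∈ Finset.univ.erase j,
        c (Function.update (Function.update w j (f (w j))) k (g (w k))) := by
    intro f g w
    simp only [altDer_apply]
    rw [← Finset.sum_add_distrib]
    refine Finset.sum_congr rfl fun j _ => ?_
    rw [← Finset.add_sum_erase _ _ (Finset.mem_univ j)]
    congr 1
    · simp
    · refine Finset.sum_congr rfl fun k hk => ?_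
      rw [Function.update_of_ne (Finset.ne_of_mem_erase hk)]
  ext w
  rw [AlternatingMap.sub_apply, key, key]
  have : ∑ j, ∑ k ∈ Finset.univ.erase j,
        c (Function.update (Function.update w j (f (w j))) k (g (w k))) =
      ∑ j, ∑ k ∈ Finset.univ.erase j,
        c (Function.update (Function.update w j (g (w j))) k (f (w k))) := by
    rw [Finset.sum_comm' (t' := Finset.univ) (s' := fun k => Finset.univ.erase k)]
    · refine Finset.sum_congr rfl fun k _ => Finset.sum_congr rfl fun j hj => ?_
      rw [Function.update_comm (Finset.ne_of_mem_erase hj)]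
    · intro j k
      simp [eq_comm]
  rw [this, add_sub_add_right_eq_sub, ← Finset.sum_sub_distrib, altDer_apply]
  refine Finset.sum_congr rfl fun j _ => ?_
  rw [← c.map_update_sub]
  rfl

/-- The natural representation on the alternating maps from a representation `σ` on `W` to a
representation `φ` on `M`:
`(x · c)(w₀, …) = φ(x) (c (w₀, …)) - ∑ j, c (w₀, …, σ(x) w_j, …)`. -/
def altRep (n : ℕ) (σ : L →ₗ⁅ℝ⁆ Module.End ℝ W) (φ : L →ₗ⁅ℝ⁆ Module.End ℝ M) :
    L →ₗ⁅ℝ⁆ Module.End ℝ (W [⋀^Fin n]→ₗ[ℝ] M) where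
  toFun x :=
    { toFun := fun c => (φ x).compAlternatingMap c - altDer (σ x) c
      map_add' := fun c d => by
        ext w
        simp only [altDer_apply, AlternatingMap.sub_apply, AlternatingMap.add_apply,
          LinearMap.compAlternatingMap_apply, map_add, Finset.sum_add_distrib]
        abel
      map_smul' := fun r c => by
        ext w
        simp [altDer_apply, Finset.smul_sum, smul_sub] }
  map_add' x y := by
    ext c w
    simp [altDer_apply, Finset.sum_add_distrib]
    abel
  map_smul' r x := by
    ext c w
    simp [altDer_apply, Finset.smul_sum, smul_sub]
  map_lie' {x y} := by
    ext c w
    have h := congrArg (fun d => d w) (altDer_comm (σ x) (σ y) c)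
    simp only [LieHom.map_lie, Ring.lie_def, AlternatingMap.sub_apply] at h ⊢
    simp only [LinearMap.coe_mk, AddHom.coe_mk, AlternatingMap.sub_apply,
      LinearMap.compAlternatingMap_apply, LinearMap.sub_apply, Module.End.mul_apply, altDer_apply,
      map_sub, map_sum] at h ⊢
    have e : ∀ j, c (Function.update w j (σ x (σ y (w j)) - σ y (σ x (w j)))) =
      -c (Function.update w j (σ y (σ x (w j)) - σ x (σ y (w j)))) := by
      intro j
      rw [← c.map_update_neg, neg_sub]
    simp only [e, Finset.sum_neg_distrib, ← h]
    abel

theorem altRep_apply (n : ℕ) (σ : L →ₗ⁅ℝ⁆ Module.End ℝ W) (φ : L →ₗ⁅ℝ⁆ Module.End ℝ M) (x : L)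
    (c : W [⋀^Fin n]→ₗ[ℝ] M) (w : Fin n → W) :
    altRep n σ φ x c w = φ x (c w) - ∑ j, c (Function.update w j (σ x (w j))) := rfl

/-- The direct sum (finite product) of finitely many representations. -/
def piRep {ι : Type*} {N : ι → Type*} [∀ i, AddCommGroup (N i)] [∀ i, Module ℝ (N i)]
    (φ : ∀ i, L →ₗ⁅ℝ⁆ Module.End ℝ (N i)) : L →ₗ⁅ℝ⁆ Module.End ℝ (∀ i, N i) where
  toFun x := LinearMap.pi fun i => φ i x ∘ₗ LinearMap.proj i
  map_add' x y := by ext; simp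
  map_smul' r x := by ext; simp
  map_lie' {x y} := by ext; simp [Ring.lie_def]

/-- The linear map `x ↦ φ(x) ∘ c - (1/2) ∑ j, c (…, [x, ·], …)`, whose alternatization is the
coboundary of `c`. -/
def coboundaryAux (φ : L →ₗ⁅ℝ⁆ Module.End ℝ M) {n : ℕ} (c : L [⋀^Fin n]→ₗ[ℝ] M) :
    L →ₗ[ℝ] L [⋀^Fin n]→ₗ[ℝ] M where
  toFun x := (φ x).compAlternatingMap c - (1 / 2 : ℝ) • altDer (LieAlgebra.ad ℝ L x) c
  map_add' x y := by
    ext v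
    simp [altDer_apply, Finset.sum_add_distrib]
    ring_nf
    module
  map_smul' r x := by
    ext v
    simp [altDer_apply, ← Finset.smul_sum, smul_sub]
    module

theorem bracket_term_symm {n : ℕ} (c : L [⋀^Fin n]→ₗ[ℝ] M) (v : Fin (n + 1) → L)
    {i j : Fin (n + 1)} (hij : i ≠ j) :
    (-1 : ℝ) ^ (i : ℕ) • c (i.removeNth (Function.update v j ⁅v i, v j⁆)) =
      (-1 : ℝ) ^ (j : ℕ) • c (j.removeNth (Function.update v i ⁅v j, v i⁆)) := by
  have h := c.neg_one_pow_smul_map_removeNth_add_eq_zero_of_eq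
    (v := Function.update (Function.update v i ⁅v i, v j⁆) j ⁅v i, v j⁆) (i := i) (j := j)
    (by simp [Function.update_of_ne hij]) hij
  rw [Fin.removeNth_update, Function.update_comm hij, Fin.removeNth_update] at h
  obtain ⟨k, rfl⟩ := Fin.exists_succAbove_eq hij
  have e : c (j.removeNth (Function.update v (j.succAbove k) ⁅v (j.succAbove k), v j⁆)) =
      -c (j.removeNth (Function.update v (j.succAbove k) ⁅v j, v (j.succAbove k)⁆)) := by
    rw [Fin.removeNth_update_succAbove, Fin.removeNth_update_succAbove, ← lie_skew,
      AlternatingMap.map_update_neg]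
  rw [e, smul_neg, ← sub_eq_add_neg, sub_eq_zero] at h
  rcases Nat.even_or_odd (j.succAbove k : ℕ) with h1 | h1 <;>
  rcases Nat.even_or_odd (j : ℕ) with h2 | h2 <;>
  simpa [h1.neg_one_pow, h2.neg_one_pow] using h

theorem coboundaryAux_formula (φ : L →ₗ⁅ℝ⁆ Module.End ℝ M) {n : ℕ} (c : L [⋀^Fin n]→ₗ[ℝ] M)
    (v : Fin (n + 1) → L) :
    AlternatingMap.alternatizeUncurryFin (coboundaryAux φ c) v =
      ∑ i : Fin (n + 1), (-1 : ℝ) ^ (i : ℕ) • φ (v i) (c (i.removeNth v)) -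
        ∑ i : Fin (n + 1), ∑ j ∈ Finset.Ioi i,
          (-1 : ℝ) ^ (i : ℕ) • c (i.removeNth (Function.update v j ⁅v i, v j⁆)) := by
  set T : Fin (n + 1) → Fin (n + 1) → M := fun i j =>
    (-1 : ℝ) ^ (i : ℕ) • c (i.removeNth (Function.update v j ⁅v i, v j⁆)) with hT
  have hsymm : ∑ i, ∑ j ∈ Finset.Iio i, T i j = ∑ i, ∑ j ∈ Finset.Ioi i, T i j := by
    rw [Finset.sum_comm' (t' := Finset.univ) (s' := fun j => Finset.Ioi j) (by simp)]
    refine Finset.sum_congr rfl fun i _ => Finset.sum_congr rfl fun j hj => ?_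
    exact bracket_term_symm c v (Finset.mem_Ioi.1 hj).ne'
  have hsplit : ∀ i : Fin (n + 1), ∑ k : Fin n, T i (i.succAbove k) =
      ∑ j ∈ Finset.Iio i, T i j + ∑ j ∈ Finset.Ioi i, T i j := by
    intro i
    rw [← Finset.sum_union (Finset.disjoint_left.2 fun j h1 h2 =>
      lt_asymm (Finset.mem_Iio.1 h1) (Finset.mem_Ioi.1 h2))]
    have : Finset.Iio i ∪ Finset.Ioi i = Finset.univ.image i.succAbove := by
      ext j
      simp [lt_or_lt_iff_ne]
    rw [this, Finset.sum_image fun a _ b _ h => Fin.succAbove_right_injective h]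
  have hterm : ∀ i : Fin (n + 1),
      (-1 : ℤ) ^ (i : ℕ) • coboundaryAux φ c (v i) (i.removeNth v) =
      (-1 : ℝ) ^ (i : ℕ) • φ (v i) (c (i.removeNth v)) -
        (1 / 2 : ℝ) • ∑ k : Fin n, T i (i.succAbove k) := by
    intro i
    have e : (-1 : ℤ) ^ (i : ℕ) • coboundaryAux φ c (v i) (i.removeNth v) =
        (-1 : ℝ) ^ (i : ℕ) • coboundaryAux φ c (v i) (i.removeNth v) := by
      rcases Nat.even_or_odd (i : ℕ) with h | h <;> simp [h.neg_one_pow]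
    rw [e]
    simp only [coboundaryAux, LinearMap.coe_mk, AddHom.coe_mk, AlternatingMap.sub_apply,
      LinearMap.compAlternatingMap_apply, AlternatingMap.smul_apply, altDer_apply, hT,
      ← Finset.smul_sum, Fin.removeNth_update_succAbove, smul_sub]
    rw [smul_comm]
    rfl
  rw [AlternatingMap.alternatizeUncurryFin_apply, Finset.sum_congr rfl fun i _ => hterm i,
    Finset.sum_sub_distrib, ← Finset.smul_sum, Finset.sum_congr rfl fun i _ => hsplit i,
    Finset.sum_add_distrib, hsymm, ← two_smul ℝ, smul_smul]
  norm_num [hT]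

/-- The Chevalley-Eilenberg coboundary of an `n`-cochain. The term indexed by `i < j` in the second
sum is `(-1)^i c (x₀, …, x̂_i, …, [x_i, x_j], …, x_n)`, with `[x_i, x_j]` at the place of `x_j`;
moving it to the front gives the usual term `-(-1)^(i+j) c ([x_i, x_j], …, x̂_i, …, x̂_j, …)`. -/
def coboundary (φ : L →ₗ⁅ℝ⁆ Module.End ℝ M) (n : ℕ) :
    (L [⋀^Fin n]→ₗ[ℝ] M) →ₗ[ℝ] (L [⋀^Fin (n + 1)]→ₗ[ℝ] M) where
  toFun c :=
    { toFun := fun v =>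
        ∑ i : Fin (n + 1), (-1 : ℝ) ^ (i : ℕ) • φ (v i) (c (i.removeNth v)) -
          ∑ i : Fin (n + 1), ∑ j ∈ Finset.Ioi i,
            (-1 : ℝ) ^ (i : ℕ) • c (i.removeNth (Function.update v j ⁅v i, v j⁆))
      map_update_add' := by
        intro _ v i x y
        simp only [← coboundaryAux_formula, AlternatingMap.map_update_add]
      map_update_smul' := by
        intro _ v i r x
        simp only [← coboundaryAux_formula, AlternatingMap.map_update_smul]
      map_eq_zero_of_eq' := by
        intro v i j h hij
        rw [← coboundaryAux_formula]
        exact AlternatingMap.map_eq_zero_of_eq _ v h hij }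
  map_add' c d := by
    ext v
    simp [Finset.sum_add_distrib]
    abel
  map_smul' r c := by
    ext v
    simp [Finset.smul_sum, smul_sub, smul_comm r]

/-- The space `Λ(L, M) = ⨁ n, Λⁿ(L, M)` of all cochains. -/
def Cochains (L M : Type*) [LieRing L] [LieAlgebra ℝ L] [AddCommGroup M] [Module ℝ M] : Type _ :=
  DirectSum ℕ fun n => L [⋀^Fin n]→ₗ[ℝ] M

instance : AddCommGroup (Cochains L M) :=
  inferInstanceAs (AddCommGroup (DirectSum ℕ fun n => L [⋀^Fin n]→ₗ[ℝ] M))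

instance : Module ℝ (Cochains L M) :=
  inferInstanceAs (Module ℝ (DirectSum ℕ fun n => L [⋀^Fin n]→ₗ[ℝ] M))

/-- The inclusion of the `n`-cochains in the space of all cochains. -/
def Cochains.of (L M : Type*) [LieRing L] [LieAlgebra ℝ L] [AddCommGroup M] [Module ℝ M] (n : ℕ) :
    (L [⋀^Fin n]→ₗ[ℝ] M) →ₗ[ℝ] Cochains L M :=
  DirectSum.lof ℝ ℕ (fun n => L [⋀^Fin n]→ₗ[ℝ] M) n

/-- The linear map on the space of all cochains that is given by `f n` on the `n`-cochains. -/
def Cochains.lift {N : Type*} [AddCommGroup N] [Module ℝ N]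
    (f : ∀ n, (L [⋀^Fin n]→ₗ[ℝ] M) →ₗ[ℝ] N) : Cochains L M →ₗ[ℝ] N :=
  DirectSum.toModule ℝ ℕ N f

theorem Cochains.lift_of {N : Type*} [AddCommGroup N] [Module ℝ N]
    (f : ∀ n, (L [⋀^Fin n]→ₗ[ℝ] M) →ₗ[ℝ] N) (n : ℕ) (c : L [⋀^Fin n]→ₗ[ℝ] M) :
    Cochains.lift f (Cochains.of L M n c) = f n c :=
  DirectSum.toModule_lof (R := ℝ) (φ := f) n c

/-- The Chevalley-Eilenberg differential on the space of all cochains. -/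
def d (φ : L →ₗ⁅ℝ⁆ Module.End ℝ M) : Cochains L M →ₗ[ℝ] Cochains L M :=
  Cochains.lift fun n => Cochains.of L M (n + 1) ∘ₗ coboundary φ n

theorem coboundary_apply (φ : L →ₗ⁅ℝ⁆ Module.End ℝ M) (n : ℕ) (c : L [⋀^Fin n]→ₗ[ℝ] M)
    (v : Fin (n + 1) → L) :
    coboundary φ n c v =
      ∑ i : Fin (n + 1), (-1 : ℝ) ^ (i : ℕ) • φ (v i) (c (i.removeNth v)) -
        ∑ i : Fin (n + 1), ∑ j ∈ Finset.Ioi i,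
          (-1 : ℝ) ^ (i : ℕ) • c (i.removeNth (Function.update v j ⁅v i, v j⁆)) := rfl

/-- The Chevalley-Eilenberg cohomology `H(L, M)`: cocycles modulo coboundaries. -/
abbrev H (φ : L →ₗ⁅ℝ⁆ Module.End ℝ M) : Type _ :=
  LinearMap.ker (d φ) ⧸ (LinearMap.range (d φ)).submoduleOf (LinearMap.ker (d φ))

/-- The map induced in cohomology by a linear map which commutes with the differentials. -/
def cohomologyMap {L' M' : Type*} [LieRing L'] [LieAlgebra ℝ L'] [AddCommGroup M'] [Module ℝ M']
    (φ : L →ₗ⁅ℝ⁆ Module.End ℝ M) (φ' : L' →ₗ⁅ℝ⁆ Module.End ℝ M')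
    (F : Cochains L M →ₗ[ℝ] Cochains L' M') (hF : ∀ c, d φ' (F c) = F (d φ c)) :
    H φ →ₗ[ℝ] H φ' :=
  Submodule.mapQ _ _
    (F.restrict (p := LinearMap.ker (d φ)) (q := LinearMap.ker (d φ')) fun c hc => by
      rw [LinearMap.mem_ker] at hc ⊢
      rw [hF, hc, map_zero])
    (by
      rintro ⟨c, hc⟩ ⟨b, hb⟩
      exact ⟨F b, (hF b).trans (congrArg F hb)⟩)

end General

section Fields

variable {m : ℕ} {V : Type*} [NormedAddCommGroup V] [NormedSpace ℝ V]

theorem two_le_smooth : (2 : WithTop ℕ∞) ≤ ∞ :=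
  WithTop.coe_le_coe.2 (le_top : (2 : ℕ∞) ≤ ⊤)

theorem minSmoothness_le_smooth : minSmoothness ℝ 2 ≤ ∞ := by
  rw [minSmoothness_of_isRCLikeNormedField]
  exact two_le_smooth

theorem smooth_succ_le : (∞ : WithTop ℕ∞) + 1 ≤ ∞ := by exact_mod_cast le_top

theorem smooth_ne_zero : (∞ : WithTop ℕ∞) ≠ 0 := by simp

/-- The subspace of smooth functions. -/
def smoothFunctions (m : ℕ) (V : Type*) [NormedAddCommGroup V] [NormedSpace ℝ V] :
    Submodule ℝ ((Fin m → ℝ) → V) where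
  carrier := {f | ContDiff ℝ ∞ f}
  add_mem' {f g} (hf : ContDiff ℝ ∞ f) (hg : ContDiff ℝ ∞ g) := hf.add hg
  zero_mem' := contDiff_zero_fun (𝕜 := ℝ) (n := ∞)
  smul_mem' r f (hf : ContDiff ℝ ∞ f) := hf.const_smul r

/-- The space `C^∞(ℝ^m, V)` of smooth functions. -/
abbrev Smooth (m : ℕ) (V : Type*) [NormedAddCommGroup V] [NormedSpace ℝ V] : Type _ :=
  smoothFunctions m V

theorem Smooth.contDiff (f : Smooth m V) : ContDiff ℝ ∞ f.1 := f.2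

/-- The smooth vector fields on `ℝ^m`. -/
abbrev Vect (m : ℕ) : Type := Smooth m (Fin m → ℝ)

theorem Smooth.diff (f : Smooth m V) (x : Fin m → ℝ) : DifferentiableAt ℝ f.1 x :=
  (f.contDiff.differentiable smooth_ne_zero) x

theorem Smooth.fderiv_smooth (f : Smooth m V) : ContDiff ℝ ∞ (fderiv ℝ f.1) :=
  f.contDiff.fderiv_right smooth_succ_le

theorem Smooth.ext {f g : Smooth m V} (h : ∀ x, f.1 x = g.1 x) : f = g :=
  Subtype.ext (funext h)

/-- The Lie algebra of vector fields, with `[X, Y] = X^j ∂_j Y - Y^j ∂_j X`. -/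
instance : LieRing (Vect m) where
  bracket X Y := ⟨VectorField.lieBracket ℝ X.1 Y.1,
    ContDiff.lieBracket_vectorField (m := ∞) (n := ∞) X.contDiff Y.contDiff
      smooth_succ_le⟩
  add_lie X Y _ := Smooth.ext fun x => VectorField.lieBracket_add_left (X.diff x) (Y.diff x)
  lie_add _ Y Z := Smooth.ext fun x => VectorField.lieBracket_add_right (Y.diff x) (Z.diff x)
  lie_self _ := Smooth.ext fun x => congrFun VectorField.lieBracket_self x
  leibniz_lie X Y Z := Smooth.ext fun _ =>
    VectorField.leibniz_identity_lieBracket (n := ∞) minSmoothness_le_smooth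
      X.contDiff.contDiffAt Y.contDiff.contDiffAt Z.contDiff.contDiffAt

instance : LieAlgebra ℝ (Vect m) where
  lie_smul _ _ Y := Smooth.ext fun x => VectorField.lieBracket_const_smul_right (Y.diff x)

theorem Vect.lie_apply (X Y : Vect m) (x : Fin m → ℝ) :
    (⁅X, Y⁆ : Vect m).1 x = fderiv ℝ Y.1 x (X.1 x) - fderiv ℝ X.1 x (Y.1 x) := rfl

/-- The Jacobian matrix `DX = (∂_j X^i)` of a vector field at a point. -/
def jac (X : Vect m) (x : Fin m → ℝ) : Matrix (Fin m) (Fin m) ℝ :=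
  LinearMap.toMatrix' (fderiv ℝ X.1 x).toLinearMap

/-- The differential `d tr(DX)` of the divergence of a vector field at a point. -/
def dTrJac (X : Vect m) (x : Fin m → ℝ) : Module.Dual ℝ (Fin m → ℝ) :=
  (fderiv ℝ (fun y => (jac X y).trace) x).toLinearMap

variable [FiniteDimensional ℝ V]

/-- The continuous bilinear map `(D, v) ↦ ρ(D) v`. -/
def rhoL (ρ : Matrix (Fin m) (Fin m) ℝ →ₗ⁅ℝ⁆ Module.End ℝ V) :
    ((Fin m → ℝ) →L[ℝ] (Fin m → ℝ)) →L[ℝ] V →L[ℝ] V :=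
  LinearMap.toContinuousLinearMap
    ((LinearMap.toContinuousLinearMap (E := V) (F' := V) (𝕜 := ℝ)).toLinearMap ∘ₗ
      (ρ : Matrix (Fin m) (Fin m) ℝ →ₗ[ℝ] Module.End ℝ V) ∘ₗ
      (LinearMap.toMatrix' (R := ℝ) (m := Fin m) (n := Fin m)).toLinearMap ∘ₗ
      ContinuousLinearMap.coeLM ℝ)

theorem rhoL_fderiv (ρ : Matrix (Fin m) (Fin m) ℝ →ₗ⁅ℝ⁆ Module.End ℝ V) (X : Vect m)
    (x : Fin m → ℝ) (v : V) : rhoL ρ (fderiv ℝ X.1 x) v = ρ (jac X x) v := rfl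

theorem rhoL_lie (ρ : Matrix (Fin m) (Fin m) ℝ →ₗ⁅ℝ⁆ Module.End ℝ V)
    (A B : (Fin m → ℝ) →L[ℝ] (Fin m → ℝ)) (v : V) :
    rhoL ρ (A * B - B * A) v = rhoL ρ A (rhoL ρ B v) - rhoL ρ B (rhoL ρ A v) := by
  have h := congrArg (fun T : Module.End ℝ V => T v)
    (ρ.map_lie (LinearMap.toMatrix' A.toLinearMap) (LinearMap.toMatrix' B.toLinearMap))
  simp only [Ring.lie_def, ← LinearMap.toMatrix'_mul] at h
  rw [← map_sub] at h
  exact h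

theorem fderiv_lie (X Y : Vect m) (x : Fin m → ℝ) :
    fderiv ℝ (⁅X, Y⁆ : Vect m).1 x =
      fderiv ℝ (fderiv ℝ Y.1) x (X.1 x) - fderiv ℝ (fderiv ℝ X.1) x (Y.1 x) -
        (fderiv ℝ X.1 x * fderiv ℝ Y.1 x - fderiv ℝ Y.1 x * fderiv ℝ X.1 x) := by
  have hX := X.fderiv_smooth.differentiable smooth_ne_zero x
  have hY := Y.fderiv_smooth.differentiable smooth_ne_zero x
  have sX : IsSymmSndFDerivAt ℝ X.1 x := X.contDiff.contDiffAt.isSymmSndFDerivAt minSmoothness_le_smooth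
  have sY : IsSymmSndFDerivAt ℝ Y.1 x := Y.contDiff.contDiffAt.isSymmSndFDerivAt minSmoothness_le_smooth
  have e : (⁅X, Y⁆ : Vect m).1 = fun x => fderiv ℝ Y.1 x (X.1 x) - fderiv ℝ X.1 x (Y.1 x) := rfl
  rw [e, fderiv_fun_sub (hY.clm_apply (X.diff x)) (hX.clm_apply (Y.diff x)),
    fderiv_clm_apply hY (X.diff x), fderiv_clm_apply hX (Y.diff x)]
  ext1 v
  simp only [sub_apply, add_apply,
    ContinuousLinearMap.comp_apply, ContinuousLinearMap.flip_apply,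
    mul_apply_eq_comp, sX.eq v (Y.1 x), sY.eq v (X.1 x)]
  abel

/-- The natural Lie derivative `L_X f = X.f - ρ(DX) f` of `V`-valued functions. -/
def lieDeriv (ρ : Matrix (Fin m) (Fin m) ℝ →ₗ⁅ℝ⁆ Module.End ℝ V) :
    Vect m →ₗ⁅ℝ⁆ Module.End ℝ (Smooth m V) where
  toFun X :=
    { toFun := fun f => ⟨fun x => fderiv ℝ f.1 x (X.1 x) - ρ (jac X x) (f.1 x),
        (f.fderiv_smooth.clm_apply X.contDiff).sub
          (((rhoL ρ).contDiff.comp X.fderiv_smooth).clm_apply f.contDiff)⟩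
      map_add' := fun f g => Smooth.ext fun x => by
        change fderiv ℝ (f.1 + g.1) x (X.1 x) - ρ (jac X x) (f.1 x + g.1 x) =
          fderiv ℝ f.1 x (X.1 x) - ρ (jac X x) (f.1 x) +
          (fderiv ℝ g.1 x (X.1 x) - ρ (jac X x) (g.1 x))
        rw [fderiv_add (f.diff x) (g.diff x), add_apply, map_add]
        abel
      map_smul' := fun r f => Smooth.ext fun x => by
        change fderiv ℝ (r • f.1) x (X.1 x) - ρ (jac X x) (r • f.1 x) =
          r • (fderiv ℝ f.1 x (X.1 x) - ρ (jac X x) (f.1 x))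
        rw [fderiv_const_smul (f.diff x), smul_apply, map_smul, smul_sub] }
  map_add' X Y := LinearMap.ext fun f => Smooth.ext fun x => by
    change fderiv ℝ f.1 x (X.1 x + Y.1 x) - rhoL ρ (fderiv ℝ (X.1 + Y.1) x) (f.1 x) =
      fderiv ℝ f.1 x (X.1 x) - rhoL ρ (fderiv ℝ X.1 x) (f.1 x) +
      (fderiv ℝ f.1 x (Y.1 x) - rhoL ρ (fderiv ℝ Y.1 x) (f.1 x))
    rw [fderiv_add (X.diff x) (Y.diff x), map_add, map_add, add_apply]
    abel
  map_smul' r X := LinearMap.ext fun f => Smooth.ext fun x => by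
    change fderiv ℝ f.1 x (r • X.1 x) - rhoL ρ (fderiv ℝ (r • X.1) x) (f.1 x) =
      r • (fderiv ℝ f.1 x (X.1 x) - rhoL ρ (fderiv ℝ X.1 x) (f.1 x))
    rw [fderiv_const_smul (X.diff x), map_smul, map_smul, smul_apply, smul_sub]
  map_lie' {X Y} := LinearMap.ext fun f => Smooth.ext fun x => by
    have second : ∀ X Y : Vect m,
        fderiv ℝ (fun x => fderiv ℝ f.1 x (Y.1 x) - rhoL ρ (fderiv ℝ Y.1 x) (f.1 x)) x (X.1 x) =
        fderiv ℝ (fun x => fderiv ℝ f.1 x (Y.1 x)) x (X.1 x) -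
          (rhoL ρ (fderiv ℝ Y.1 x) (fderiv ℝ f.1 x (X.1 x)) +
            rhoL ρ (fderiv ℝ (fderiv ℝ Y.1) x (X.1 x)) (f.1 x)) := by
      intro X Y
      have hY := Y.fderiv_smooth.differentiable smooth_ne_zero x
      have hf := f.fderiv_smooth.differentiable smooth_ne_zero x
      have hR : HasFDerivAt (fun x => rhoL ρ (fderiv ℝ Y.1 x))
          (rhoL ρ ∘L fderiv ℝ (fderiv ℝ Y.1) x) x :=
        (rhoL ρ).hasFDerivAt.comp x hY.hasFDerivAt
      rw [fderiv_fun_sub (hf.clm_apply (Y.diff x)) (hR.differentiableAt.clm_apply (f.diff x)),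
        fderiv_clm_apply hR.differentiableAt (f.diff x), hR.fderiv]
      rfl
    change fderiv ℝ f.1 x (VectorField.lieBracket ℝ X.1 Y.1 x) -
        rhoL ρ (fderiv ℝ (⁅X, Y⁆ : Vect m).1 x) (f.1 x) =
      (fderiv ℝ (fun x => fderiv ℝ f.1 x (Y.1 x) - rhoL ρ (fderiv ℝ Y.1 x) (f.1 x)) x (X.1 x) -
        rhoL ρ (fderiv ℝ X.1 x)
          (fderiv ℝ f.1 x (Y.1 x) - rhoL ρ (fderiv ℝ Y.1 x) (f.1 x))) -
      (fderiv ℝ (fun x => fderiv ℝ f.1 x (X.1 x) - rhoL ρ (fderiv ℝ X.1 x) (f.1 x)) x (Y.1 x) -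
        rhoL ρ (fderiv ℝ Y.1 x)
          (fderiv ℝ f.1 x (X.1 x) - rhoL ρ (fderiv ℝ X.1 x) (f.1 x)))
    rw [second, second, fderiv_lie, VectorField.fderiv_apply_lieBracket (n := ∞) f.contDiff.contDiffAt
      minSmoothness_le_smooth (Y.diff x) (X.diff x)]
    simp only [map_sub, sub_apply]
    have h := rhoL_lie ρ (fderiv ℝ X.1 x) (fderiv ℝ Y.1 x) (f.1 x)
    simp only [map_sub, sub_apply] at h
    rw [h]
    abel

theorem lieDeriv_apply (ρ : Matrix (Fin m) (Fin m) ℝ →ₗ⁅ℝ⁆ Module.End ℝ V) (X : Vect m)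
    (f : Smooth m V) (x : Fin m → ℝ) :
    (lieDeriv ρ X f).1 x = fderiv ℝ f.1 x (X.1 x) - ρ (jac X x) (f.1 x) := rfl

end Fields

section Projective

variable {m : ℕ} {V : Type*} [NormedAddCommGroup V] [NormedSpace ℝ V]

/-- The projective realization `sl_{m+1} = ℝ^m ⊕ gl(m, ℝ) ⊕ ℝ^{m*}` of `sl(m+1, ℝ)`; an element is
a triple `(h, A, α)`. -/
def ProjSl (m : ℕ) : Type :=
  (Fin m → ℝ) × Matrix (Fin m) (Fin m) ℝ × Module.Dual ℝ (Fin m → ℝ)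

instance : AddCommGroup (ProjSl m) :=
  inferInstanceAs (AddCommGroup
    ((Fin m → ℝ) × Matrix (Fin m) (Fin m) ℝ × Module.Dual ℝ (Fin m → ℝ)))

instance : Module ℝ (ProjSl m) :=
  inferInstanceAs (Module ℝ
    ((Fin m → ℝ) × Matrix (Fin m) (Fin m) ℝ × Module.Dual ℝ (Fin m → ℝ)))

/-- The matrix of `h ⊗ α : x ↦ α(x) h`. -/
def tens (h : Fin m → ℝ) (α : Module.Dual ℝ (Fin m → ℝ)) : Matrix (Fin m) (Fin m) ℝ :=
  LinearMap.toMatrix' (α.smulRight h)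

theorem tens_mulVec (h : Fin m → ℝ) (α : Module.Dual ℝ (Fin m → ℝ)) (x : Fin m → ℝ) :
    (tens h α).mulVec x = α x • h := by
  rw [tens, LinearMap.toMatrix'_mulVec]
  rfl

/-- The bracket for which `ℝ^m` and `ℝ^{m*}` are abelian, `gl(m, ℝ)` is a subalgebra acting
naturally on both, and `[h, α] = α(h) 1 + h ⊗ α`. -/
instance : Bracket (ProjSl m) (ProjSl m) where
  bracket S T :=
    (S.2.1.mulVec T.1 - T.2.1.mulVec S.1,
      ⁅S.2.1, T.2.1⁆ + (T.2.2 S.1 • (1 : Matrix (Fin m) (Fin m) ℝ) + tens S.1 T.2.2)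
        - (S.2.2 T.1 • (1 : Matrix (Fin m) (Fin m) ℝ) + tens T.1 S.2.2),
      S.2.2 ∘ₗ Matrix.toLin' T.2.1 - T.2.2 ∘ₗ Matrix.toLin' S.2.1)

/-- The fundamental vector field `T* = -h^i ∂_i - A^i_j x^j ∂_i + α(x) x^i ∂_i` of
`T = (h, A, α)`, as a linear map. -/
def starL (m : ℕ) : ProjSl m →ₗ[ℝ] Vect m where
  toFun T := ⟨fun x => -T.1 - T.2.1.mulVec x + T.2.2 x • x, by
    change ContDiff ℝ ∞ _
    have hA : ContDiff ℝ ∞ fun x : Fin m → ℝ => T.2.1.mulVec x :=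
      (LinearMap.toContinuousLinearMap (Matrix.toLin' T.2.1)).contDiff
    have hα : ContDiff ℝ ∞ fun x : Fin m → ℝ => T.2.2 x :=
      (LinearMap.toContinuousLinearMap T.2.2).contDiff
    exact (contDiff_const.sub hA).add (hα.smul contDiff_id)⟩
  map_add' S T := Smooth.ext fun x => by
    change -(S.1 + T.1) - (S.2.1 + T.2.1).mulVec x + (S.2.2 x + T.2.2 x) • x =
      (-S.1 - S.2.1.mulVec x + S.2.2 x • x) + (-T.1 - T.2.1.mulVec x + T.2.2 x • x)
    rw [Matrix.add_mulVec, add_smul]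
    abel
  map_smul' r T := Smooth.ext fun x => by
    change -(r • T.1) - (r • T.2.1).mulVec x + (r * T.2.2 x) • x =
      r • (-T.1 - T.2.1.mulVec x + T.2.2 x • x)
    rw [Matrix.smul_mulVec, mul_smul, smul_add, smul_sub, smul_neg]

theorem starL_apply (T : ProjSl m) (x : Fin m → ℝ) :
    (starL m T).1 x = -T.1 - T.2.1.mulVec x + T.2.2 x • x := rfl

theorem fderiv_starL (T : ProjSl m) (x v : Fin m → ℝ) :
    fderiv ℝ (starL m T).1 x v = -T.2.1.mulVec v + (T.2.2 x • v + T.2.2 v • x) := by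
  have hA : HasFDerivAt (fun x : Fin m → ℝ => T.2.1.mulVec x)
      (LinearMap.toContinuousLinearMap (Matrix.toLin' T.2.1)) x :=
    (LinearMap.toContinuousLinearMap (Matrix.toLin' T.2.1)).hasFDerivAt
  have hα : HasFDerivAt (fun x : Fin m → ℝ => T.2.2 x)
      (LinearMap.toContinuousLinearMap T.2.2) x :=
    (LinearMap.toContinuousLinearMap T.2.2).hasFDerivAt
  have h : HasFDerivAt (starL m T).1 _ x := (hA.const_sub (-T.1)).add (hα.smul (hasFDerivAt_id x))
  rw [h.fderiv]
  rfl

theorem starL_lie (S T : ProjSl m) : starL m ⁅S, T⁆ = ⁅starL m S, starL m T⁆ := by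
  refine Smooth.ext fun x => ?_
  rw [Vect.lie_apply, fderiv_starL, fderiv_starL, starL_apply, starL_apply, starL_apply]
  change -(S.2.1.mulVec T.1 - T.2.1.mulVec S.1) -
      (⁅S.2.1, T.2.1⁆ + (T.2.2 S.1 • (1 : Matrix (Fin m) (Fin m) ℝ) + tens S.1 T.2.2)
        - (S.2.2 T.1 • (1 : Matrix (Fin m) (Fin m) ℝ) + tens T.1 S.2.2)).mulVec x +
      (S.2.2 (T.2.1.mulVec x) - T.2.2 (S.2.1.mulVec x)) • x = _
  simp only [Ring.lie_def, Matrix.add_mulVec, Matrix.sub_mulVec, Matrix.smul_mulVec,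
    Matrix.one_mulVec, tens_mulVec, Matrix.mulVec_add, Matrix.mulVec_sub, Matrix.mulVec_neg,
    Matrix.mulVec_smul, ← Matrix.mulVec_mulVec, map_add, map_sub, map_neg, map_smul, smul_eq_mul]
  module

theorem starL_injective : Function.Injective (starL m) := by
  rw [← LinearMap.ker_eq_bot, LinearMap.ker_eq_bot']
  intro T hT
  have h : ∀ x, -T.1 - T.2.1.mulVec x + T.2.2 x • x = 0 := fun x =>
    congrFun (congrArg Subtype.val hT) x
  have h0 : T.1 = 0 := by simpa using h 0
  have hA : ∀ x, T.2.1.mulVec x = 0 := by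
    intro x
    have h1 := h x
    have h2 := h (-x)
    simp only [h0, Matrix.mulVec_neg, map_neg, neg_smul_neg] at h1 h2
    have : (2 : ℝ) • T.2.1.mulVec x = 0 := by
      rw [two_smul, ← sub_eq_zero.2 (h2.trans h1.symm)]
      abel
    simpa using this
  have hα : ∀ x, T.2.2 x = 0 := by
    intro x
    have h1 := h x
    rw [h0, hA x] at h1
    simp only [neg_zero, sub_zero, zero_add, smul_eq_zero] at h1
    rcases h1 with h1 | h1
    · exact h1
    · rw [h1, map_zero]
  refine Prod.ext h0 (Prod.ext ?_ (LinearMap.ext hα))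
  exact Matrix.toLin'.injective (LinearMap.ext fun x => (hA x).trans (Matrix.zero_mulVec x).symm)

instance : LieRing (ProjSl m) where
  add_lie S T U := starL_injective (by simp only [starL_lie, map_add, add_lie])
  lie_add S T U := starL_injective (by simp only [starL_lie, map_add, lie_add])
  lie_self S := starL_injective (by rw [starL_lie, lie_self, map_zero])
  leibniz_lie S T U := starL_injective (by
    simp only [starL_lie, map_add]
    exact leibniz_lie _ _ _)

instance : LieAlgebra ℝ (ProjSl m) where
  lie_smul r S T := starL_injective (by simp only [starL_lie, map_smul, lie_smul])

/-- The projective embedding `T ↦ T*` of `sl_{m+1}` in the Lie algebra of vector fields. -/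
def star (m : ℕ) : ProjSl m →ₗ⁅ℝ⁆ Vect m :=
  { starL m with map_lie' := fun {S T} => starL_lie S T }

theorem star_apply (T : ProjSl m) (x : Fin m → ℝ) :
    (star m T).1 x = -T.1 - T.2.1.mulVec x + T.2.2 x • x := rfl

theorem jac_star (T : ProjSl m) (x : Fin m → ℝ) :
    jac (star m T) x = -T.2.1 + (T.2.2 x • (1 : Matrix (Fin m) (Fin m) ℝ) + tens x T.2.2) := by
  refine Matrix.toLin'.injective (LinearMap.ext fun v => ?_)
  simp only [jac, Matrix.toLin'_toMatrix', Matrix.toLin'_apply, Matrix.add_mulVec,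
    Matrix.neg_mulVec, Matrix.smul_mulVec, Matrix.one_mulVec, tens_mulVec]
  exact fderiv_starL T x v

theorem trace_tens (h : Fin m → ℝ) (α : Module.Dual ℝ (Fin m → ℝ)) :
    (tens h α).trace = α h := by
  have : (α h : ℝ) = ∑ i, h i • α (Pi.single i 1) := by
    conv_lhs => rw [← Finset.univ_sum_single h, map_sum]
    refine Finset.sum_congr rfl fun i _ => ?_
    rw [← map_smul, ← Pi.single_smul, smul_eq_mul, mul_one]
  rw [this]
  refine Finset.sum_congr rfl fun i _ => ?_
  simp [tens, LinearMap.toMatrix'_apply, mul_comm]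

theorem dTrJac_star (T : ProjSl m) (x : Fin m → ℝ) :
    dTrJac (star m T) x = ((m : ℝ) + 1) • T.2.2 := by
  have e : (fun y => (jac (star m T) y).trace) =
      fun y => -T.2.1.trace + ((m : ℝ) + 1) * T.2.2 y := by
    funext y
    rw [jac_star, Matrix.trace_add, Matrix.trace_add, Matrix.trace_neg, Matrix.trace_smul,
      trace_tens, Matrix.trace_one, Fintype.card_fin, smul_eq_mul]
    ring
  have hα : HasFDerivAt (fun x : Fin m → ℝ => T.2.2 x)
      (LinearMap.toContinuousLinearMap T.2.2) x :=
    (LinearMap.toContinuousLinearMap T.2.2).hasFDerivAt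
  rw [dTrJac, e, ((hα.const_mul ((m : ℝ) + 1)).const_add (-T.2.1.trace)).fderiv]
  rfl

theorem jac_star_add (S T : ProjSl m) (x : Fin m → ℝ) :
    jac (star m (S + T)) x = jac (star m S) x + jac (star m T) x := by
  rw [map_add]
  change LinearMap.toMatrix' (fderiv ℝ ((star m S).1 + (star m T).1) x).toLinearMap = _
  rw [fderiv_add ((star m S).diff x) ((star m T).diff x)]
  exact map_add _ _ _

theorem jac_star_smul (r : ℝ) (T : ProjSl m) (x : Fin m → ℝ) :
    jac (star m (r • T)) x = r • jac (star m T) x := by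
  rw [map_smul]
  change LinearMap.toMatrix' (fderiv ℝ (r • (star m T).1) x).toLinearMap = _
  rw [fderiv_const_smul ((star m T).diff x)]
  exact map_smul _ _ _

theorem dTrJac_star_add (S T : ProjSl m) (x : Fin m → ℝ) :
    dTrJac (star m (S + T)) x = dTrJac (star m S) x + dTrJac (star m T) x := by
  simp only [dTrJac_star]
  exact smul_add _ _ _

theorem dTrJac_star_smul (r : ℝ) (T : ProjSl m) (x : Fin m → ℝ) :
    dTrJac (star m (r • T)) x = r • dTrJac (star m T) x := by
  simp only [dTrJac_star]
  exact smul_comm _ _ _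

theorem contDiff_jac_star (T : ProjSl m) (l : Matrix (Fin m) (Fin m) ℝ →ₗ[ℝ] ℝ) :
    ContDiff ℝ ∞ fun x => l (jac (star m T) x) := by
  have h1 : ContDiff ℝ ∞ fun x : Fin m → ℝ => T.2.2 x :=
    (LinearMap.toContinuousLinearMap T.2.2).contDiff
  have h2 : ContDiff ℝ ∞ fun x : Fin m → ℝ => l (tens x T.2.2) :=
    (LinearMap.toContinuousLinearMap
      (l ∘ₗ (LinearMap.toMatrix' (R := ℝ) (m := Fin m) (n := Fin m)).toLinearMap ∘ₗ
        LinearMap.smulRightₗ T.2.2)).contDiff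
  simp only [jac_star, map_add, map_smul]
  exact contDiff_const.add ((h1.smul contDiff_const).add h2)

theorem update_castAdd {α β : Type*} {t u : ℕ} (F : α → β) (T : Fin (t + u) → α) (k : Fin t)
    (X : α) : (fun i => F (Function.update T (Fin.castAdd u k) X (Fin.castAdd u i))) =
      Function.update (fun i => F (T (Fin.castAdd u i))) k (F X) := by
  funext i
  rcases eq_or_ne i k with rfl | h
  · simp
  · rw [Function.update_of_ne h, Function.update_of_ne (by simpa [Fin.ext_iff] using h)]

theorem update_natAdd {α β : Type*} {t u : ℕ} (F : α → β) (T : Fin (t + u) → α) (k : Fin u)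
    (X : α) : (fun i => F (Function.update T (Fin.natAdd t k) X (Fin.natAdd t i))) =
      Function.update (fun i => F (T (Fin.natAdd t i))) k (F X) := by
  funext i
  rcases eq_or_ne i k with rfl | h
  · simp
  · rw [Function.update_of_ne h, Function.update_of_ne (by simpa [Fin.ext_iff] using h)]

theorem update_castAdd_natAdd {α : Type*} {t u : ℕ} (T : Fin (t + u) → α) (k : Fin t) (X : α)
    (i : Fin u) : Function.update T (Fin.castAdd u k) X (Fin.natAdd t i) = T (Fin.natAdd t i) :=
  Function.update_of_ne (fun h => by
    have h1 := congrArg Fin.val h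
    have h2 := k.isLt
    simp only [Fin.val_natAdd, Fin.val_castAdd] at h1
    omega) _ _

theorem update_natAdd_castAdd {α : Type*} {t u : ℕ} (T : Fin (t + u) → α) (k : Fin u) (X : α)
    (i : Fin t) : Function.update T (Fin.natAdd t k) X (Fin.castAdd u i) = T (Fin.castAdd u i) :=
  Function.update_of_ne (fun h => by
    have h1 := congrArg Fin.val h
    have h2 := i.isLt
    simp only [Fin.val_natAdd, Fin.val_castAdd] at h1
    omega) _ _

/-- A multilinear expression in families of vectors with smooth coordinates is smooth. -/
theorem contDiff_multilinear {E : Type*} [AddCommGroup E] [Module ℝ E] [FiniteDimensional ℝ E]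
    {t : ℕ} (f : MultilinearMap ℝ (fun _ : Fin t => E) V) (g : Fin t → (Fin m → ℝ) → E)
    (hg : ∀ i (l : E →ₗ[ℝ] ℝ), ContDiff ℝ ∞ fun x => l (g i x)) :
    ContDiff ℝ ∞ fun x => f fun i => g i x := by
  set b := Module.finBasis ℝ E
  have e : (fun x => f fun i => g i x) = fun x =>
      ∑ r : Fin t → Fin (Module.finrank ℝ E), (∏ i, b.coord (r i) (g i x)) • f fun i => b (r i) := by
    funext x
    conv_lhs => rw [show (fun i => g i x) = fun i => ∑ j, b.coord j (g i x) • b j from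
      funext fun i => (b.sum_repr (g i x)).symm]
    rw [f.map_sum]
    exact Finset.sum_congr rfl fun r _ => f.map_smul_univ _ _
  rw [e]
  refine ContDiff.sum fun r _ => ContDiff.smul (contDiff_prod fun i _ => hg i _) contDiff_const

/-- The natural representation of `gl(m, ℝ)` on `ℝ^{m*}`: `A · α = -α ∘ A`. -/
def dualRep (m : ℕ) :
    Matrix (Fin m) (Fin m) ℝ →ₗ⁅ℝ⁆ Module.End ℝ (Module.Dual ℝ (Fin m → ℝ)) where
  toFun A :=
    { toFun := fun α => -(α ∘ₗ Matrix.toLin' A)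
      map_add' := fun α β => by ext; simp; ring
      map_smul' := fun r α => by ext; simp }
  map_add' A B := by ext α i; simp; ring
  map_smul' r A := by ext α i; simp
  map_lie' {A B} := by
    ext α i
    simp [Ring.lie_def]

/-- The space `Λ(ℝ^{m*}, V) = ⨁_{0 ≤ u ≤ m} Λ^u(ℝ^{m*}, V)` of alternating multilinear maps from
`ℝ^{m*}` to `V`. -/
abbrev ExtDual (m : ℕ) (V : Type*) [AddCommGroup V] [Module ℝ V] : Type _ :=
  ∀ u : Fin (m + 1), Module.Dual ℝ (Fin m → ℝ) [⋀^Fin u]→ₗ[ℝ] V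

/-- The representation of `gl(m, ℝ)` on `Λ(ℝ^{m*}, V)` deduced from `ρ` and the natural action on
`ℝ^{m*}`. -/
def glRep (ρ : Matrix (Fin m) (Fin m) ℝ →ₗ⁅ℝ⁆ Module.End ℝ V) :
    Matrix (Fin m) (Fin m) ℝ →ₗ⁅ℝ⁆ Module.End ℝ (ExtDual m V) :=
  piRep fun u => altRep u (dualRep m) ρ

/-- The representation of `sl_{m+1}` on `C^∞(ℝ^m, V)` by the natural Lie derivative. -/
def slRep [FiniteDimensional ℝ V] (ρ : Matrix (Fin m) (Fin m) ℝ →ₗ⁅ℝ⁆ Module.End ℝ V) :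
    ProjSl m →ₗ⁅ℝ⁆ Module.End ℝ (Smooth m V) :=
  (lieDeriv ρ).comp (star m)

/-- The multilinear map
`(X₀, …, X_{t+u-1}) ↦ γ(DX₀, …, DX_{t-1})(d tr(DX_t), …, d tr(DX_{t+u-1}))`. -/
def chiCore {t u : ℕ}
    (γ : Matrix (Fin m) (Fin m) ℝ [⋀^Fin t]→ₗ[ℝ] (Module.Dual ℝ (Fin m → ℝ) [⋀^Fin u]→ₗ[ℝ] V)) :
    MultilinearMap ℝ (fun _ : Fin (t + u) => ProjSl m) (Smooth m V) where
  toFun T := ⟨fun x => γ (fun i => jac (star m (T (Fin.castAdd u i))) x)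
      (fun j => dTrJac (star m (T (Fin.natAdd t j))) x), by
    change ContDiff ℝ ∞ _
    simp only [dTrJac_star]
    let ev : (Module.Dual ℝ (Fin m → ℝ) [⋀^Fin u]→ₗ[ℝ] V) →ₗ[ℝ] V :=
      { toFun := fun β => β fun j => ((m : ℝ) + 1) • (T (Fin.natAdd t j)).2.2
        map_add' := fun _ _ => rfl
        map_smul' := fun _ _ => rfl }
    exact contDiff_multilinear (ev.compMultilinearMap γ.toMultilinearMap)
      (fun i x => jac (star m (T (Fin.castAdd u i))) x) fun i l => contDiff_jac_star _ l⟩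
  map_update_add' := by
    intro inst T k X Y
    obtain rfl : inst = instDecidableEqFin (t + u) := Subsingleton.elim _ _
    refine Smooth.ext fun x => ?_
    refine Fin.addCases (fun k => ?_) (fun k => ?_) k
    · change γ (fun i => jac (star m _) x) _ = γ (fun i => jac (star m _) x) _ +
        γ (fun i => jac (star m _) x) _
      simp only [update_castAdd_natAdd, update_castAdd (fun S => jac (star m S) x), jac_star_add,
        γ.map_update_add, AlternatingMap.add_apply]
    · change γ _ (fun i => dTrJac (star m _) x) = γ _ (fun i => dTrJac (star m _) x) +
        γ _ (fun i => dTrJac (star m _) x)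
      simp only [update_natAdd_castAdd, update_natAdd (fun S => dTrJac (star m S) x),
        dTrJac_star_add, AlternatingMap.map_update_add]
  map_update_smul' := by
    intro inst T k r X
    obtain rfl : inst = instDecidableEqFin (t + u) := Subsingleton.elim _ _
    refine Smooth.ext fun x => ?_
    refine Fin.addCases (fun k => ?_) (fun k => ?_) k
    · change γ (fun i => jac (star m _) x) _ = r • γ (fun i => jac (star m _) x) _
      simp only [update_castAdd_natAdd, update_castAdd (fun S => jac (star m S) x), jac_star_smul,
        γ.map_update_smul, AlternatingMap.smul_apply]
    · change γ _ (fun i => dTrJac (star m _) x) = r • γ _ (fun i => dTrJac (star m _) x)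
      simp only [update_natAdd_castAdd, update_natAdd (fun S => dTrJac (star m S) x),
        dTrJac_star_smul, AlternatingMap.map_update_smul]

/-- The map `χ^u` on the `t`-cochains:
`χ^u(γ)(X₀, …, X_{t+u-1}) = (-1)^t / (t! u! (m+1)^u)
  ∑_ν sign(ν) γ(DX_{ν₀}, …, DX_{ν_{t-1}})(d tr(DX_{ν_t}), …, d tr(DX_{ν_{t+u-1}}))`,
where `ν` runs through the permutations of the `t + u` indices. -/
def chiU (m : ℕ) (V : Type*) [NormedAddCommGroup V] [NormedSpace ℝ V] (t u : ℕ) :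
    (Matrix (Fin m) (Fin m) ℝ [⋀^Fin t]→ₗ[ℝ] (Module.Dual ℝ (Fin m → ℝ) [⋀^Fin u]→ₗ[ℝ] V)) →ₗ[ℝ]
      (ProjSl m [⋀^Fin (t + u)]→ₗ[ℝ] Smooth m V) where
  toFun γ := ((-1 : ℝ) ^ t / (t.factorial * u.factorial * ((m : ℝ) + 1) ^ u)) •
    MultilinearMap.alternatization (chiCore γ)
  map_add' γ δ := by
    have : chiCore (γ + δ) = chiCore γ + chiCore δ := rfl
    rw [this, map_add, smul_add]
  map_smul' r γ := by
    have : chiCore (r • γ) = r • chiCore γ := rfl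
    rw [this, RingHom.id_apply, smul_comm r]
    congr 1
    ext1 T
    simp only [MultilinearMap.alternatization_apply, AlternatingMap.smul_apply,
      Finset.smul_sum]
    refine Finset.sum_congr rfl fun ν _ => ?_
    rw [smul_comm]
    rfl

theorem chiU_apply (t u : ℕ)
    (γ : Matrix (Fin m) (Fin m) ℝ [⋀^Fin t]→ₗ[ℝ] (Module.Dual ℝ (Fin m → ℝ) [⋀^Fin u]→ₗ[ℝ] V))
    (T : Fin (t + u) → ProjSl m) (x : Fin m → ℝ) :
    (chiU m V t u γ T).1 x =
      ((-1 : ℝ) ^ t / (t.factorial * u.factorial * ((m : ℝ) + 1) ^ u)) •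
        ∑ ν : Equiv.Perm (Fin (t + u)), Equiv.Perm.sign ν •
          γ (fun i => jac (star m (T (ν (Fin.castAdd u i)))) x)
            (fun j => dTrJac (star m (T (ν (Fin.natAdd t j)))) x) := by
  have h : MultilinearMap.alternatization (chiCore γ) T =
      ∑ ν : Equiv.Perm (Fin (t + u)), Equiv.Perm.sign ν • chiCore γ fun i => T (ν i) :=
    MultilinearMap.alternatization_apply _ _
  change ((-1 : ℝ) ^ t / (t.factorial * u.factorial * ((m : ℝ) + 1) ^ u)) •
    (MultilinearMap.alternatization (chiCore γ) T).1 x = _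
  rw [h]
  congr 1
  simp only [Submodule.coe_sum, Finset.sum_apply]
  rfl

/-- The map `χ` on `Λ(gl(m, ℝ), Λ(ℝ^{m*}, V))` that reduces to `χ^u` on
`Λ(gl(m, ℝ), Λ^u(ℝ^{m*}, V))`. -/
def chi (m : ℕ) (V : Type*) [NormedAddCommGroup V] [NormedSpace ℝ V] :
    Cochains (Matrix (Fin m) (Fin m) ℝ) (ExtDual m V) →ₗ[ℝ] Cochains (ProjSl m) (Smooth m V) :=
  Cochains.lift fun t => ∑ u : Fin (m + 1),
    Cochains.of (ProjSl m) (Smooth m V) (t + u) ∘ₗ chiU m V t u ∘ₗ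
      LinearMap.compAlternatingMapₗ ℝ (LinearMap.proj u)

end Projective

end ProjCoh

end

/-! The argument is a Shapiro lemma for the isotropy algebra at the origin, `gl(m, ℝ) ⊕ ℝ^{m*}`,
made explicit by the translations of `ℝ^m`.

Translating a projective field by `x` gives another one, `shift x X`, whose value and Jacobian at
`x` are those of `X` at the origin, namely `-h` and `-A`. A cochain `c` is therefore rewritten in a
moving frame by `gauge`: `(X₀, …) ↦ (x ↦ c(shift x X₀, …)(x))`. The derivative of `shift x X` in the
direction `h` is `shift x [h, X]`, so differentiating the frame produces exactly the brackets with
`ℝ^m`, and these cancel in the coboundary. What remains (`gauge_coboundary`) is the de Rham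
differential in the `ℝ^m` arguments, up to sign, plus the Chevalley–Eilenberg differential of the
isotropy algebra acting on `V`, with `ℝ^{m*}` acting by zero.

The de Rham factor is contracted by the usual radial homotopy of the Poincaré lemma. Cartan's
formula and integration over `s ∈ [0, 1]` give `∂h + h∂ = id - basicPart` (`homotopy_succ`, and
`homotopy_zero` in degree zero). Here `basicPart` projects on the cochains that, in the moving
frame, are constant and vanish as soon as one argument lies in `ℝ^m`. Such a cochain is an
alternating map from the isotropy algebra to `V`.

Since `ℝ^{m*}` is an abelian ideal of the isotropy algebra that acts trivially on `V`, these
alternating maps split as the sum of the `Λ^t(gl(m, ℝ), Λ^u(ℝ^{m*}, V))`, with the differential of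
`gl(m, ℝ)` (`restr_coboundary_succ`, `restr_coboundary_zero`). Restriction to the isotropy algebra
and evaluation at the origin define a chain map `retraction`. The normalization of `χ` makes
`retraction ∘ χ = id` (`retraction_chi`), while `χ ∘ retraction` is `basicPart` (`chi_retraction`).
As `basicPart` commutes with `∂`, so does `χ`. In cohomology `retraction` is then a left inverse of
`χ`, and the homotopy makes it a right inverse. -/

noncomputable section

namespace ProjCoh

/-! ### The coboundary computed with any bilinear map that antisymmetrizes to the bracket. -/

section AntisymmetricPart

variable {L M : Type*} [LieRing L] [LieAlgebra ℝ L] [AddCommGroup M] [Module ℝ M]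

/-- Putting `w` at both places `i` and `j` gives a tuple with a repeated entry. For such a tuple the
two signed values obtained by deleting one of the repeated entries cancel. -/
theorem removeNth_update_antisymm {n : ℕ} (c : L [⋀^Fin n]→ₗ[ℝ] M) (v : Fin (n + 1) → L)
    {i j : Fin (n + 1)} (hij : i ≠ j) (w : L) :
    (-1 : ℝ) ^ (i : ℕ) • c (i.removeNth (Function.update v j w)) =
      -((-1 : ℝ) ^ (j : ℕ) • c (j.removeNth (Function.update v i w))) := by
  have h := c.neg_one_pow_smul_map_removeNth_add_eq_zero_of_eq
    (v := Function.update (Function.update v i w) j w) (i := i) (j := j)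
    (by simp [Function.update_of_ne hij]) hij
  rw [Fin.removeNth_update, Function.update_comm hij, Fin.removeNth_update] at h
  rw [eq_neg_iff_add_eq_zero]
  rcases Nat.even_or_odd (i : ℕ) with h1 | h1 <;>
  rcases Nat.even_or_odd (j : ℕ) with h2 | h2 <;>
  simpa [h1.neg_one_pow, h2.neg_one_pow] using h

/-- The alternatization of `x ↦ altDer (β x) c`. -/
def altSum {n : ℕ} (β : L →ₗ[ℝ] Module.End ℝ L) (c : L [⋀^Fin n]→ₗ[ℝ] M) (v : Fin (n + 1) → L) : M :=
  ∑ i : Fin (n + 1), (-1 : ℝ) ^ (i : ℕ) • altDer (β (v i)) c (i.removeNth v)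

theorem altSum_eq {n : ℕ} (β : L →ₗ[ℝ] Module.End ℝ L) (c : L [⋀^Fin n]→ₗ[ℝ] M)
    (v : Fin (n + 1) → L) : altSum β c v = ∑ i : Fin (n + 1), ∑ j ∈ Finset.univ.erase i,
      (-1 : ℝ) ^ (i : ℕ) • c (i.removeNth (Function.update v j (β (v i) (v j)))) := by
  refine Finset.sum_congr rfl fun i _ => ?_
  rw [altDer_apply, Finset.smul_sum]
  have : Finset.univ.erase i = Finset.univ.image i.succAbove := by
    ext j
    simp
  rw [this, Finset.sum_image fun a _ b _ h => Fin.succAbove_right_injective h]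
  refine Finset.sum_congr rfl fun k _ => ?_
  rw [Fin.removeNth_update_succAbove]
  rfl

/-- Exchanging the roles of the deleted index and of the modified index changes the sign of each
term, by `removeNth_update_antisymm`. -/
theorem altSum_flip {n : ℕ} (β : L →ₗ[ℝ] Module.End ℝ L) (c : L [⋀^Fin n]→ₗ[ℝ] M)
    (v : Fin (n + 1) → L) : altSum β.flip c v = -altSum β c v := by
  rw [altSum_eq, altSum_eq, ← Finset.sum_neg_distrib]
  rw [Finset.sum_comm' (t' := Finset.univ) (s' := fun k => Finset.univ.erase k) (by simp [eq_comm])]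
  refine Finset.sum_congr rfl fun j _ => ?_
  rw [← Finset.sum_neg_distrib]
  refine Finset.sum_congr rfl fun i hi => ?_
  rw [removeNth_update_antisymm c v (Finset.ne_of_mem_erase hi), LinearMap.flip_apply]

theorem altSum_sub {n : ℕ} (β γ : L →ₗ[ℝ] Module.End ℝ L) (c : L [⋀^Fin n]→ₗ[ℝ] M)
    (v : Fin (n + 1) → L) : altSum (β - γ) c v = altSum β c v - altSum γ c v := by
  rw [altSum_eq, altSum_eq, altSum_eq, ← Finset.sum_sub_distrib]
  refine Finset.sum_congr rfl fun i _ => ?_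
  rw [← Finset.sum_sub_distrib]
  refine Finset.sum_congr rfl fun j hj => ?_
  obtain ⟨k, rfl⟩ := Fin.exists_succAbove_eq (Finset.ne_of_mem_erase hj)
  simp only [Fin.removeNth_update_succAbove, LinearMap.sub_apply, AlternatingMap.map_update_sub,
    smul_sub]

/-- `altSum β c` depends only on the antisymmetric part of `β`. -/
theorem altSum_congr {n : ℕ} {β γ : L →ₗ[ℝ] Module.End ℝ L} (h : ∀ x y, β x y - β y x = γ x y - γ y x)
    (c : L [⋀^Fin n]→ₗ[ℝ] M) (v : Fin (n + 1) → L) : altSum β c v = altSum γ c v := by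
  -- The difference is symmetric, so its `altSum` is equal to its own opposite.
  have e : (β - γ).flip = β - γ := by
    ext x y
    simp only [LinearMap.flip_apply, LinearMap.sub_apply]
    have := h x y
    rw [sub_eq_sub_iff_add_eq_add] at this ⊢
    rw [add_comm (β y x), ← this, add_comm]
  have h1 := altSum_flip (β - γ) c v
  rw [e, altSum_sub, eq_neg_iff_add_eq_zero, ← two_smul ℝ, smul_eq_zero, sub_eq_zero] at h1
  exact h1.resolve_left two_ne_zero

/-- The Chevalley-Eilenberg coboundary, with the bracket replaced by any bilinear map whose
antisymmetrization is the bracket. -/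
theorem coboundary_eq_of_antisymm (φ : L →ₗ⁅ℝ⁆ Module.End ℝ M) {β : L →ₗ[ℝ] Module.End ℝ L}
    (h : ∀ x y, β x y - β y x = ⁅x, y⁆) {n : ℕ} (c : L [⋀^Fin n]→ₗ[ℝ] M) (v : Fin (n + 1) → L) :
    coboundary φ n c v = ∑ i : Fin (n + 1), (-1 : ℝ) ^ (i : ℕ) •
      (φ (v i) (c (i.removeNth v)) - altDer (β (v i)) c (i.removeNth v)) := by
  -- Half the adjoint map is the choice built into `coboundaryAux`; it has the same
  -- antisymmetrization as `β`.
  have h2 : ∀ x y : L, ((1 / 2 : ℝ) • (LieAlgebra.ad ℝ L : L →ₗ[ℝ] Module.End ℝ L)) x y -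
      ((1 / 2 : ℝ) • (LieAlgebra.ad ℝ L : L →ₗ[ℝ] Module.End ℝ L)) y x = β x y - β y x := by
    intro x y
    rw [h]
    simp only [LinearMap.smul_apply, LieHom.coe_toLinearMap, LieAlgebra.ad_apply]
    rw [← lie_skew x y]
    module
  have h3 := altSum_congr h2 c v
  simp only [smul_sub, Finset.sum_sub_distrib]
  change _ = _ - altSum β c v
  rw [← h3, coboundary_apply, ← coboundaryAux_formula, AlternatingMap.alternatizeUncurryFin_apply,
    altSum, ← Finset.sum_sub_distrib]
  refine Finset.sum_congr rfl fun i _ => ?_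
  have e : ∀ z : M, (-1 : ℤ) ^ (i : ℕ) • z = (-1 : ℝ) ^ (i : ℕ) • z := by
    intro z
    rcases Nat.even_or_odd (i : ℕ) with h | h <;> simp [h.neg_one_pow]
  rw [e, ← smul_sub]
  congr 1
  simp only [coboundaryAux, LinearMap.coe_mk, AddHom.coe_mk, AlternatingMap.sub_apply,
    LinearMap.compAlternatingMap_apply, AlternatingMap.smul_apply, altDer_apply, Finset.smul_sum,
    LinearMap.smul_apply, AlternatingMap.map_update_smul]
  rfl

end AntisymmetricPart

/-! ### Smoothness and differentiation of cochains along families of arguments. -/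

section Families

variable {m : ℕ} {V : Type*} [NormedAddCommGroup V] [NormedSpace ℝ V]
  {L : Type*} [AddCommGroup L] [Module ℝ L]

/-- The evaluation of smooth functions at a point. -/
def Smooth.eval (x : Fin m → ℝ) : Smooth m V →ₗ[ℝ] V :=
  LinearMap.proj x ∘ₗ (smoothFunctions m V).subtype

@[simp] theorem Smooth.eval_apply (x : Fin m → ℝ) (f : Smooth m V) : Smooth.eval x f = f.1 x := rfl

/-- The alternating map with values in the smooth functions that is given pointwise. -/
def ofPointwise {n : ℕ} (F : (Fin m → ℝ) → L [⋀^Fin n]→ₗ[ℝ] V)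
    (hF : ∀ v, ContDiff ℝ ∞ fun x => F x v) : L [⋀^Fin n]→ₗ[ℝ] Smooth m V where
  toFun v := ⟨fun x => F x v, hF v⟩
  map_update_add' v _ _ _ := Smooth.ext fun x => (F x).map_update_add v _ _ _
  map_update_smul' v _ _ _ := Smooth.ext fun x => (F x).map_update_smul v _ _ _
  map_eq_zero_of_eq' v _ _ h hij := Smooth.ext fun x => (F x).map_eq_zero_of_eq v h hij

theorem cochain_ext {n : ℕ} {c c' : L [⋀^Fin n]→ₗ[ℝ] Smooth m V}
    (h : ∀ v x, (c v).1 x = (c' v).1 x) : c = c' :=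
  AlternatingMap.ext fun v => Smooth.ext fun x => h v x

/-- This reduces the analysis of a cochain with values in functions to finite sums of coordinate
products times fixed functions, so that no topology on the function space enters. -/
theorem multilinear_basis_expansion {W : Type*} [AddCommGroup W] [Module ℝ W] {κ : Type*} [Fintype κ]
    (b : Module.Basis κ ℝ L) {n : ℕ} (c : MultilinearMap ℝ (fun _ : Fin n => L) W) (v : Fin n → L) :
    c v = ∑ r : Fin n → κ, (∏ i, b.coord (r i) (v i)) • c fun i => b (r i) := by
  classical
  conv_lhs => rw [show v = fun i => ∑ j, b.coord j (v i) • b j from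
    funext fun i => (b.sum_repr (v i)).symm]
  rw [c.map_sum]
  exact Finset.sum_congr rfl fun r _ => c.map_smul_univ _ _

variable [FiniteDimensional ℝ L]

theorem contDiff_apply_family {E : Type*} [NormedAddCommGroup E] [NormedSpace ℝ E] {n : ℕ}
    (c : L [⋀^Fin n]→ₗ[ℝ] Smooth m V) (g : Fin n → E → L)
    (hg : ∀ i (l : L →ₗ[ℝ] ℝ), ContDiff ℝ ∞ fun e => l (g i e)) {y : E → Fin m → ℝ}
    (hy : ContDiff ℝ ∞ y) : ContDiff ℝ ∞ fun e => (c fun i => g i e).1 (y e) := by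
  have e : (fun e => (c fun i => g i e).1 (y e)) = fun e =>
      ∑ r : Fin n → Fin (Module.finrank ℝ L),
        (∏ i, (Module.finBasis ℝ L).coord (r i) (g i e)) •
          (c fun i => Module.finBasis ℝ L (r i)).1 (y e) := by
    funext e
    have := congrArg (Smooth.eval (y e))
      (multilinear_basis_expansion (Module.finBasis ℝ L) c.toMultilinearMap fun i => g i e)
    rw [map_sum] at this
    exact this
  rw [e]
  exact ContDiff.sum fun r _ => (contDiff_prod fun i _ => hg i _).smul
    ((Smooth.contDiff _).comp hy)

/-- Leibniz rule: the point of evaluation and each argument of the cochain move together.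
Differentiability of the arguments is tested on linear forms. -/
theorem hasDerivAt_apply_family {n : ℕ} (c : L [⋀^Fin n]→ₗ[ℝ] Smooth m V) {g : Fin n → ℝ → L}
    {g' : Fin n → L} {s : ℝ}
    (hg : ∀ i (l : L →ₗ[ℝ] ℝ), HasDerivAt (fun τ => l (g i τ)) (l (g' i)) s)
    {y : ℝ → Fin m → ℝ} {y' : Fin m → ℝ} (hy : HasDerivAt y y' s) :
    HasDerivAt (fun τ => (c fun i => g i τ).1 (y τ))
      (fderiv ℝ (c fun i => g i s).1 (y s) y' +
        ∑ j, (c (Function.update (fun i => g i s) j (g' j))).1 (y s)) s := by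
  set b := Module.finBasis ℝ L
  have expand : ∀ (v : Fin n → L) (x : Fin m → ℝ), (c v).1 x =
      ∑ r : Fin n → Fin (Module.finrank ℝ L), (∏ i, b.coord (r i) (v i)) •
        (c fun i => b (r i)).1 x := by
    intro v x
    have := congrArg (Smooth.eval x) (multilinear_basis_expansion b c.toMultilinearMap v)
    rw [map_sum] at this
    exact this
  have e1 : (fun τ => (c fun i => g i τ).1 (y τ)) = fun τ =>
      ∑ r : Fin n → Fin (Module.finrank ℝ L), (∏ i, b.coord (r i) (g i τ)) •
        (c fun i => b (r i)).1 (y τ) := funext fun τ => expand _ _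
  have e2 : fderiv ℝ (c fun i => g i s).1 (y s) y' =
      ∑ r : Fin n → Fin (Module.finrank ℝ L), (∏ i, b.coord (r i) (g i s)) •
        fderiv ℝ (c fun i => b (r i)).1 (y s) y' := by
    rw [show (c fun i => g i s).1 = fun x => ∑ r : Fin n → Fin (Module.finrank ℝ L),
      (∏ i, b.coord (r i) (g i s)) • (c fun i => b (r i)).1 x from funext fun x => expand _ _]
    have hs : HasFDerivAt (fun x => ∑ r : Fin n → Fin (Module.finrank ℝ L),
        (∏ i, b.coord (r i) (g i s)) • (c fun i => b (r i)).1 x)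
        (∑ r : Fin n → Fin (Module.finrank ℝ L),
          (∏ i, b.coord (r i) (g i s)) • fderiv ℝ (c fun i => b (r i)).1 (y s)) (y s) :=
      HasFDerivAt.fun_sum fun r _ => (Smooth.diff _ _).hasFDerivAt.fun_const_smul _
    rw [hs.fderiv]
    simp only [sum_apply, smul_apply]
  have e3 : ∑ j, (c (Function.update (fun i => g i s) j (g' j))).1 (y s) =
      ∑ r : Fin n → Fin (Module.finrank ℝ L),
        (∑ j, (∏ i ∈ Finset.univ.erase j, b.coord (r i) (g i s)) • b.coord (r j) (g' j)) •
          (c fun i => b (r i)).1 (y s) := by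
    rw [Finset.sum_congr rfl fun j _ => expand (Function.update (fun i => g i s) j (g' j)) (y s),
      Finset.sum_comm]
    refine Finset.sum_congr rfl fun r _ => ?_
    rw [Finset.sum_smul]
    refine Finset.sum_congr rfl fun j _ => ?_
    congr 1
    rw [← Finset.mul_prod_erase _ _ (Finset.mem_univ j), Function.update_self, mul_comm, smul_eq_mul]
    congr 1
    refine Finset.prod_congr rfl fun i hi => ?_
    rw [Function.update_of_ne (Finset.ne_of_mem_erase hi)]
  rw [e1, e2, e3, ← Finset.sum_add_distrib]
  refine HasDerivAt.fun_sum fun r _ => ?_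
  exact (HasDerivAt.fun_finsetProd fun i _ => hg i (b.coord (r i))).smul
    ((Smooth.diff _ _).hasFDerivAt.comp_hasDerivAt s hy)

end Families

/-! ### The frame of translated fields and the coboundary in it. -/

section Gauge

variable {m : ℕ} {V : Type*} [NormedAddCommGroup V] [NormedSpace ℝ V]

instance : FiniteDimensional ℝ (ProjSl m) :=
  inferInstanceAs (FiniteDimensional ℝ
    ((Fin m → ℝ) × Matrix (Fin m) (Fin m) ℝ × Module.Dual ℝ (Fin m → ℝ)))

theorem tens_smul_left (r : ℝ) (h : Fin m → ℝ) (α : Module.Dual ℝ (Fin m → ℝ)) :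
    tens (r • h) α = r • tens h α := by
  refine Matrix.toLin'.injective (LinearMap.ext fun v => ?_)
  simp [tens_mulVec, smul_comm r]

theorem tens_add_right (h : Fin m → ℝ) (α β : Module.Dual ℝ (Fin m → ℝ)) :
    tens h (α + β) = tens h α + tens h β := by
  refine Matrix.toLin'.injective (LinearMap.ext fun v => ?_)
  simp [tens_mulVec, add_smul]

theorem tens_smul_right (r : ℝ) (h : Fin m → ℝ) (α : Module.Dual ℝ (Fin m → ℝ)) :
    tens h (r • α) = r • tens h α := by
  refine Matrix.toLin'.injective (LinearMap.ext fun v => ?_)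
  simp [tens_mulVec, mul_smul]

/-- The inclusion of `ℝ^m` in `sl_{m+1}`. -/
def ofVec (m : ℕ) : (Fin m → ℝ) →ₗ[ℝ] ProjSl m := LinearMap.inl ℝ _ _

/-- The projection of `sl_{m+1}` to `ℝ^m`. -/
def vecPart (m : ℕ) : ProjSl m →ₗ[ℝ] (Fin m → ℝ) := LinearMap.fst ℝ _ _

/-- The inclusion of `gl(m, ℝ)` in `sl_{m+1}`. -/
def ofMat (m : ℕ) : Matrix (Fin m) (Fin m) ℝ →ₗ[ℝ] ProjSl m :=
  LinearMap.inr ℝ _ _ ∘ₗ LinearMap.inl ℝ _ _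

/-- The inclusion of `ℝ^{m*}` in `sl_{m+1}`. -/
def ofDual (m : ℕ) : Module.Dual ℝ (Fin m → ℝ) →ₗ[ℝ] ProjSl m :=
  LinearMap.inr ℝ _ _ ∘ₗ LinearMap.inr ℝ _ _

theorem ofVec_add_ofMat_add_ofDual (X : ProjSl m) :
    ofVec m X.1 + ofMat m X.2.1 + ofDual m X.2.2 = X := by
  refine Prod.ext ?_ (Prod.ext ?_ ?_)
  · change X.1 + 0 + 0 = X.1
    simp
  · change 0 + X.2.1 + 0 = X.2.1
    simp
  · change 0 + 0 + X.2.2 = X.2.2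
    simp

/-- The multiplication by `s` on the component in `ℝ^m`. -/
def dilate (m : ℕ) (s : ℝ) : ProjSl m →ₗ[ℝ] ProjSl m :=
  LinearMap.prodMap (s • LinearMap.id) LinearMap.id

theorem dilate_eq (s : ℝ) (X : ProjSl m) :
    dilate m s X = X + (s - 1) • ofVec m X.1 := by
  refine Prod.ext ?_ (Prod.ext ?_ ?_)
  · change s • X.1 = X.1 + (s - 1) • X.1
    module
  · change X.2.1 = X.2.1 + (s - 1) • 0
    simp
  · change X.2.2 = X.2.2 + (s - 1) • 0
    simp

/-- The pull-back of an element of `sl_{m+1}` by the translation `y ↦ y - x`. -/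
def shift (x : Fin m → ℝ) : ProjSl m →ₗ[ℝ] ProjSl m where
  toFun X := (X.1 - X.2.1.mulVec x - X.2.2 x • x,
    X.2.1 + (X.2.2 x • (1 : Matrix (Fin m) (Fin m) ℝ) + tens x X.2.2), X.2.2)
  map_add' X Y := by
    refine Prod.ext ?_ (Prod.ext ?_ rfl)
    · change (X.1 + Y.1) - (X.2.1 + Y.2.1).mulVec x - (X.2.2 x + Y.2.2 x) • x =
        (X.1 - X.2.1.mulVec x - X.2.2 x • x) + (Y.1 - Y.2.1.mulVec x - Y.2.2 x • x)
      rw [Matrix.add_mulVec]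
      module
    · change (X.2.1 + Y.2.1) + ((X.2.2 x + Y.2.2 x) • 1 + tens x (X.2.2 + Y.2.2)) =
        (X.2.1 + (X.2.2 x • 1 + tens x X.2.2)) + (Y.2.1 + (Y.2.2 x • 1 + tens x Y.2.2))
      rw [tens_add_right]
      module
  map_smul' r X := by
    refine Prod.ext ?_ (Prod.ext ?_ rfl)
    · change (r • X.1) - (r • X.2.1).mulVec x - (r * X.2.2 x) • x =
        r • (X.1 - X.2.1.mulVec x - X.2.2 x • x)
      rw [Matrix.smul_mulVec]
      module
    · change (r • X.2.1) + ((r * X.2.2 x) • 1 + tens x (r • X.2.2)) =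
        r • (X.2.1 + (X.2.2 x • 1 + tens x X.2.2))
      rw [tens_smul_right]
      module

/-- Identifies the algebraic formula for `shift` with translation of vector fields. Together with
the injectivity of the embedding it yields the group law and the compatibility with brackets. -/
theorem star_shift (X : ProjSl m) (x y : Fin m → ℝ) :
    (starL m (shift x X)).1 y = (starL m X).1 (y - x) := by
  rw [starL_apply, starL_apply]
  change -(X.1 - X.2.1.mulVec x - X.2.2 x • x) -
    (X.2.1 + (X.2.2 x • (1 : Matrix (Fin m) (Fin m) ℝ) + tens x X.2.2)).mulVec y + X.2.2 y • y = _
  simp only [Matrix.add_mulVec, Matrix.smul_mulVec, Matrix.one_mulVec, tens_mulVec,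
    Matrix.mulVec_sub, map_sub]
  module

theorem shift_shift (X : ProjSl m) (x y : Fin m → ℝ) : shift x (shift y X) = shift (x + y) X :=
  starL_injective (Smooth.ext fun z => by
    rw [star_shift, star_shift, star_shift, sub_sub])

@[simp] theorem shift_zero (X : ProjSl m) : shift 0 X = X :=
  starL_injective (Smooth.ext fun z => by rw [star_shift, sub_zero])

theorem shift_lie (X Y : ProjSl m) (x : Fin m → ℝ) : shift x ⁅X, Y⁆ = ⁅shift x X, shift x Y⁆ := by
  have h : ∀ (X : ProjSl m) (y v : Fin m → ℝ),
      fderiv ℝ (starL m (shift x X)).1 y v = fderiv ℝ (starL m X).1 (y - x) v := by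
    intro X y v
    rw [show (starL m (shift x X)).1 = fun y => (starL m X).1 (y - x) from
      funext fun y => star_shift X x y, fderiv_comp_sub]
  refine starL_injective (Smooth.ext fun y => ?_)
  rw [star_shift, starL_lie, starL_lie, Vect.lie_apply, Vect.lie_apply, h, h, star_shift, star_shift]

/-- With `jac_star_shift` and `jac_star_zero`, this shows that `L_X` acts at `x`, in the translated
frame, through the constant vector `-h` and the constant matrix `-A`. -/
theorem star_shift_self (X : ProjSl m) (x : Fin m → ℝ) : (star m (shift x X)).1 x = -X.1 := by
  change (starL m (shift x X)).1 x = -X.1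
  rw [star_shift, sub_self, starL_apply]
  simp

theorem jac_star_zero (X : ProjSl m) : jac (star m X) 0 = -X.2.1 := by
  rw [jac_star]
  have : tens (0 : Fin m → ℝ) X.2.2 = 0 := by
    simpa using tens_smul_left 0 0 X.2.2
  simp [this]

theorem jac_star_shift (X : ProjSl m) (x y : Fin m → ℝ) :
    jac (star m (shift x X)) y = jac (star m X) (y - x) := by
  change LinearMap.toMatrix' (fderiv ℝ (starL m (shift x X)).1 y).toLinearMap =
    LinearMap.toMatrix' (fderiv ℝ (starL m X).1 (y - x)).toLinearMap
  rw [show (starL m (shift x X)).1 = fun y => (starL m X).1 (y - x) from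
      funext fun y => star_shift X x y, fderiv_comp_sub]

theorem contDiff_linear_vec {W : Type*} [NormedAddCommGroup W] [NormedSpace ℝ W]
    (l : (Fin m → ℝ) →ₗ[ℝ] W) : ContDiff ℝ ∞ fun x => l x :=
  (LinearMap.toContinuousLinearMap l).contDiff

theorem shift_eq (X : ProjSl m) (x : Fin m → ℝ) :
    shift x X = X + (ofMat m (X.2.2 x • 1 + tens x X.2.2) - ofVec m (X.2.1.mulVec x)) -
      X.2.2 x • ofVec m x := by
  refine Prod.ext ?_ (Prod.ext ?_ ?_)
  · change X.1 - X.2.1.mulVec x - X.2.2 x • x = X.1 + (0 - X.2.1.mulVec x) - X.2.2 x • x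
    abel
  · change X.2.1 + (X.2.2 x • 1 + tens x X.2.2) =
      X.2.1 + ((X.2.2 x • 1 + tens x X.2.2) - 0) - X.2.2 x • 0
    simp
  · change X.2.2 = X.2.2 + (0 - 0) - X.2.2 x • 0
    simp

theorem ofVec_lie (h : Fin m → ℝ) (X : ProjSl m) :
    ⁅ofVec m h, X⁆ = ofMat m (X.2.2 h • 1 + tens h X.2.2) - ofVec m (X.2.1.mulVec h) := by
  have e : tens X.1 (0 : Module.Dual ℝ (Fin m → ℝ)) = 0 := by
    simpa using tens_smul_right 0 X.1 0
  refine Prod.ext ?_ (Prod.ext ?_ ?_)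
  · change (0 : Matrix (Fin m) (Fin m) ℝ).mulVec X.1 - X.2.1.mulVec h = 0 - X.2.1.mulVec h
    simp
  · change ⁅(0 : Matrix (Fin m) (Fin m) ℝ), X.2.1⁆ + (X.2.2 h • (1 : Matrix (Fin m) (Fin m) ℝ) +
      tens h X.2.2) - ((0 : ℝ) • 1 + tens X.1 0) = X.2.2 h • 1 + tens h X.2.2 - 0
    rw [e]
    simp
  · change (0 : Module.Dual ℝ (Fin m → ℝ)) ∘ₗ Matrix.toLin' X.2.1 -
      X.2.2 ∘ₗ Matrix.toLin' (0 : Matrix (Fin m) (Fin m) ℝ) = 0 - 0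
    simp

theorem contDiff_shift (X : ProjSl m) (l : ProjSl m →ₗ[ℝ] ℝ) :
    ContDiff ℝ ∞ fun x => l (shift x X) := by
  have h1 := contDiff_linear_vec X.2.2
  have h2 := contDiff_linear_vec (l ∘ₗ ofVec m)
  have h3 := contDiff_linear_vec (l ∘ₗ ofVec m ∘ₗ Matrix.toLin' X.2.1)
  have h4 := contDiff_linear_vec (l ∘ₗ ofMat m ∘ₗ
    (LinearMap.toMatrix' (R := ℝ) (m := Fin m) (n := Fin m)).toLinearMap ∘ₗ
    LinearMap.smulRightₗ X.2.2)
  simp only [shift_eq, map_add, map_sub, map_smul]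
  exact (contDiff_const.add (((h1.smul contDiff_const).add h4).sub h3)).sub (h1.smul h2)

/-- The infinitesimal translation by `h` is the adjoint action of the constant field attached to
`h`. This makes the frame absorb the brackets with `ℝ^m`. -/
theorem hasDerivAt_shift (X : ProjSl m) (x h : Fin m → ℝ) (l : ProjSl m →ₗ[ℝ] ℝ) :
    HasDerivAt (fun τ : ℝ => l (shift (x + τ • h) X)) (l (shift x ⁅ofVec m h, X⁆)) 0 := by
  -- Projective fields are quadratic, so the translation is a polynomial of degree two in `τ`; only
  -- its linear part contributes at `τ = 0`.
  have e : ∀ τ : ℝ, shift (τ • h) X =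
      X + (τ • ⁅ofVec m h, X⁆ - (τ * τ) • (X.2.2 h • ofVec m h)) := by
    intro τ
    rw [shift_eq, ofVec_lie, tens_smul_left, Matrix.mulVec_smul]
    simp only [map_smul, map_add, smul_eq_mul]
    module
  simp only [← shift_shift, e, map_add, map_sub, map_smul, smul_eq_mul]
  have h1 := (hasDerivAt_id' (0 : ℝ)).mul_const (l (shift x ⁅ofVec m h, X⁆))
  have h2 := ((hasDerivAt_id' (0 : ℝ)).mul (hasDerivAt_id' (0 : ℝ))).mul_const
    (X.2.2 h * l (shift x (ofVec m h)))
  simpa using (h1.sub h2).const_add (l (shift x X))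

/-- The bilinear map `(X, Y) ↦ (0, [A, B] / 2, -β ∘ A)` for `X = (h, A, α)` and `Y = (k, B, β)`,
whose antisymmetrization is the bracket of `gl(m, ℝ) ⊕ ℝ^{m*}`. -/
def halfBracket (m : ℕ) : ProjSl m →ₗ[ℝ] Module.End ℝ (ProjSl m) :=
  LinearMap.mk₂ ℝ (fun X Y => ofMat m ((1 / 2 : ℝ) • ⁅X.2.1, Y.2.1⁆) +
      ofDual m (dualRep m X.2.1 Y.2.2))
    (fun X X' Y => by
      change ofMat m ((1 / 2 : ℝ) • ⁅X.2.1 + X'.2.1, Y.2.1⁆) +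
        ofDual m (dualRep m (X.2.1 + X'.2.1) Y.2.2) = _
      simp only [add_lie, map_add, LinearMap.add_apply, smul_add]
      abel)
    (fun r X Y => by
      change ofMat m ((1 / 2 : ℝ) • ⁅r • X.2.1, Y.2.1⁆) +
        ofDual m (dualRep m (r • X.2.1) Y.2.2) = _
      simp only [smul_lie, map_smul, LinearMap.smul_apply, smul_add]
      module)
    (fun X Y Y' => by
      change ofMat m ((1 / 2 : ℝ) • ⁅X.2.1, Y.2.1 + Y'.2.1⁆) +
        ofDual m (dualRep m X.2.1 (Y.2.2 + Y'.2.2)) = _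
      simp only [lie_add, map_add, smul_add]
      abel)
    (fun r X Y => by
      change ofMat m ((1 / 2 : ℝ) • ⁅X.2.1, r • Y.2.1⁆) +
        ofDual m (dualRep m X.2.1 (r • Y.2.2)) = _
      simp only [lie_smul, map_smul, smul_add]
      module)

theorem halfBracket_apply (X Y : ProjSl m) : halfBracket m X Y =
    ofMat m ((1 / 2 : ℝ) • ⁅X.2.1, Y.2.1⁆) + ofDual m (dualRep m X.2.1 Y.2.2) := rfl

/-- A bilinear map whose antisymmetrization is the bracket of `sl_{m+1}`. -/
def gaugeBracket (m : ℕ) : ProjSl m →ₗ[ℝ] Module.End ℝ (ProjSl m) :=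
  (LieAlgebra.ad ℝ (ProjSl m) : ProjSl m →ₗ[ℝ] Module.End ℝ (ProjSl m)) ∘ₗ ofVec m ∘ₗ
    vecPart m + halfBracket m

theorem gaugeBracket_apply (X Y : ProjSl m) :
    gaugeBracket m X Y = ⁅ofVec m X.1, Y⁆ + halfBracket m X Y := rfl

/-- Brackets involving `ℝ^m` come from the first summand, and those of `gl(m, ℝ) ⊕ ℝ^{m*}` from
`halfBracket`. The choice is deliberately asymmetric: the first summand matches the derivative of
the frame, and matrices act on covectors but not conversely, as in the representation on
`Λ^u(ℝ^{m*}, V)`. -/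
theorem gaugeBracket_antisymm (X Y : ProjSl m) :
    gaugeBracket m X Y - gaugeBracket m Y X = ⁅X, Y⁆ := by
  rw [gaugeBracket_apply, gaugeBracket_apply, halfBracket_apply, halfBracket_apply, ofVec_lie,
    ofVec_lie]
  refine Prod.ext ?_ (Prod.ext ?_ ?_)
  · change (0 - Y.2.1.mulVec X.1 + (0 + 0)) - (0 - X.2.1.mulVec Y.1 + (0 + 0)) =
      X.2.1.mulVec Y.1 - Y.2.1.mulVec X.1
    abel
  · change ((Y.2.2 X.1 • 1 + tens X.1 Y.2.2) - 0 + ((1 / 2 : ℝ) • ⁅X.2.1, Y.2.1⁆ + 0)) -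
      ((X.2.2 Y.1 • 1 + tens Y.1 X.2.2) - 0 + ((1 / 2 : ℝ) • ⁅Y.2.1, X.2.1⁆ + 0)) =
      ⁅X.2.1, Y.2.1⁆ + (Y.2.2 X.1 • (1 : Matrix (Fin m) (Fin m) ℝ) + tens X.1 Y.2.2)
        - (X.2.2 Y.1 • (1 : Matrix (Fin m) (Fin m) ℝ) + tens Y.1 X.2.2)
    rw [← lie_skew Y.2.1 X.2.1]
    module
  · change (0 - 0 + (0 + -(Y.2.2 ∘ₗ Matrix.toLin' X.2.1))) -
      (0 - 0 + (0 + -(X.2.2 ∘ₗ Matrix.toLin' Y.2.1))) =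
      X.2.2 ∘ₗ Matrix.toLin' Y.2.1 - Y.2.2 ∘ₗ Matrix.toLin' X.2.1
    abel

/-- The pull-back `c ↦ ((X₀, …) ↦ (x ↦ c(B_x X₀, …)(y(x))))` of cochains. -/
def pull {n : ℕ} (y : (Fin m → ℝ) → (Fin m → ℝ)) (hy : ContDiff ℝ ∞ y)
    (B : (Fin m → ℝ) → ProjSl m →ₗ[ℝ] ProjSl m)
    (hB : ∀ X (l : ProjSl m →ₗ[ℝ] ℝ), ContDiff ℝ ∞ fun x => l (B x X)) :
    (ProjSl m [⋀^Fin n]→ₗ[ℝ] Smooth m V) →ₗ[ℝ] (ProjSl m [⋀^Fin n]→ₗ[ℝ] Smooth m V) where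
  toFun c := ofPointwise
    (fun x => ((Smooth.eval (y x)).compAlternatingMap c).compLinearMap (B x))
    (fun v => contDiff_apply_family c (fun i x => B x (v i)) (fun i l => hB (v i) l) hy)
  map_add' _ _ := rfl
  map_smul' _ _ := rfl

/-- The change of frame that trivializes the bracket with constant vector fields. -/
def gauge (m : ℕ) (V : Type*) [NormedAddCommGroup V] [NormedSpace ℝ V] (n : ℕ) :
    (ProjSl m [⋀^Fin n]→ₗ[ℝ] Smooth m V) →ₗ[ℝ] (ProjSl m [⋀^Fin n]→ₗ[ℝ] Smooth m V) :=
  pull (fun x => x) contDiff_id shift contDiff_shift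

/-- The inverse of `gauge`. -/
def ungauge (m : ℕ) (V : Type*) [NormedAddCommGroup V] [NormedSpace ℝ V] (n : ℕ) :
    (ProjSl m [⋀^Fin n]→ₗ[ℝ] Smooth m V) →ₗ[ℝ] (ProjSl m [⋀^Fin n]→ₗ[ℝ] Smooth m V) :=
  pull (fun x => x) contDiff_id (fun x => shift (-x)) fun X l => (contDiff_shift X l).comp contDiff_neg

theorem gauge_apply {n : ℕ} (c : ProjSl m [⋀^Fin n]→ₗ[ℝ] Smooth m V) (v : Fin n → ProjSl m)
    (x : Fin m → ℝ) : (gauge m V n c v).1 x = (c fun i => shift x (v i)).1 x := rfl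

theorem ungauge_apply {n : ℕ} (c : ProjSl m [⋀^Fin n]→ₗ[ℝ] Smooth m V) (v : Fin n → ProjSl m)
    (x : Fin m → ℝ) : (ungauge m V n c v).1 x = (c fun i => shift (-x) (v i)).1 x := rfl

@[simp] theorem ungauge_gauge {n : ℕ} (c : ProjSl m [⋀^Fin n]→ₗ[ℝ] Smooth m V) :
    ungauge m V n (gauge m V n c) = c :=
  cochain_ext fun v x => by simp [ungauge_apply, gauge_apply, shift_shift]

@[simp] theorem gauge_ungauge {n : ℕ} (c : ProjSl m [⋀^Fin n]→ₗ[ℝ] Smooth m V) :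
    gauge m V n (ungauge m V n c) = c :=
  cochain_ext fun v x => by simp [ungauge_apply, gauge_apply, shift_shift]

theorem fderiv_eq_of_hasDerivAt (f : Smooth m V) {x h : Fin m → ℝ} {w : V}
    (hf : HasDerivAt (fun τ : ℝ => f.1 (x + τ • h)) w 0) : fderiv ℝ f.1 x h = w := by
  have h1 : HasDerivAt (fun τ : ℝ => x + τ • h) h 0 := by
    simpa using ((hasDerivAt_id' (0 : ℝ)).smul_const h).const_add x
  have h2 : HasFDerivAt f.1 (fderiv ℝ f.1 x) (x + (0 : ℝ) • h) := by
    simpa using (f.diff x).hasFDerivAt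
  exact (h2.comp_hasDerivAt 0 h1).unique hf

/-- The point `x` occurs both as point of evaluation and in the frame. The second dependence yields
the brackets, by `hasDerivAt_shift`. -/
theorem fderiv_gauge {n : ℕ} (c : ProjSl m [⋀^Fin n]→ₗ[ℝ] Smooth m V) (v : Fin n → ProjSl m)
    (x h : Fin m → ℝ) : fderiv ℝ (gauge m V n c v).1 x h =
      fderiv ℝ (c fun i => shift x (v i)).1 x h +
        ∑ j, (gauge m V n c (Function.update v j ⁅ofVec m h, v j⁆)).1 x := by
  have h1 : HasDerivAt (fun τ : ℝ => x + τ • h) h 0 := by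
    simpa using ((hasDerivAt_id' (0 : ℝ)).smul_const h).const_add x
  have := hasDerivAt_apply_family c (g := fun i τ => shift (x + τ • h) (v i))
    (fun i l => hasDerivAt_shift (v i) x h l) h1
  rw [zero_smul, add_zero] at this
  rw [fderiv_eq_of_hasDerivAt _ this]
  congr 1
  refine Finset.sum_congr rfl fun j _ => ?_
  rw [gauge_apply]
  refine congrArg (fun w => (c w).1 x) (funext fun i => ?_)
  rcases eq_or_ne i j with rfl | hij
  · simp
  · simp [hij]

variable [FiniteDimensional ℝ V] (ρ : Matrix (Fin m) (Fin m) ℝ →ₗ⁅ℝ⁆ Module.End ℝ V)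

/-- One term of the coboundary of a cochain in the frame of `gauge`. -/
def flatTerm {n : ℕ} (c : ProjSl m [⋀^Fin n]→ₗ[ℝ] Smooth m V) (X : ProjSl m)
    (v : Fin n → ProjSl m) (x : Fin m → ℝ) : V :=
  -fderiv ℝ (c v).1 x X.1 + ρ X.2.1 ((c v).1 x) -
    ∑ j, (c (Function.update v j (halfBracket m X (v j)))).1 x

/-- The coboundary in the frame of `gauge`. -/
def flatCoboundary {n : ℕ} (c : ProjSl m [⋀^Fin n]→ₗ[ℝ] Smooth m V)
    (v : Fin (n + 1) → ProjSl m) (x : Fin m → ℝ) : V :=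
  ∑ i : Fin (n + 1), (-1 : ℝ) ^ (i : ℕ) • flatTerm ρ c (v i) (i.removeNth v) x

theorem slRep_apply (X : ProjSl m) (f : Smooth m V) (x : Fin m → ℝ) :
    (slRep ρ X f).1 x = fderiv ℝ f.1 x ((star m X).1 x) - ρ (jac (star m X) x) (f.1 x) := rfl

/-- With `gaugeBracket` in place of the bracket, the terms `[h, v_j]` combine with the derivative at
fixed frame into the derivative of the gauged cochain (`fderiv_gauge`). Only `halfBracket` survives,
with coefficients independent of `x`. -/
theorem gauge_coboundary {n : ℕ} (c : ProjSl m [⋀^Fin n]→ₗ[ℝ] Smooth m V)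
    (v : Fin (n + 1) → ProjSl m) (x : Fin m → ℝ) :
    (gauge m V (n + 1) (coboundary (slRep ρ) n c) v).1 x =
      flatCoboundary ρ (gauge m V n c) v x := by
  -- Half the bracket commutes with `shift x`, so it can be carried through the frame; it is
  -- exchanged for `gaugeBracket` only afterwards, in `h2`.
  set β : ProjSl m →ₗ[ℝ] Module.End ℝ (ProjSl m) :=
    (1 / 2 : ℝ) • (LieAlgebra.ad ℝ (ProjSl m) : ProjSl m →ₗ[ℝ] Module.End ℝ (ProjSl m)) with hβ
  have hβ' : ∀ X Y, β X Y = (1 / 2 : ℝ) • ⁅X, Y⁆ := fun _ _ => rfl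
  have hanti : ∀ X Y : ProjSl m, β X Y - β Y X = ⁅X, Y⁆ := by
    intro X Y
    rw [hβ', hβ', ← lie_skew X Y]
    module
  have h1 := coboundary_eq_of_antisymm (slRep ρ) hanti c fun i => shift x (v i)
  have h2 := altSum_congr (β := β) (γ := gaugeBracket m)
    (fun X Y => by rw [hanti, gaugeBracket_antisymm])
    (((Smooth.eval x).compAlternatingMap c).compLinearMap (shift x)) v
  have h3 := congrArg (Smooth.eval x) h1
  rw [map_sum] at h3
  simp only [map_smul, map_sub, smul_sub, Finset.sum_sub_distrib] at h3
  rw [gauge_apply]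
  refine h3.trans ?_
  have h4 : ∑ i : Fin (n + 1), (-1 : ℝ) ^ (i : ℕ) • Smooth.eval x
      (altDer (β (shift x (v i))) c (i.removeNth fun i => shift x (v i))) =
      altSum β (((Smooth.eval x).compAlternatingMap c).compLinearMap (shift x)) v := by
    refine Finset.sum_congr rfl fun i _ => ?_
    congr 1
    rw [altDer_apply, altDer_apply, map_sum]
    refine Finset.sum_congr rfl fun j _ => ?_
    change Smooth.eval x (c _) = Smooth.eval x (c _)
    congr 2
    funext k
    rcases eq_or_ne k j with rfl | hk
    · simp only [Function.update_self, hβ', map_smul, shift_lie]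
      rfl
    · simp only [Function.update_of_ne hk]
      rfl
  rw [h4, h2, altSum, flatCoboundary, ← Finset.sum_sub_distrib]
  refine Finset.sum_congr rfl fun i _ => ?_
  rw [← smul_sub]
  congr 1
  rw [Smooth.eval_apply, slRep_apply, star_shift_self, jac_star_shift, sub_self, jac_star_zero,
    flatTerm, fderiv_gauge, altDer_apply]
  have h5 : ∀ w : Fin n → ProjSl m, (((Smooth.eval x).compAlternatingMap c).compLinearMap (shift x)) w
      = (gauge m V n c w).1 x := fun _ => rfl
  simp only [h5, gaugeBracket_apply, AlternatingMap.map_update_add]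
  have h6 : ∀ f g : Smooth m V, (f + g).1 x = f.1 x + g.1 x := fun _ _ => rfl
  simp only [h6, Finset.sum_add_distrib, map_neg, LinearMap.neg_apply]
  change -(fderiv ℝ (c fun j => shift x (i.removeNth v j)).1 x (v i).1) -
    -(ρ (v i).2.1 ((gauge m V n c (i.removeNth v)).1 x)) - _ = _
  abel

end Gauge

/-! ### Differentiation under the integral sign over the unit interval. -/

section ParametricIntegral

open MeasureTheory

variable {E V : Type*} [NormedAddCommGroup E] [NormedSpace ℝ E] [FiniteDimensional ℝ E]
  [NormedAddCommGroup V] [NormedSpace ℝ V]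

theorem hasFDerivAt_unitInterval_integral {f : E × ℝ → V} (hf : ContDiff ℝ 1 f) (x : E) :
    HasFDerivAt (fun x => ∫ s in (0 : ℝ)..1, f (x, s))
      (∫ s in (0 : ℝ)..1, (fderiv ℝ f (x, s)).comp (ContinuousLinearMap.inl ℝ E ℝ)) x := by
  have hc : Continuous fun p : E × ℝ => (fderiv ℝ f p).comp (ContinuousLinearMap.inl ℝ E ℝ) :=
    (hf.continuous_fderiv one_ne_zero).clm_comp continuous_const
  -- Compactness gives a constant bound for the partial derivative near `x`, uniformly in `s`: the
  -- domination needed to differentiate under the integral.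
  have hK : IsCompact (Metric.closedBall x 1 ×ˢ Set.Icc (0 : ℝ) 1) :=
    (isCompact_closedBall x 1).prod isCompact_Icc
  obtain ⟨C, hC⟩ := hK.exists_bound_of_continuousOn hc.continuousOn
  refine intervalIntegral.hasFDerivAt_integral_of_dominated_of_fderiv_le (μ := volume)
    (F := fun x s => f (x, s))
    (F' := fun x s => (fderiv ℝ f (x, s)).comp (ContinuousLinearMap.inl ℝ E ℝ))
    (bound := fun _ => C) (Metric.closedBall_mem_nhds x one_pos) ?_ ?_ ?_ ?_ ?_ ?_
  · exact Filter.Eventually.of_forall fun y =>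
      (hf.continuous.comp (Continuous.prodMk_right y)).aestronglyMeasurable
  · exact (hf.continuous.comp (Continuous.prodMk_right x)).intervalIntegrable _ _
  · exact (hc.comp (Continuous.prodMk_right x)).aestronglyMeasurable
  · refine Filter.Eventually.of_forall fun t ht y hy => hC (y, t) ⟨hy, ?_⟩
    rw [Set.uIoc_of_le zero_le_one] at ht
    exact ⟨ht.1.le, ht.2⟩
  · exact intervalIntegrable_const
  · refine Filter.Eventually.of_forall fun t _ y _ => ?_
    exact ((hf.differentiable one_ne_zero) (y, t)).hasFDerivAt.comp y (hasFDerivAt_prodMk_left y t)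

theorem fderiv_unitInterval_integral {f : E × ℝ → V} (hf : ContDiff ℝ 1 f) (x h : E) :
    fderiv ℝ (fun x => ∫ s in (0 : ℝ)..1, f (x, s)) x h =
      ∫ s in (0 : ℝ)..1, fderiv ℝ f (x, s) (h, 0) := by
  have hc : Continuous fun p : E × ℝ => (fderiv ℝ f p).comp (ContinuousLinearMap.inl ℝ E ℝ) :=
    (hf.continuous_fderiv one_ne_zero).clm_comp continuous_const
  rw [(hasFDerivAt_unitInterval_integral hf x).fderiv]
  exact ContinuousLinearMap.intervalIntegral_apply
    ((hc.comp (Continuous.prodMk_right x)).intervalIntegrable _ _) h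

/-- Induction on the order of differentiability: each directional derivative of the integral is
again such an integral, with an integrand of one order less. -/
theorem contDiff_unitInterval_integral {f : E × ℝ → V} (hf : ContDiff ℝ ∞ f) :
    ContDiff ℝ ∞ fun x => ∫ s in (0 : ℝ)..1, f (x, s) := by
  rw [contDiff_infty]
  intro n
  have hf' := hf.of_le (m := (n : ℕ)) (by exact_mod_cast le_top)
  clear hf
  induction n generalizing f with
  | zero =>
    have h := hf'.continuous
    rw [Nat.cast_zero, contDiff_zero]
    exact intervalIntegral.continuous_parametric_intervalIntegral_of_continuous'
      (f := fun x s => f (x, s)) h 0 1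
  | succ n ih =>
    have h1 : ContDiff ℝ 1 f := hf'.of_le (by push_cast; exact le_add_self)
    push_cast
    rw [contDiff_succ_iff_fderiv_apply]
    refine ⟨fun x => (hasFDerivAt_unitInterval_integral h1 x).differentiableAt,
      fun h => absurd h (by simp), fun h => ?_⟩
    simp only [fderiv_unitInterval_integral h1]
    exact ih ((hf'.fderiv_right (m := (n : ℕ)) (by push_cast; exact le_rfl)).clm_apply contDiff_const)

end ParametricIntegral

/-! ### The radial homotopy and Cartan's formula in the translated frame. -/

section Homotopy

variable {m : ℕ} {V : Type*} [NormedAddCommGroup V] [NormedSpace ℝ V]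

theorem contDiff_dilate (X : ProjSl m) (l : ProjSl m →ₗ[ℝ] ℝ) :
    ContDiff ℝ ∞ fun s : ℝ => l (dilate m s X) := by
  simp only [dilate_eq, map_add, map_smul]
  exact contDiff_const.add ((contDiff_id.sub contDiff_const).smul contDiff_const)

/-- Joint smoothness in `x` and in the parameter `s`, required to integrate over `s`. The vector
`-x` is inserted because the field of `h` is `-h`, so that it represents the radial field. -/
theorem contDiff_contract {n : ℕ} (c : ProjSl m [⋀^Fin (n + 1)]→ₗ[ℝ] Smooth m V)
    (v : Fin n → ProjSl m) : ContDiff ℝ ∞ fun p : (Fin m → ℝ) × ℝ =>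
      (c (Fin.cons (ofVec m (-p.1)) fun i => dilate m p.2 (v i))).1 (p.2 • p.1) := by
  have h := contDiff_apply_family c (E := (Fin m → ℝ) × ℝ)
    (fun i p => (Fin.cons (ofVec m (-p.1)) fun i => dilate m p.2 (v i) : Fin (n + 1) → ProjSl m) i)
    (fun i l => by
      refine Fin.cases ?_ (fun i => ?_) i
      · exact (contDiff_linear_vec (l ∘ₗ ofVec m)).comp contDiff_fst.neg
      · exact (contDiff_dilate (v i) l).comp contDiff_snd)
    (contDiff_snd.smul contDiff_fst)
  exact h

/-- The contraction with the radial field of the pull-back under the homothety `x ↦ s x`. -/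
def contract (m : ℕ) (V : Type*) [NormedAddCommGroup V] [NormedSpace ℝ V] (s : ℝ) {n : ℕ} : (ProjSl m [⋀^Fin (n + 1)]→ₗ[ℝ] Smooth m V) →ₗ[ℝ]
    (ProjSl m [⋀^Fin n]→ₗ[ℝ] Smooth m V) where
  toFun c := ofPointwise
    (fun x => (((Smooth.eval (s • x)).compAlternatingMap c).curryLeft (ofVec m (-x))).compLinearMap
      (dilate m s))
    (fun v => (contDiff_contract c v).comp (contDiff_id.prodMk contDiff_const))
  map_add' _ _ := rfl
  map_smul' _ _ := rfl

theorem contract_apply (s : ℝ) {n : ℕ} (c : ProjSl m [⋀^Fin (n + 1)]→ₗ[ℝ] Smooth m V)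
    (v : Fin n → ProjSl m) (x : Fin m → ℝ) : (contract m V s c v).1 x =
      (c (Fin.cons (ofVec m (-x)) fun i => dilate m s (v i))).1 (s • x) := rfl

theorem intervalIntegrable_contract {n : ℕ} (c : ProjSl m [⋀^Fin (n + 1)]→ₗ[ℝ] Smooth m V)
    (v : Fin n → ProjSl m) (x : Fin m → ℝ) :
    IntervalIntegrable (fun s => (contract m V s c v).1 x) MeasureTheory.volume 0 1 :=
  ((contDiff_contract c v).continuous.comp (Continuous.prodMk_right x)).intervalIntegrable _ _

/-- The homotopy operator of the Poincaré lemma. -/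
def poincare (m : ℕ) (V : Type*) [NormedAddCommGroup V] [NormedSpace ℝ V] (n : ℕ) :
    (ProjSl m [⋀^Fin (n + 1)]→ₗ[ℝ] Smooth m V) →ₗ[ℝ] (ProjSl m [⋀^Fin n]→ₗ[ℝ] Smooth m V) where
  toFun c := ofPointwise
    (fun x =>
      { toFun := fun v => ∫ s in (0 : ℝ)..1, (contract m V s c v).1 x
        map_update_add' := fun v i a b => by
          rw [← intervalIntegral.integral_add (intervalIntegrable_contract _ _ _)
            (intervalIntegrable_contract _ _ _)]
          simp only [AlternatingMap.map_update_add]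
          rfl
        map_update_smul' := fun v i r a => by
          rw [← intervalIntegral.integral_smul]
          simp only [AlternatingMap.map_update_smul]
          rfl
        map_eq_zero_of_eq' := fun v i j h hij => by
          have : ∀ s : ℝ, (contract m V s c v).1 x = 0 := fun s => by
            rw [(contract m V s c).map_eq_zero_of_eq v h hij]
            rfl
          simp only [this, intervalIntegral.integral_zero] })
    (fun v => contDiff_unitInterval_integral (contDiff_contract c v))
  map_add' c c' := cochain_ext fun v x =>
    intervalIntegral.integral_add (intervalIntegrable_contract c v x)
      (intervalIntegrable_contract c' v x)
  map_smul' r c := cochain_ext fun v x =>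
    intervalIntegral.integral_smul r fun s => (contract m V s c v).1 x

theorem poincare_apply {n : ℕ} (c : ProjSl m [⋀^Fin (n + 1)]→ₗ[ℝ] Smooth m V)
    (v : Fin n → ProjSl m) (x : Fin m → ℝ) :
    (poincare m V n c v).1 x = ∫ s in (0 : ℝ)..1, (contract m V s c v).1 x := rfl

/-- The first term comes from the point of evaluation `s x`, the second from the inserted vector
`-x`. The second one supplies the correction in `flatTerm_contract`. -/
theorem fderiv_contract (s : ℝ) {n : ℕ} (c : ProjSl m [⋀^Fin (n + 1)]→ₗ[ℝ] Smooth m V)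
    (v : Fin n → ProjSl m) (x h : Fin m → ℝ) : fderiv ℝ (contract m V s c v).1 x h =
      fderiv ℝ (c (Fin.cons (ofVec m (-x)) fun i => dilate m s (v i))).1 (s • x) (s • h) -
        (c (Fin.cons (ofVec m h) fun i => dilate m s (v i))).1 (s • x) := by
  have h1 : HasDerivAt (fun τ : ℝ => s • (x + τ • h)) (s • h) 0 := by
    simpa only [one_smul] using
      (((hasDerivAt_id' (0 : ℝ)).smul_const h).const_add x).fun_const_smul s
  have h2 : HasDerivAt (fun τ : ℝ => -τ) (-1) 0 := hasDerivAt_neg 0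
  have := hasDerivAt_apply_family c (s := 0)
    (g := fun i τ => (Fin.cons (ofVec m (-(x + τ • h))) fun i => dilate m s (v i) :
      Fin (n + 1) → ProjSl m) i)
    (g' := Fin.cons (ofVec m (-h)) fun _ => 0)
    (fun i l => by
      refine Fin.cases ?_ (fun i => ?_) i
      · simp only [Fin.cons_zero, neg_add, map_add, ← neg_smul, map_smul]
        have := (h2.smul_const (l (ofVec m h))).const_add (l (ofVec m (-x)))
        simpa [map_neg] using this
      · simpa using hasDerivAt_const (0 : ℝ) _) h1
  rw [fderiv_eq_of_hasDerivAt (contract m V s c v) this]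
  simp only [zero_smul, add_zero, Fin.sum_univ_succ, Fin.cons_zero, Fin.cons_succ]
  -- Only the inserted argument depends on `x`; the others have zero derivative.
  rw [Finset.sum_eq_zero]
  · rw [add_zero, sub_eq_add_neg]
    congr 1
    have e : Function.update (Fin.cons (ofVec m (-x)) fun i => dilate m s (v i) :
        Fin (n + 1) → ProjSl m) 0 (ofVec m (-h)) =
        Fin.cons (-ofVec m h) fun i => dilate m s (v i) := by
      rw [Fin.update_cons_zero, map_neg]
    refine (congrArg (fun w => (c w).1 (s • x)) e).trans ?_
    have e2 := (((Smooth.eval (s • x)).compAlternatingMap c).curryLeft).map_neg (ofVec m h)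
    exact congrArg (fun F => F fun i => dilate m s (v i)) e2
  · intro i _
    rw [c.map_coord_zero i.succ (by simp)]
    rfl

theorem halfBracket_dilate (s : ℝ) (X Y : ProjSl m) :
    halfBracket m (dilate m s X) (dilate m s Y) = halfBracket m X Y := rfl

/-- `halfBracket` has no component in `ℝ^m` and ignores those of its arguments, so the isotropy part
of the coboundary is unaffected by dilation and by contraction with the radial field. -/
theorem dilate_halfBracket (s : ℝ) (X Y : ProjSl m) :
    dilate m s (halfBracket m X Y) = halfBracket m X Y := by
  rw [dilate_eq, halfBracket_apply]
  change _ + (s - 1) • ofVec m (0 + 0) = _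
  simp

theorem halfBracket_ofVec_left (h : Fin m → ℝ) (X : ProjSl m) : halfBracket m (ofVec m h) X = 0 := by
  rw [halfBracket_apply]
  change ofMat m ((1 / 2 : ℝ) • ⁅(0 : Matrix (Fin m) (Fin m) ℝ), X.2.1⁆) +
    ofDual m (dualRep m 0 X.2.2) = 0
  simp

theorem halfBracket_ofVec_right (h : Fin m → ℝ) (X : ProjSl m) : halfBracket m X (ofVec m h) = 0 := by
  rw [halfBracket_apply]
  change ofMat m ((1 / 2 : ℝ) • ⁅X.2.1, (0 : Matrix (Fin m) (Fin m) ℝ)⁆) +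
    ofDual m (dualRep m X.2.1 0) = 0
  simp

/-- The pull-back of cochains under the homothety `x ↦ s x`. -/
def homothety (m : ℕ) (V : Type*) [NormedAddCommGroup V] [NormedSpace ℝ V] (s : ℝ) {n : ℕ} : (ProjSl m [⋀^Fin n]→ₗ[ℝ] Smooth m V) →ₗ[ℝ]
    (ProjSl m [⋀^Fin n]→ₗ[ℝ] Smooth m V) :=
  pull (fun x => s • x) (contDiff_id.const_smul s) (fun _ => dilate m s) fun _ _ => contDiff_const

theorem homothety_apply (s : ℝ) {n : ℕ} (c : ProjSl m [⋀^Fin n]→ₗ[ℝ] Smooth m V)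
    (v : Fin n → ProjSl m) (x : Fin m → ℝ) :
    (homothety m V s c v).1 x = (c fun i => dilate m s (v i)).1 (s • x) := rfl

theorem hasDerivAt_homothety (s : ℝ) {n : ℕ} (c : ProjSl m [⋀^Fin n]→ₗ[ℝ] Smooth m V)
    (v : Fin n → ProjSl m) (x : Fin m → ℝ) :
    HasDerivAt (fun s => (homothety m V s c v).1 x)
      (fderiv ℝ (c fun i => dilate m s (v i)).1 (s • x) x +
        ∑ j, (c (Function.update (fun i => dilate m s (v i)) j (ofVec m (v j).1))).1 (s • x)) s := by
  refine hasDerivAt_apply_family c (g := fun i τ => dilate m τ (v i)) (fun i l => ?_)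
    (y := fun τ => τ • x) (by simpa using (hasDerivAt_id' s).smul_const x)
  simp only [dilate_eq, map_add, map_smul]
  simpa using (((hasDerivAt_id' s).sub_const 1).smul_const (l (ofVec m (v i).1))).const_add (l (v i))

theorem contDiff_homothety {n : ℕ} (c : ProjSl m [⋀^Fin n]→ₗ[ℝ] Smooth m V)
    (v : Fin n → ProjSl m) (x : Fin m → ℝ) : ContDiff ℝ ∞ fun s => (homothety m V s c v).1 x :=
  contDiff_apply_family c (fun i τ => dilate m τ (v i)) (fun i l => contDiff_dilate (v i) l)
    (contDiff_id.smul contDiff_const)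

theorem fderiv_poincare {n : ℕ} (c : ProjSl m [⋀^Fin (n + 1)]→ₗ[ℝ] Smooth m V)
    (v : Fin n → ProjSl m) (x h : Fin m → ℝ) :
    IntervalIntegrable (fun s => fderiv ℝ (contract m V s c v).1 x h) MeasureTheory.volume 0 1 ∧
    fderiv ℝ (poincare m V n c v).1 x h = ∫ s in (0 : ℝ)..1, fderiv ℝ (contract m V s c v).1 x h := by
  have hf := contDiff_contract c v
  have e : ∀ s : ℝ, fderiv ℝ (contract m V s c v).1 x h = fderiv ℝ (fun p : (Fin m → ℝ) × ℝ =>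
      (c (Fin.cons (ofVec m (-p.1)) fun i => dilate m p.2 (v i))).1 (p.2 • p.1)) (x, s) (h, 0) := by
    intro s
    have := ((hf.differentiable (by simp)) (x, s)).hasFDerivAt.comp x (hasFDerivAt_prodMk_left (𝕜 := ℝ) x s)
    rw [show (contract m V s c v).1 = (fun p : (Fin m → ℝ) × ℝ =>
      (c (Fin.cons (ofVec m (-p.1)) fun i => dilate m p.2 (v i))).1 (p.2 • p.1)) ∘ fun x => (x, s)
      from rfl, this.fderiv]
    rfl
  simp only [e]
  refine ⟨?_, fderiv_unitInterval_integral (hf.of_le (by simp)) x h⟩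
  exact (((hf.continuous_fderiv (by simp)).comp (Continuous.prodMk_right x)).clm_apply
    continuous_const).intervalIntegrable _ _

/-- The homotopy operator on the cochains of `sl_{m+1}`. -/
def homotopy (m : ℕ) (V : Type*) [NormedAddCommGroup V] [NormedSpace ℝ V] (n : ℕ) :
    (ProjSl m [⋀^Fin (n + 1)]→ₗ[ℝ] Smooth m V) →ₗ[ℝ] (ProjSl m [⋀^Fin n]→ₗ[ℝ] Smooth m V) :=
  ungauge m V n ∘ₗ poincare m V n ∘ₗ gauge m V (n + 1)

/-- The projection on the cochains that are constant and horizontal in the frame of `gauge`. -/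
def basicPart (m : ℕ) (V : Type*) [NormedAddCommGroup V] [NormedSpace ℝ V] (n : ℕ) :
    (ProjSl m [⋀^Fin n]→ₗ[ℝ] Smooth m V) →ₗ[ℝ] (ProjSl m [⋀^Fin n]→ₗ[ℝ] Smooth m V) :=
  ungauge m V n ∘ₗ homothety m V 0 ∘ₗ gauge m V n

theorem basicPart_apply {n : ℕ} (c : ProjSl m [⋀^Fin n]→ₗ[ℝ] Smooth m V) (v : Fin n → ProjSl m)
    (x : Fin m → ℝ) : (basicPart m V n c v).1 x =
      (c fun i => dilate m 0 (shift (-x) (v i))).1 0 := by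
  rw [basicPart, LinearMap.comp_apply, LinearMap.comp_apply, ungauge_apply, homothety_apply,
    gauge_apply]
  simp

theorem gauge_injective {n : ℕ} : Function.Injective (gauge m V n) :=
  Function.LeftInverse.injective ungauge_gauge

theorem gauge_sub_apply {n : ℕ} (c c' : ProjSl m [⋀^Fin n]→ₗ[ℝ] Smooth m V)
    (v : Fin n → ProjSl m) (x : Fin m → ℝ) : (gauge m V n (c - c') v).1 x =
      (gauge m V n c v).1 x - (gauge m V n c' v).1 x := rfl

variable (ρ : Matrix (Fin m) (Fin m) ℝ →ₗ⁅ℝ⁆ Module.End ℝ V)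

/-- The inserted vector has zero `halfBracket` with everything, so each term of the coboundary
passes through the contraction, except for the derivative of the inserted vector itself. -/
theorem flatTerm_contract (s : ℝ) {n : ℕ} (c : ProjSl m [⋀^Fin (n + 1)]→ₗ[ℝ] Smooth m V)
    (X : ProjSl m) (v : Fin n → ProjSl m) (x : Fin m → ℝ) :
    flatTerm ρ (contract m V s c) X v x =
      flatTerm ρ c (dilate m s X) (Fin.cons (ofVec m (-x)) fun i => dilate m s (v i)) (s • x) +
        (c (Fin.cons (ofVec m X.1) fun i => dilate m s (v i))).1 (s • x) := by
  have e : ∑ j, (contract m V s c (Function.update v j (halfBracket m X (v j)))).1 x =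
      ∑ j, (c (Function.update
        (Fin.cons (ofVec m (-x)) fun i => dilate m s (v i) : Fin (n + 1) → ProjSl m) j
        (halfBracket m (dilate m s X)
          ((Fin.cons (ofVec m (-x)) fun i => dilate m s (v i) : Fin (n + 1) → ProjSl m) j)))).1
        (s • x) := by
    rw [Fin.sum_univ_succ, Fin.cons_zero, halfBracket_ofVec_right, c.map_update_zero]
    change _ = 0 + _
    rw [zero_add]
    refine Finset.sum_congr rfl fun j _ => ?_
    rw [Fin.cons_succ, halfBracket_dilate, contract_apply]
    refine congrArg (fun w => (c w).1 (s • x)) ?_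
    rw [← Fin.cons_update]
    congr 1
    funext i
    rcases eq_or_ne i j with rfl | h
    · simp [dilate_halfBracket]
    · simp [h]
  rw [flatTerm, flatTerm, e, fderiv_contract]
  change -(fderiv ℝ _ (s • x) (s • X.1) - _) + ρ X.2.1 _ - _ = -fderiv ℝ _ (s • x) (s • X.1) +
    ρ X.2.1 _ - _ + _
  rw [contract_apply]
  abel

theorem flatTerm_ofVec {n : ℕ} (c : ProjSl m [⋀^Fin n]→ₗ[ℝ] Smooth m V)
    (h : Fin m → ℝ) (v : Fin n → ProjSl m) (x : Fin m → ℝ) :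
    flatTerm ρ c (ofVec m h) v x = -fderiv ℝ (c v).1 x h := by
  rw [flatTerm, Finset.sum_eq_zero fun j _ => ?_]
  · change -fderiv ℝ (c v).1 x h + ρ 0 _ - 0 = _
    simp
  · rw [halfBracket_ofVec_left, c.map_update_zero]
    rfl

/-- Cartan's formula for the contraction with the radial field, in degree zero. -/
theorem contract_flatCoboundary_zero (s : ℝ) (c : ProjSl m [⋀^Fin 0]→ₗ[ℝ] Smooth m V)
    (v : Fin 0 → ProjSl m) (x : Fin m → ℝ) :
    flatCoboundary ρ c (Fin.cons (ofVec m (-x)) fun i => dilate m s (v i)) (s • x) =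
      fderiv ℝ (c fun i => dilate m s (v i)).1 (s • x) x +
        ∑ j, (c (Function.update (fun i => dilate m s (v i)) j (ofVec m (v j).1))).1 (s • x) := by
  rw [flatCoboundary, Fin.sum_univ_succ]
  simp only [Fin.cons_zero, flatTerm_ofVec]
  simp [Fin.tail_def]

/-- Cartan's formula for the contraction with the radial field. -/
theorem contract_flatCoboundary_succ (s : ℝ) {n : ℕ} (c : ProjSl m [⋀^Fin (n + 1)]→ₗ[ℝ] Smooth m V)
    (v : Fin (n + 1) → ProjSl m) (x : Fin m → ℝ) :
    flatCoboundary ρ (contract m V s c) v x +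
      flatCoboundary ρ c (Fin.cons (ofVec m (-x)) fun i => dilate m s (v i)) (s • x) =
      fderiv ℝ (c fun i => dilate m s (v i)).1 (s • x) x +
        ∑ j, (c (Function.update (fun i => dilate m s (v i)) j (ofVec m (v j).1))).1 (s • x) := by
  have h0 : (0 : Fin (n + 2)).removeNth
      (Fin.cons (ofVec m (-x)) fun i => dilate m s (v i) : Fin (n + 2) → ProjSl m) =
      fun i => dilate m s (v i) := by
    simp
  have h1 : ∀ i : Fin (n + 1), i.succ.removeNth
      (Fin.cons (ofVec m (-x)) fun i => dilate m s (v i) : Fin (n + 2) → ProjSl m) =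
      Fin.cons (ofVec m (-x)) fun k => dilate m s (i.removeNth v k) := by
    intro i
    funext k
    refine Fin.cases ?_ (fun k => ?_) k
    · simp [Fin.removeNth_apply]
    · simp [Fin.removeNth_apply]
  -- Moving the entry at place `j` to the front costs the sign `(-1)^j`.
  have h2 : ∀ j : Fin (n + 1),
      (c (Function.update (fun i => dilate m s (v i)) j (ofVec m (v j).1))).1 (s • x) =
      (-1 : ℝ) ^ (j : ℕ) • (c (Fin.cons (ofVec m (v j).1)
        fun k => dilate m s (j.removeNth v k))).1 (s • x) := by
    intro j
    have := ((Smooth.eval (s • x)).compAlternatingMap c).map_insertNth j (ofVec m (v j).1)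
      fun k => dilate m s (j.removeNth v k)
    have e : ∀ z : V, (-1 : ℤ) ^ (j : ℕ) • z = (-1 : ℝ) ^ (j : ℕ) • z := by
      intro z
      rcases Nat.even_or_odd (j : ℕ) with h | h <;> simp [h.neg_one_pow]
    rw [e] at this
    refine Eq.trans ?_ this
    refine congrArg (fun w => (c w).1 (s • x)) ?_
    rw [← Fin.insertNth_removeNth]
    rfl
  have h3 : ∀ (w : Fin (n + 1) → ProjSl m) (y : Fin m → ℝ),
      flatTerm ρ c (ofVec m (-x)) w y = fderiv ℝ (c w).1 y x := by
    intro w y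
    rw [flatTerm_ofVec, map_neg, neg_neg]
  -- The term of index `0` of the second coboundary is the radial derivative. Its other terms have
  -- the sign opposite to those of the first coboundary and cancel them, leaving the corrections
  -- from `flatTerm_contract`.
  rw [flatCoboundary, flatCoboundary, Fin.sum_univ_succ (n := n + 1), h0]
  simp only [Fin.cons_zero, Fin.cons_succ, h1, h2, flatTerm_contract, smul_add, Finset.sum_add_distrib,
    h3, Fin.val_succ, pow_succ, mul_neg, mul_one, neg_smul, Finset.sum_neg_distrib,
    Fin.val_zero, pow_zero, one_smul]
  abel

variable [FiniteDimensional ℝ V]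

/-- The integrand, which is the right-hand side of Cartan's formula, is the derivative in `s` of the
pull-back by `x ↦ s x`. The pull-back is the identity at `s = 1`. -/
theorem integral_deriv_homothety {n : ℕ} (c : ProjSl m [⋀^Fin n]→ₗ[ℝ] Smooth m V)
    (v : Fin n → ProjSl m) (x : Fin m → ℝ) :
    ∫ s in (0 : ℝ)..1, (fderiv ℝ (c fun i => dilate m s (v i)).1 (s • x) x +
        ∑ j, (c (Function.update (fun i => dilate m s (v i)) j (ofVec m (v j).1))).1 (s • x)) =
      (c v).1 x - (homothety m V 0 c v).1 x := by
  have := FiniteDimensional.complete ℝ V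
  have e : (fun s => fderiv ℝ (c fun i => dilate m s (v i)).1 (s • x) x +
      ∑ j, (c (Function.update (fun i => dilate m s (v i)) j (ofVec m (v j).1))).1 (s • x)) =
      deriv fun s => (homothety m V s c v).1 x :=
    funext fun s => (hasDerivAt_homothety s c v x).deriv.symm
  have h := contDiff_homothety c v x
  rw [intervalIntegral.integral_eq_sub_of_hasDerivAt (f := fun s => (homothety m V s c v).1 x)
    fun s _ => hasDerivAt_homothety s c v x]
  · simp [homothety_apply, dilate_eq]
  · rw [e]
    exact (h.continuous_deriv (by simp)).intervalIntegrable _ _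

theorem flatTerm_poincare {n : ℕ} (c : ProjSl m [⋀^Fin (n + 1)]→ₗ[ℝ] Smooth m V)
    (X : ProjSl m) (v : Fin n → ProjSl m) (x : Fin m → ℝ) :
    IntervalIntegrable (fun s => flatTerm ρ (contract m V s c) X v x) MeasureTheory.volume 0 1 ∧
    flatTerm ρ (poincare m V n c) X v x = ∫ s in (0 : ℝ)..1, flatTerm ρ (contract m V s c) X v x := by
  have := FiniteDimensional.complete ℝ V
  have h1 : IntervalIntegrable (fun s => -fderiv ℝ (contract m V s c v).1 x X.1)
    MeasureTheory.volume 0 1 := (fderiv_poincare c v x X.1).1.neg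
  have h2 := intervalIntegrable_contract c v x
  have h2' : IntervalIntegrable (fun s => ρ X.2.1 ((contract m V s c v).1 x)) MeasureTheory.volume 0 1 :=
    ((LinearMap.toContinuousLinearMap (ρ X.2.1)).continuous.comp
      ((contDiff_contract c v).continuous.comp (Continuous.prodMk_right x))).intervalIntegrable _ _
  have h3 : ∀ j ∈ Finset.univ, IntervalIntegrable (fun s => (contract m V s c (Function.update v j
      (halfBracket m X (v j)))).1 x) MeasureTheory.volume 0 1 := fun j _ =>
    intervalIntegrable_contract c _ x
  have h4 : IntervalIntegrable (fun s => ∑ j, (contract m V s c (Function.update v j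
      (halfBracket m X (v j)))).1 x) MeasureTheory.volume 0 1 := by
    simpa only [Finset.sum_fn] using IntervalIntegrable.sum Finset.univ h3
  refine ⟨(h1.add h2').sub h4, ?_⟩
  simp only [flatTerm]
  rw [intervalIntegral.integral_sub (h1.add h2') h4, intervalIntegral.integral_add h1 h2',
    intervalIntegral.integral_neg, intervalIntegral.integral_finsetSum h3, (fderiv_poincare _ _ _ _).2]
  congr 2
  exact ((LinearMap.toContinuousLinearMap (ρ X.2.1)).intervalIntegral_comp_comm h2).symm

theorem flatCoboundary_poincare {n : ℕ} (c : ProjSl m [⋀^Fin (n + 1)]→ₗ[ℝ] Smooth m V)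
    (v : Fin (n + 1) → ProjSl m) (x : Fin m → ℝ) :
    IntervalIntegrable (fun s => flatCoboundary ρ (contract m V s c) v x) MeasureTheory.volume 0 1 ∧
    flatCoboundary ρ (poincare m V n c) v x =
      ∫ s in (0 : ℝ)..1, flatCoboundary ρ (contract m V s c) v x := by
  have h : ∀ i ∈ (Finset.univ : Finset (Fin (n + 1))), IntervalIntegrable (fun s => (-1 : ℝ) ^ (i : ℕ) •
      flatTerm ρ (contract m V s c) (v i) (i.removeNth v) x) MeasureTheory.volume 0 1 := fun i _ =>
    (flatTerm_poincare ρ c (v i) (i.removeNth v) x).1.smul _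
  simp only [flatCoboundary]
  refine ⟨by simpa only [Finset.sum_fn] using IntervalIntegrable.sum Finset.univ h, ?_⟩
  rw [intervalIntegral.integral_finsetSum h]
  refine Finset.sum_congr rfl fun i _ => ?_
  rw [(flatTerm_poincare ρ c _ _ _).2, intervalIntegral.integral_smul]

theorem contract_gauge_coboundary {n : ℕ} (s : ℝ) (c : ProjSl m [⋀^Fin n]→ₗ[ℝ] Smooth m V)
    (v : Fin n → ProjSl m) (x : Fin m → ℝ) :
    (contract m V s (gauge m V (n + 1) (coboundary (slRep ρ) n c)) v).1 x =
      flatCoboundary ρ (gauge m V n c) (Fin.cons (ofVec m (-x)) fun i => dilate m s (v i)) (s • x) := by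
  rw [contract_apply, gauge_coboundary]

theorem homotopy_zero (c : ProjSl m [⋀^Fin 0]→ₗ[ℝ] Smooth m V) :
    homotopy m V 0 (coboundary (slRep ρ) 0 c) = c - basicPart m V 0 c := by
  refine gauge_injective (cochain_ext fun v x => ?_)
  simp only [homotopy, basicPart, LinearMap.comp_apply, gauge_sub_apply, gauge_ungauge]
  rw [poincare_apply]
  simp only [contract_gauge_coboundary, contract_flatCoboundary_zero]
  exact integral_deriv_homothety _ v x

/-- Cartan's formula integrated over `s`, then transported back from the translated frame. -/
theorem homotopy_succ {n : ℕ} (c : ProjSl m [⋀^Fin (n + 1)]→ₗ[ℝ] Smooth m V) :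
    coboundary (slRep ρ) n (homotopy m V n c) + homotopy m V (n + 1) (coboundary (slRep ρ) (n + 1) c) =
      c - basicPart m V (n + 1) c := by
  refine gauge_injective (cochain_ext fun v x => ?_)
  rw [map_add]
  change (gauge m V (n + 1) (coboundary (slRep ρ) n (homotopy m V n c)) v).1 x +
    (gauge m V (n + 1) (homotopy m V (n + 1) (coboundary (slRep ρ) (n + 1) c)) v).1 x = _
  rw [gauge_coboundary]
  simp only [homotopy, basicPart, LinearMap.comp_apply, gauge_sub_apply, gauge_ungauge]
  rw [poincare_apply, (flatCoboundary_poincare ρ _ v x).2, ← intervalIntegral.integral_add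
    (flatCoboundary_poincare ρ _ v x).1 (intervalIntegrable_contract _ v x)]
  simp only [contract_gauge_coboundary, contract_flatCoboundary_succ]
  exact integral_deriv_homothety _ v x

/-- The coefficients of `flatCoboundary` do not depend on `x`, so it commutes with the pull-back by
the zero homothety. -/
theorem coboundary_basicPart {n : ℕ} (c : ProjSl m [⋀^Fin n]→ₗ[ℝ] Smooth m V) :
    coboundary (slRep ρ) n (basicPart m V n c) =
      basicPart m V (n + 1) (coboundary (slRep ρ) n c) := by
  refine gauge_injective (cochain_ext fun v x => ?_)
  rw [gauge_coboundary]
  simp only [basicPart, LinearMap.comp_apply, gauge_ungauge]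
  rw [homothety_apply, gauge_coboundary, flatCoboundary, flatCoboundary]
  refine Finset.sum_congr rfl fun i _ => ?_
  congr 1
  set b := gauge m V n c
  -- The pulled-back cochain has constant values, so the de Rham part vanishes; on the other side it
  -- vanishes because `dilate m 0` removes the direction of differentiation.
  have e1 : ∀ w y h, fderiv ℝ (homothety m V 0 b w).1 y h = 0 := by
    intro w y h
    rw [show (homothety m V 0 b w).1 = fun _ => (b fun i => dilate m 0 (w i)).1 0 from
      funext fun y => by rw [homothety_apply, zero_smul], fderiv_const_apply]
    rfl
  rw [flatTerm, flatTerm, e1]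
  have e2 : (dilate m 0 (v i)).1 = 0 := zero_smul ℝ (v i).1
  rw [e2, map_zero, zero_smul]
  simp only [homothety_apply, zero_smul]
  congr 1
  refine Finset.sum_congr rfl fun j _ => ?_
  refine congrArg (fun w => (b w).1 0) (funext fun k => ?_)
  rcases eq_or_ne k j with rfl | h
  · simp only [Function.update_self, dilate_halfBracket]
    rfl
  · simp only [Function.update_of_ne h]
    rfl

end Homotopy

/-! ### Homogeneous components of the total space of cochains. -/

section Cochains

variable {L M N : Type*} [LieRing L] [LieAlgebra ℝ L] [AddCommGroup M] [Module ℝ M]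
  [AddCommGroup N] [Module ℝ N]

theorem Cochains.hom_ext {F G : Cochains L M →ₗ[ℝ] N}
    (h : ∀ n c, F (Cochains.of L M n c) = G (Cochains.of L M n c)) : F = G :=
  DirectSum.linearMap_ext (R := ℝ) (M := fun n => L [⋀^Fin n]→ₗ[ℝ] M) fun n =>
    LinearMap.ext fun c => h n c

/-- The component of degree `n` of a cochain. -/
def Cochains.component (L M : Type*) [LieRing L] [LieAlgebra ℝ L] [AddCommGroup M] [Module ℝ M]
    (n : ℕ) : Cochains L M →ₗ[ℝ] (L [⋀^Fin n]→ₗ[ℝ] M) :=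
  DirectSum.component ℝ ℕ (fun n => L [⋀^Fin n]→ₗ[ℝ] M) n

theorem Cochains.component_of (n : ℕ) (c : L [⋀^Fin n]→ₗ[ℝ] M) :
    Cochains.component L M n (Cochains.of L M n c) = c :=
  DirectSum.component.lof_self (R := ℝ) (M := fun n => L [⋀^Fin n]→ₗ[ℝ] M) n c

theorem Cochains.component_of_ne {n k : ℕ} (h : k ≠ n) (c : L [⋀^Fin k]→ₗ[ℝ] M) :
    Cochains.component L M n (Cochains.of L M k c) = 0 :=
  DirectSum.of_eq_of_ne (β := fun n => L [⋀^Fin n]→ₗ[ℝ] M) k n c h.symm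

theorem Cochains.of_injective (n : ℕ) : Function.Injective (Cochains.of L M n) :=
  Function.LeftInverse.injective (Cochains.component_of n)

theorem d_of (φ : L →ₗ⁅ℝ⁆ Module.End ℝ M) (n : ℕ) (c : L [⋀^Fin n]→ₗ[ℝ] M) :
    d φ (Cochains.of L M n c) = Cochains.of L M (n + 1) (coboundary φ n c) :=
  Cochains.lift_of _ n c

end Cochains

section Evaluation

variable {ι L N : Type*} [AddCommGroup L] [Module ℝ L] [AddCommGroup N] [Module ℝ N]

theorem alternatingMap_sum_apply {κ : Type*} (s : Finset κ) (c : κ → L [⋀^ι]→ₗ[ℝ] N) (v : ι → L) :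
    (∑ k ∈ s, c k) v = ∑ k ∈ s, c k v :=
  map_sum (⟨⟨fun c => c v, rfl⟩, fun _ _ => rfl⟩ : (L [⋀^ι]→ₗ[ℝ] N) →+ N) c s

end Evaluation

/-! ### Concatenated tuples. -/

section Append

variable {α : Type*}

theorem append_update_left {t u : ℕ} (a : Fin t → α) (b : Fin u → α) (i : Fin t) (x : α) :
    Fin.append (Function.update a i x) b = Function.update (Fin.append a b) (Fin.castAdd u i) x := by
  funext k
  refine Fin.addCases (fun k => ?_) (fun k => ?_) k
  · rw [Fin.append_left]
    rcases eq_or_ne k i with rfl | h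
    · simp
    · rw [Function.update_of_ne h, Function.update_of_ne (by simpa using h), Fin.append_left]
  · rw [Fin.append_right, update_castAdd_natAdd, Fin.append_right]

theorem append_update_right {t u : ℕ} (a : Fin t → α) (b : Fin u → α) (i : Fin u) (x : α) :
    Fin.append a (Function.update b i x) = Function.update (Fin.append a b) (Fin.natAdd t i) x := by
  funext k
  refine Fin.addCases (fun k => ?_) (fun k => ?_) k
  · rw [Fin.append_left, update_natAdd_castAdd, Fin.append_left]
  · rw [Fin.append_right]
    rcases eq_or_ne k i with rfl | h
    · simp
    · rw [Function.update_of_ne h, Function.update_of_ne (by simpa using h), Fin.append_right]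

theorem removeNth_append_left {t u : ℕ} (h : t + u + 1 = t + 1 + u) (a : Fin (t + 1) → α)
    (b : Fin u → α) (i : Fin (t + 1)) :
    (Fin.cast h.symm (Fin.castAdd u i)).removeNth (fun k => Fin.append a b (Fin.cast h k)) =
      Fin.append (i.removeNth a) b := by
  funext k
  rw [Fin.removeNth_apply]
  refine Fin.addCases (fun k => ?_) (fun k => ?_) k
  · rw [Fin.append_left, Fin.removeNth_apply, ← Fin.append_left a b]
    congr 1
    ext
    simp only [Fin.val_cast, Fin.val_castAdd, Fin.succAbove, Fin.lt_def, Fin.val_castSucc]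
    split_ifs <;> simp
  · rw [Fin.append_right, ← Fin.append_right a b]
    congr 1
    ext
    have := i.isLt
    simp only [Fin.val_cast, Fin.val_castAdd, Fin.succAbove, Fin.lt_def, Fin.val_castSucc,
      Fin.val_natAdd]
    split_ifs <;> simp <;> omega

end Append

/-! ### Alternating sums over permutations with two blocks of indices. -/

section Shuffle

variable {M₁ M₂ N : Type*} [AddCommGroup M₁] [Module ℝ M₁] [AddCommGroup M₂] [Module ℝ M₂]
  [AddCommGroup N] [Module ℝ N]

/-- The sum over all permutations reduces to the permutations which preserve the two blocks. -/
theorem sum_perm_eq_of_blocks {t u : ℕ} (γ : M₁ [⋀^Fin t]→ₗ[ℝ] (M₂ [⋀^Fin u]→ₗ[ℝ] N))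
    (a : Fin (t + u) → M₁) (b : Fin (t + u) → M₂) (ha : ∀ j, a (Fin.natAdd t j) = 0) :
    ∑ ν : Equiv.Perm (Fin (t + u)), Equiv.Perm.sign ν •
      γ (fun i => a (ν (Fin.castAdd u i))) (fun j => b (ν (Fin.natAdd t j))) =
    ((t.factorial : ℝ) * u.factorial) •
      γ (fun i => a (Fin.castAdd u i)) (fun j => b (Fin.natAdd t j)) := by
  set F : Equiv.Perm (Fin t ⊕ Fin u) → N := fun σ => Equiv.Perm.sign σ •
    γ (fun i => a (finSumFinEquiv (σ (Sum.inl i)))) (fun j => b (finSumFinEquiv (σ (Sum.inr j))))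
    with hF
  have h1 : ∑ ν : Equiv.Perm (Fin (t + u)), Equiv.Perm.sign ν •
      γ (fun i => a (ν (Fin.castAdd u i))) (fun j => b (ν (Fin.natAdd t j))) = ∑ σ, F σ := by
    rw [← Equiv.sum_comp (Equiv.permCongr (finSumFinEquiv (m := t) (n := u)))]
    refine Finset.sum_congr rfl fun σ _ => ?_
    simp only [hF, Equiv.Perm.sign_permCongr, Equiv.permCongr_apply,
      finSumFinEquiv_symm_apply_castAdd, finSumFinEquiv_symm_apply_natAdd]
  have h2 : ∀ σ ∉ Set.range (Equiv.Perm.sumCongrHom (Fin t) (Fin u)), F σ = 0 := by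
    intro σ hσ
    -- A permutation that does not preserve the blocks sends some index of the first one into the
    -- second, where `a` vanishes.
    have : ∃ i j, σ (Sum.inl i) = Sum.inr j := by
      by_contra! hcon
      refine hσ (Equiv.Perm.mem_sumCongrHom_range_of_perm_mapsTo_inl ?_)
      rintro _ ⟨i, rfl⟩
      rcases hx : σ (Sum.inl i) with k | k
      · exact ⟨k, rfl⟩
      · exact absurd hx (hcon i k)
    obtain ⟨i, j, hij⟩ := this
    simp only [hF]
    rw [γ.map_coord_zero i, AlternatingMap.zero_apply, smul_zero]
    rw [hij, finSumFinEquiv_apply_right, ha]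
  have h3 : ∀ p : Equiv.Perm (Fin t) × Equiv.Perm (Fin u),
      γ (fun i => a (Fin.castAdd u i)) (fun j => b (Fin.natAdd t j)) =
        F (Equiv.Perm.sumCongrHom (Fin t) (Fin u) p) := by
    rintro ⟨σ, τ⟩
    simp only [hF, Equiv.Perm.sumCongrHom_apply, Equiv.Perm.sumCongr_apply, Sum.map_inl,
      Sum.map_inr, finSumFinEquiv_apply_left, finSumFinEquiv_apply_right, Equiv.Perm.sign_sumCongr]
    have e1 := γ.map_perm (fun i => a (Fin.castAdd u i)) σ
    have e2 := (γ fun i => a (Fin.castAdd u i)).map_perm (fun j => b (Fin.natAdd t j)) τ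
    simp only [Function.comp_def] at e1 e2
    rw [e1, AlternatingMap.smul_apply, e2, smul_smul, smul_smul]
    rcases Int.units_eq_one_or (Equiv.Perm.sign σ) with hs | hs <;>
    rcases Int.units_eq_one_or (Equiv.Perm.sign τ) with ht | ht <;> simp [hs, ht]
  rw [h1, ← Fintype.sum_of_injective _ Equiv.Perm.sumCongrHom_injective _ F h2 h3,
    Finset.sum_const, Finset.card_univ, Fintype.card_prod, Fintype.card_perm, Fintype.card_perm,
    Fintype.card_fin, Fintype.card_fin, ← Nat.cast_smul_eq_nsmul ℝ, Nat.cast_mul]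

theorem sum_ite_val_lt {n t : ℕ} (h : t ≤ n) : ∑ k : Fin n, (if (k : ℕ) < t then 1 else 0) = t := by
  obtain ⟨u, rfl⟩ := Nat.exists_eq_add_of_le h
  rw [Fin.sum_univ_add]
  simp

/-- The sum over all permutations vanishes when the sizes of the blocks do not match. -/
theorem sum_perm_eq_zero_of_blocks {t u t' : ℕ} (ht' : t' ≤ t + u) (hne : t' ≠ t)
    (γ : M₁ [⋀^Fin t]→ₗ[ℝ] (M₂ [⋀^Fin u]→ₗ[ℝ] N)) (a : Fin (t + u) → M₁) (b : Fin (t + u) → M₂)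
    (ha : ∀ k : Fin (t + u), t' ≤ k → a k = 0) (hb : ∀ k : Fin (t + u), (k : ℕ) < t' → b k = 0) :
    ∑ ν : Equiv.Perm (Fin (t + u)), Equiv.Perm.sign ν •
      γ (fun i => a (ν (Fin.castAdd u i))) (fun j => b (ν (Fin.natAdd t j))) = 0 := by
  refine Finset.sum_eq_zero fun ν _ => ?_
  by_cases h1 : ∃ i : Fin t, t' ≤ (ν (Fin.castAdd u i) : ℕ)
  · obtain ⟨i, hi⟩ := h1
    rw [γ.map_coord_zero i (ha _ hi), AlternatingMap.zero_apply, smul_zero]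
  by_cases h2 : ∃ j : Fin u, (ν (Fin.natAdd t j) : ℕ) < t'
  · obtain ⟨j, hj⟩ := h2
    rw [AlternatingMap.map_coord_zero _ j (hb _ hj), smul_zero]
  push Not at h1 h2
  -- A permutation with a nonzero term would map the first `t` indices exactly onto those below
  -- `t'`; counting them gives `t = t'`.
  refine absurd ?_ hne
  have e := Equiv.sum_comp ν fun k => if (k : ℕ) < t' then 1 else 0
  rw [sum_ite_val_lt ht', Fin.sum_univ_add] at e
  simp only [h1, if_true, (h2 _).not_gt, if_false] at e
  simpa using e.symm

end Shuffle

/-! ### Basic cochains as alternating maps on the isotropy algebra `gl(m, ℝ) ⊕ ℝ^{m*}`. -/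

section Restriction

variable {m : ℕ} {V : Type*} [NormedAddCommGroup V] [NormedSpace ℝ V]

/-- The sequence of elements of `gl(m, ℝ)` and `ℝ^{m*}`, as elements of `sl_{m+1}`. -/
def pureTuple {t u n : ℕ} (h : t + u = n) (A : Fin t → Matrix (Fin m) (Fin m) ℝ)
    (α : Fin u → Module.Dual ℝ (Fin m → ℝ)) : Fin n → ProjSl m := fun k =>
  Fin.append (fun i => ofMat m (A i)) (fun j => ofDual m (α j)) (Fin.cast h.symm k)

theorem pureTuple_update_left {t u n : ℕ} (h : t + u = n) (A : Fin t → Matrix (Fin m) (Fin m) ℝ)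
    (α : Fin u → Module.Dual ℝ (Fin m → ℝ)) (i : Fin t) (B : Matrix (Fin m) (Fin m) ℝ) :
    pureTuple h (Function.update A i B) α =
      Function.update (pureTuple h A α) (Fin.cast h (Fin.castAdd u i)) (ofMat m B) := by
  subst h
  change Fin.append (fun k => ofMat m (Function.update A i B k)) (fun j => ofDual m (α j)) =
    Function.update (Fin.append (fun i => ofMat m (A i)) (fun j => ofDual m (α j))) (Fin.castAdd u i) _
  rw [← append_update_left]
  congr 1
  funext k
  exact Function.apply_update (fun _ => ofMat m) A i B k

theorem pureTuple_update_right {t u n : ℕ} (h : t + u = n) (A : Fin t → Matrix (Fin m) (Fin m) ℝ)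
    (α : Fin u → Module.Dual ℝ (Fin m → ℝ)) (j : Fin u) (β : Module.Dual ℝ (Fin m → ℝ)) :
    pureTuple h A (Function.update α j β) =
      Function.update (pureTuple h A α) (Fin.cast h (Fin.natAdd t j)) (ofDual m β) := by
  subst h
  change Fin.append (fun k => ofMat m (A k)) (fun k => ofDual m (Function.update α j β k)) =
    Function.update (Fin.append (fun i => ofMat m (A i)) (fun j => ofDual m (α j))) (Fin.natAdd t j) _
  rw [← append_update_right]
  congr 1
  funext k
  exact Function.apply_update (fun _ => ofDual m) α j β k

@[simp] theorem pureTuple_left {t u n : ℕ} (h : t + u = n) (A : Fin t → Matrix (Fin m) (Fin m) ℝ)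
    (α : Fin u → Module.Dual ℝ (Fin m → ℝ)) (i : Fin t) :
    pureTuple h A α (Fin.cast h (Fin.castAdd u i)) = ofMat m (A i) :=
  Fin.append_left _ _ i

@[simp] theorem pureTuple_right {t u n : ℕ} (h : t + u = n) (A : Fin t → Matrix (Fin m) (Fin m) ℝ)
    (α : Fin u → Module.Dual ℝ (Fin m → ℝ)) (j : Fin u) :
    pureTuple h A α (Fin.cast h (Fin.natAdd t j)) = ofDual m (α j) :=
  Fin.append_right _ _ j

/-- The restriction to `gl(m, ℝ) ⊕ ℝ^{m*}` of the value at the origin of a cochain. -/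
def restr (m : ℕ) (V : Type*) [NormedAddCommGroup V] [NormedSpace ℝ V] {t u n : ℕ} (h : t + u = n) : (ProjSl m [⋀^Fin n]→ₗ[ℝ] Smooth m V) →ₗ[ℝ]
    (Matrix (Fin m) (Fin m) ℝ [⋀^Fin t]→ₗ[ℝ] (Module.Dual ℝ (Fin m → ℝ) [⋀^Fin u]→ₗ[ℝ] V)) where
  toFun c :=
    { toFun := fun A =>
        { toFun := fun α => (c (pureTuple h A α)).1 0
          map_update_add' := by
            intro inst α j β β'
            obtain rfl : inst = instDecidableEqFin u := Subsingleton.elim _ _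
            simp only [pureTuple_update_right, map_add, AlternatingMap.map_update_add]
            rfl
          map_update_smul' := by
            intro inst α j r β
            obtain rfl : inst = instDecidableEqFin u := Subsingleton.elim _ _
            simp only [pureTuple_update_right, map_smul, AlternatingMap.map_update_smul]
            rfl
          map_eq_zero_of_eq' := fun α j k hjk hne => by
            rw [c.map_eq_zero_of_eq (pureTuple h A α) (i := Fin.cast h (Fin.natAdd t j))
              (j := Fin.cast h (Fin.natAdd t k)) (by simp [hjk]) (by simpa using hne)]
            rfl }
      map_update_add' := by
        intro inst A i B B'
        obtain rfl : inst = instDecidableEqFin t := Subsingleton.elim _ _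
        refine AlternatingMap.ext fun α => ?_
        change (c (pureTuple h _ α)).1 0 = (c (pureTuple h _ α)).1 0 + (c (pureTuple h _ α)).1 0
        simp only [pureTuple_update_left, map_add, AlternatingMap.map_update_add]
        rfl
      map_update_smul' := by
        intro inst A i r B
        obtain rfl : inst = instDecidableEqFin t := Subsingleton.elim _ _
        refine AlternatingMap.ext fun α => ?_
        change (c (pureTuple h _ α)).1 0 = r • (c (pureTuple h _ α)).1 0
        simp only [pureTuple_update_left, map_smul, AlternatingMap.map_update_smul]
        rfl
      map_eq_zero_of_eq' := fun A i k hik hne => AlternatingMap.ext fun α => by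
        change (c (pureTuple h A α)).1 0 = 0
        rw [c.map_eq_zero_of_eq (pureTuple h A α) (i := Fin.cast h (Fin.castAdd u i))
          (j := Fin.cast h (Fin.castAdd u k)) (by simp [hik]) (by simpa using hne)]
        rfl }
  map_add' _ _ := rfl
  map_smul' _ _ := rfl

theorem restr_apply {t u n : ℕ} (h : t + u = n) (c : ProjSl m [⋀^Fin n]→ₗ[ℝ] Smooth m V)
    (A : Fin t → Matrix (Fin m) (Fin m) ℝ) (α : Fin u → Module.Dual ℝ (Fin m → ℝ)) :
    restr m V h c A α = (c (pureTuple h A α)).1 0 := rfl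

theorem jac_star_ofMat (A : Matrix (Fin m) (Fin m) ℝ) : jac (star m (ofMat m A)) 0 = -A :=
  jac_star_zero _

theorem jac_star_ofDual (α : Module.Dual ℝ (Fin m → ℝ)) : jac (star m (ofDual m α)) 0 = 0 :=
  (jac_star_zero _).trans neg_zero

theorem dTrJac_star_ofMat (A : Matrix (Fin m) (Fin m) ℝ) : dTrJac (star m (ofMat m A)) 0 = 0 :=
  (dTrJac_star _ _).trans (smul_zero _)

theorem dTrJac_star_ofDual (α : Module.Dual ℝ (Fin m → ℝ)) :
    dTrJac (star m (ofDual m α)) 0 = ((m : ℝ) + 1) • α := dTrJac_star _ _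

/-- This fixes the normalization of `χ`: on matrices `DX` at the origin is `-A`, which gives
`(-1)^t`; on covectors `d tr(DX)` is `(m + 1) α`, which gives `(m + 1)^u`; and `t! u!` permutations
preserve the blocks. -/
theorem restr_chiU {t u : ℕ}
    (γ : Matrix (Fin m) (Fin m) ℝ [⋀^Fin t]→ₗ[ℝ] (Module.Dual ℝ (Fin m → ℝ) [⋀^Fin u]→ₗ[ℝ] V))
    (h' : t + u = t + u) : restr m V h' (chiU m V t u γ) = γ := by
  ext A α
  rw [restr_apply, chiU_apply, sum_perm_eq_of_blocks γ
    (fun k => jac (star m (pureTuple h' A α k)) 0) (fun k => dTrJac (star m (pureTuple h' A α k)) 0)]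
  · have e1 : (fun i => jac (star m (pureTuple h' A α (Fin.castAdd u i))) 0) =
        fun i => (-1 : ℝ) • A i := funext fun i => by
      rw [neg_one_smul, ← jac_star_ofMat, ← pureTuple_left h' A α i]
      rfl
    have e2 : (fun j => dTrJac (star m (pureTuple h' A α (Fin.natAdd t j))) 0) =
        fun j => ((m : ℝ) + 1) • α j := funext fun j => by
      rw [← dTrJac_star_ofDual, ← pureTuple_right h' A α j]
      rfl
    rw [e1, e2]
    have e3 : γ (fun i => (-1 : ℝ) • A i) = (∏ _i : Fin t, (-1 : ℝ)) • γ A :=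
      γ.toMultilinearMap.map_smul_univ (fun _ => -1) A
    have e4 : γ A (fun j => ((m : ℝ) + 1) • α j) = (∏ _j : Fin u, ((m : ℝ) + 1)) • γ A α :=
      (γ A).toMultilinearMap.map_smul_univ (fun _ => (m : ℝ) + 1) α
    rw [e3, AlternatingMap.smul_apply, e4, smul_smul, smul_smul, smul_smul]
    convert one_smul ℝ (γ A α) using 2
    have h1 : (t.factorial : ℝ) ≠ 0 := by exact_mod_cast t.factorial_ne_zero
    have h2 : (u.factorial : ℝ) ≠ 0 := by exact_mod_cast u.factorial_ne_zero
    have h3 : (m : ℝ) + 1 ≠ 0 := by positivity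
    have h4 : ((-1 : ℝ) ^ t) * (-1) ^ t = 1 := by rw [← mul_pow]; simp
    simp only [Finset.prod_const, Finset.card_univ, Fintype.card_fin]
    field_simp
    rw [pow_two, h4]
  · intro j
    rw [← jac_star_ofDual (α j), ← pureTuple_right h' A α j]
    rfl

theorem restr_chiU_of_ne {t u t' u' : ℕ} (h : t' + u' = t + u) (hne : t' ≠ t)
    (γ : Matrix (Fin m) (Fin m) ℝ [⋀^Fin t]→ₗ[ℝ] (Module.Dual ℝ (Fin m → ℝ) [⋀^Fin u]→ₗ[ℝ] V)) :
    restr m V h (chiU m V t u γ) = 0 := by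
  ext A α
  rw [restr_apply, chiU_apply, sum_perm_eq_zero_of_blocks (t' := t') (by omega) hne γ
    (fun k => jac (star m (pureTuple h A α k)) 0) (fun k => dTrJac (star m (pureTuple h A α k)) 0),
    smul_zero]
  · rfl
  · intro k hk
    obtain ⟨k, rfl⟩ : ∃ k', k = Fin.cast h k' := ⟨Fin.cast h.symm k, rfl⟩
    refine Fin.addCases (fun k hk => ?_) (fun k hk => ?_) k hk
    · simp at hk
      omega
    · simp only [pureTuple_right, jac_star_ofDual]
  · intro k hk
    obtain ⟨k, rfl⟩ : ∃ k', k = Fin.cast h k' := ⟨Fin.cast h.symm k, rfl⟩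
    refine Fin.addCases (fun k hk => ?_) (fun k hk => ?_) k hk
    · simp only [pureTuple_left, dTrJac_star_ofMat]
    · simp at hk

/-- The value at `x` depends only on `DX` and `d tr(DX)` at `x`. Both are kept when `x` is
translated to the origin and the component in `ℝ^m` is removed. -/
theorem basicPart_chiU (t u : ℕ)
    (γ : Matrix (Fin m) (Fin m) ℝ [⋀^Fin t]→ₗ[ℝ] (Module.Dual ℝ (Fin m → ℝ) [⋀^Fin u]→ₗ[ℝ] V)) :
    basicPart m V (t + u) (chiU m V t u γ) = chiU m V t u γ := by
  refine cochain_ext fun v x => ?_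
  have e : ∀ X : ProjSl m, jac (star m (dilate m 0 (shift (-x) X))) 0 = jac (star m X) x := by
    intro X
    have h := jac_star_shift X (-x) 0
    rw [zero_sub, neg_neg] at h
    rw [← h, jac_star_zero, jac_star_zero]
    rfl
  have e' : ∀ X : ProjSl m, dTrJac (star m (dilate m 0 (shift (-x) X))) 0 = dTrJac (star m X) x := by
    intro X
    rw [dTrJac_star, dTrJac_star]
    rfl
  rw [basicPart_apply, chiU_apply, chiU_apply]
  simp only [e, e']

theorem dilate_pureTuple {t u n : ℕ} (h : t + u = n) (A : Fin t → Matrix (Fin m) (Fin m) ℝ)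
    (α : Fin u → Module.Dual ℝ (Fin m → ℝ)) (s : ℝ) (k : Fin n) :
    dilate m s (pureTuple h A α k) = pureTuple h A α k := by
  obtain ⟨k, rfl⟩ : ∃ k', k = Fin.cast h k' := ⟨Fin.cast h.symm k, rfl⟩
  refine Fin.addCases (fun k => ?_) (fun k => ?_) k
  · rw [pureTuple_left, dilate_eq]
    change _ + (s - 1) • ofVec m 0 = _
    simp
  · rw [pureTuple_right, dilate_eq]
    change _ + (s - 1) • ofVec m 0 = _
    simp

theorem restr_basicPart {t u n : ℕ} (h : t + u = n) (c : ProjSl m [⋀^Fin n]→ₗ[ℝ] Smooth m V) :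
    restr m V h (basicPart m V n c) = restr m V h c := by
  ext A α
  rw [restr_apply, restr_apply, basicPart_apply]
  simp only [neg_zero, shift_zero, dilate_pureTuple]

theorem basicPart_basicPart {n : ℕ} (c : ProjSl m [⋀^Fin n]→ₗ[ℝ] Smooth m V) :
    basicPart m V n (basicPart m V n c) = basicPart m V n c := by
  refine cochain_ext fun v x => ?_
  rw [basicPart_apply, basicPart_apply, basicPart_apply]
  simp only [neg_zero, shift_zero]
  refine congrArg (fun w => (c w).1 0) (funext fun i => ?_)
  refine Prod.ext ?_ rfl
  change (0 : ℝ) • ((0 : ℝ) • (shift (-x) (v i)).1) = (0 : ℝ) • (shift (-x) (v i)).1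
  simp

/-- More than `m` covectors are linearly dependent. Hence nothing is lost by taking only `u ≤ m` in
`ExtDual`. -/
theorem restr_eq_zero_of_lt {t u n : ℕ} (h : t + u = n) (hu : m < u)
    (c : ProjSl m [⋀^Fin n]→ₗ[ℝ] Smooth m V) : restr m V h c = 0 := by
  ext A α
  refine AlternatingMap.map_linearDependent (restr m V h c A) α fun hα => ?_
  have := hα.fintype_card_le_finrank
  rw [Fintype.card_fin, Subspace.dual_finrank_eq, Module.finrank_fin_fun] at this
  omega

/-- A basic cochain is determined by its values at the origin on sums of a matrix and a covector.
Multilinearity and a permutation of the arguments reduce these to tuples with the matrices first. -/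
theorem basic_eq_zero {n : ℕ} (c : ProjSl m [⋀^Fin n]→ₗ[ℝ] Smooth m V) (hc : basicPart m V n c = c)
    (hr : ∀ (t u : ℕ) (h : t + u = n), u ≤ m → restr m V h c = 0) : c = 0 := by
  have hr' : ∀ (t u : ℕ) (h : t + u = n), restr m V h c = 0 := fun t u h =>
    (le_or_gt u m).elim (hr t u h) fun hu => restr_eq_zero_of_lt h hu c
  refine cochain_ext fun v x => ?_
  rw [← hc, basicPart_apply]
  have e : (fun i => dilate m 0 (shift (-x) (v i))) =
      (fun i => ofMat m (shift (-x) (v i)).2.1) + fun i => ofDual m (shift (-x) (v i)).2.2 := by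
    funext i
    rw [Pi.add_apply, dilate_eq]
    conv_lhs => rw [← ofVec_add_ofMat_add_ofDual (shift (-x) (v i))]
    change (ofVec m (shift (-x) (v i)).1 + _ + _) +
      (0 - 1 : ℝ) • ofVec m ((shift (-x) (v i)).1 + 0 + 0) = _
    simp only [add_zero]
    module
  have key : ∀ (a : Fin n → Matrix (Fin m) (Fin m) ℝ) (b : Fin n → Module.Dual ℝ (Fin m → ℝ))
      (s : Finset (Fin n)),
      (c (s.piecewise (fun i => ofMat m (a i)) fun i => ofDual m (b i))).1 0 = 0 := by
    intro a b s
    -- Lists the places of `s`, occupied by matrices, before those of its complement, occupied by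
    -- covectors; reordering costs only a sign.
    set e := finSumEquivOfFinset (s := s) rfl rfl
    have h : s.card + sᶜ.card = n := by
      rw [Finset.card_add_card_compl, Fintype.card_fin]
    set σ : Equiv.Perm (Fin n) := (finCongr h.symm).trans (finSumFinEquiv.symm.trans e)
    have h1 : (s.piecewise (fun i => ofMat m (a i)) fun i => ofDual m (b i)) ∘ σ =
        pureTuple h (fun i => a (e (Sum.inl i))) (fun j => b (e (Sum.inr j))) := by
      funext k
      obtain ⟨k, rfl⟩ : ∃ k', k = Fin.cast h k' := ⟨Fin.cast h.symm k, rfl⟩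
      refine Fin.addCases (fun k => ?_) (fun k => ?_) k
      · rw [pureTuple_left]
        have : σ (Fin.cast h (Fin.castAdd _ k)) = e (Sum.inl k) := by
          change e (finSumFinEquiv.symm (Fin.castAdd _ k)) = _
          rw [finSumFinEquiv_symm_apply_castAdd]
        rw [Function.comp_apply, this, Finset.piecewise_eq_of_mem]
        simp [e]
      · rw [pureTuple_right]
        have : σ (Fin.cast h (Fin.natAdd _ k)) = e (Sum.inr k) := by
          change e (finSumFinEquiv.symm (Fin.natAdd _ k)) = _
          rw [finSumFinEquiv_symm_apply_natAdd]
        rw [Function.comp_apply, this, Finset.piecewise_eq_of_notMem]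
        rw [← Finset.mem_compl]
        simp [e]
    have h2 := ((Smooth.eval 0).compAlternatingMap c).map_perm
      (s.piecewise (fun i => ofMat m (a i)) fun i => ofDual m (b i)) σ
    have h3 : ((Smooth.eval 0).compAlternatingMap c) (pureTuple h (fun i => a (e (Sum.inl i)))
        (fun j => b (e (Sum.inr j)))) = 0 :=
      congrArg (fun γ => γ (fun i => a (e (Sum.inl i))) (fun j => b (e (Sum.inr j)))) (hr' _ _ h)
    rw [h1, h3] at h2
    exact (smul_eq_zero_iff_eq _).1 h2.symm
  rw [e]
  refine (congrArg (Smooth.eval 0) (c.map_add_univ _ _)).trans ?_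
  rw [map_sum]
  exact Finset.sum_eq_zero fun s _ => key _ _ s

theorem gaugeBracket_ofMat_ofMat (A B : Matrix (Fin m) (Fin m) ℝ) :
    gaugeBracket m (ofMat m A) (ofMat m B) = ofMat m ((1 / 2 : ℝ) • ⁅A, B⁆) := by
  rw [gaugeBracket_apply, halfBracket_apply]
  change ⁅ofVec m 0, ofMat m B⁆ + (ofMat m ((1 / 2 : ℝ) • ⁅A, B⁆) + ofDual m (dualRep m A 0)) = _
  simp

theorem gaugeBracket_ofMat_ofDual (A : Matrix (Fin m) (Fin m) ℝ) (α : Module.Dual ℝ (Fin m → ℝ)) :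
    gaugeBracket m (ofMat m A) (ofDual m α) = ofDual m (dualRep m A α) := by
  rw [gaugeBracket_apply, halfBracket_apply]
  change ⁅ofVec m 0, ofDual m α⁆ + (ofMat m ((1 / 2 : ℝ) • ⁅A, 0⁆) + ofDual m (dualRep m A α)) = _
  simp

theorem gaugeBracket_ofDual (α : Module.Dual ℝ (Fin m → ℝ)) (X : ProjSl m) :
    gaugeBracket m (ofDual m α) X = 0 := by
  rw [gaugeBracket_apply, halfBracket_apply]
  change ⁅ofVec m 0, X⁆ + (ofMat m ((1 / 2 : ℝ) • ⁅(0 : Matrix (Fin m) (Fin m) ℝ), X.2.1⁆) +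
    ofDual m (dualRep m 0 X.2.2)) = 0
  simp

variable [FiniteDimensional ℝ V] (ρ : Matrix (Fin m) (Fin m) ℝ →ₗ⁅ℝ⁆ Module.End ℝ V)

theorem slRep_ofMat_zero (A : Matrix (Fin m) (Fin m) ℝ) (f : Smooth m V) :
    (slRep ρ (ofMat m A) f).1 0 = ρ A (f.1 0) := by
  rw [slRep_apply, jac_star_ofMat]
  have : (star m (ofMat m A)).1 0 = 0 := by
    rw [star_apply]
    change -(0 : Fin m → ℝ) - A.mulVec 0 + _ • 0 = 0
    simp
  rw [this]
  simp

/-- The field of a covector is quadratic, so its value and its Jacobian vanish at the origin. -/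
theorem slRep_ofDual_zero (α : Module.Dual ℝ (Fin m → ℝ)) (f : Smooth m V) :
    (slRep ρ (ofDual m α) f).1 0 = 0 := by
  rw [slRep_apply, jac_star_ofDual]
  have : (star m (ofDual m α)).1 0 = 0 := by
    rw [star_apply]
    change -(0 : Fin m → ℝ) - (0 : Matrix (Fin m) (Fin m) ℝ).mulVec 0 + _ • 0 = 0
    simp
  rw [this]
  simp

theorem coboundary_eval_zero {n : ℕ} (c : ProjSl m [⋀^Fin n]→ₗ[ℝ] Smooth m V)
    (v : Fin (n + 1) → ProjSl m) : (coboundary (slRep ρ) n c v).1 0 =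
      ∑ i : Fin (n + 1), (-1 : ℝ) ^ (i : ℕ) • ((slRep ρ (v i) (c (i.removeNth v))).1 0 -
        ∑ j, (c (Function.update (i.removeNth v) j (gaugeBracket m (v i) (i.removeNth v j)))).1 0) := by
  have h := congrArg (Smooth.eval 0) (coboundary_eq_of_antisymm (slRep ρ) gaugeBracket_antisymm c v)
  rw [map_sum] at h
  refine h.trans (Finset.sum_congr rfl fun i _ => ?_)
  rw [map_smul, map_sub, altDer_apply, map_sum]
  rfl

/-- When all arguments are covectors, both the action at the origin and `gaugeBracket` vanish:
`ℝ^{m*}` is abelian and acts trivially on `V`. -/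
theorem restr_coboundary_zero {u n : ℕ} (h : 0 + u = n + 1)
    (c : ProjSl m [⋀^Fin n]→ₗ[ℝ] Smooth m V) : restr m V h (coboundary (slRep ρ) n c) = 0 := by
  ext A α
  rw [restr_apply, coboundary_eval_zero]
  refine Finset.sum_eq_zero fun k _ => ?_
  obtain ⟨j, rfl⟩ : ∃ j, k = Fin.cast h (Fin.natAdd 0 j) := by
    refine ⟨Fin.cast (by omega) k, ?_⟩
    ext
    simp
  rw [pureTuple_right, slRep_ofDual_zero, zero_sub, Finset.sum_eq_zero, neg_zero, smul_zero]
  intro k _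
  rw [gaugeBracket_ofDual, c.map_update_zero]
  rfl

/-- With `gaugeBracket`, the terms led by a covector vanish. In a term led by a matrix, the brackets
with matrices give the coboundary of `gl(m, ℝ)`, and those with covectors, together with `ρ`, give
its action on `Λ^u(ℝ^{m*}, V)`. -/
theorem restr_coboundary_succ {t u n : ℕ} (h : t + u = n) (h' : t + 1 + u = n + 1)
    (c : ProjSl m [⋀^Fin n]→ₗ[ℝ] Smooth m V) : restr m V h' (coboundary (slRep ρ) n c) =
      coboundary (altRep u (dualRep m) ρ) t (restr m V h c) := by
  subst h
  ext A α
  have hanti : ∀ A B : Matrix (Fin m) (Fin m) ℝ,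
      ((1 / 2 : ℝ) • (LieAlgebra.ad ℝ (Matrix (Fin m) (Fin m) ℝ) :
        Matrix (Fin m) (Fin m) ℝ →ₗ[ℝ] Module.End ℝ (Matrix (Fin m) (Fin m) ℝ))) A B -
      ((1 / 2 : ℝ) • (LieAlgebra.ad ℝ (Matrix (Fin m) (Fin m) ℝ) :
        Matrix (Fin m) (Fin m) ℝ →ₗ[ℝ] Module.End ℝ (Matrix (Fin m) (Fin m) ℝ))) B A = ⁅A, B⁆ := by
    intro A B
    simp only [LinearMap.smul_apply, LieHom.coe_toLinearMap, LieAlgebra.ad_apply]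
    rw [← lie_skew A B]
    module
  rw [restr_apply, coboundary_eval_zero, ← Equiv.sum_comp (finCongr h'), Fin.sum_univ_add]
  rw [Finset.sum_eq_zero (s := (Finset.univ : Finset (Fin u))), add_zero,
    coboundary_eq_of_antisymm _ hanti, alternatingMap_sum_apply]
  · refine Finset.sum_congr rfl fun i _ => ?_
    have e0 : (Fin.cast h' (Fin.castAdd u i)).removeNth (pureTuple h' A α) =
        pureTuple rfl (i.removeNth A) α :=
      (removeNth_append_left h'.symm (fun i => ofMat m (A i)) (fun j => ofDual m (α j)) i)
    rw [AlternatingMap.smul_apply, AlternatingMap.sub_apply, altRep_apply, altDer_apply,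
      alternatingMap_sum_apply]
    change (-1 : ℝ) ^ (i : ℕ) • ((slRep ρ (pureTuple h' A α (Fin.cast h' (Fin.castAdd u i)))
      (c ((Fin.cast h' (Fin.castAdd u i)).removeNth (pureTuple h' A α)))).1 0 -
        ∑ j, (c (Function.update ((Fin.cast h' (Fin.castAdd u i)).removeNth (pureTuple h' A α)) j
          (gaugeBracket m (pureTuple h' A α (Fin.cast h' (Fin.castAdd u i)))
            ((Fin.cast h' (Fin.castAdd u i)).removeNth (pureTuple h' A α) j)))).1 0) = _
    rw [e0, pureTuple_left, slRep_ofMat_zero, Fin.sum_univ_add]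
    have e1 : ∀ j : Fin t, (c (Function.update (pureTuple rfl (i.removeNth A) α) (Fin.castAdd u j)
        (gaugeBracket m (ofMat m (A i)) (pureTuple rfl (i.removeNth A) α (Fin.castAdd u j))))).1 0 =
        restr m V rfl c (Function.update (i.removeNth A) j ((1 / 2 : ℝ) • ⁅A i, i.removeNth A j⁆)) α := by
      intro j
      rw [restr_apply, pureTuple_update_left, ← gaugeBracket_ofMat_ofMat]
      rw [← pureTuple_left rfl (i.removeNth A) α j]
      rfl
    have e2 : ∀ j : Fin u, (c (Function.update (pureTuple rfl (i.removeNth A) α) (Fin.natAdd t j)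
        (gaugeBracket m (ofMat m (A i)) (pureTuple rfl (i.removeNth A) α (Fin.natAdd t j))))).1 0 =
        restr m V rfl c (i.removeNth A) (Function.update α j (dualRep m (A i) (α j))) := by
      intro j
      rw [restr_apply, pureTuple_update_right, ← gaugeBracket_ofMat_ofDual]
      rw [← pureTuple_right rfl (i.removeNth A) α j]
      rfl
    simp only [e1, e2]
    rw [restr_apply, sub_add_eq_sub_sub_swap]
    rfl
  · intro j _
    change (-1 : ℝ) ^ _ • ((slRep ρ (pureTuple h' A α (Fin.cast h' (Fin.natAdd (t + 1) j))) _).1 0 -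
        ∑ k, (c (Function.update _ k (gaugeBracket m
          (pureTuple h' A α (Fin.cast h' (Fin.natAdd (t + 1) j))) _))).1 0) = 0
    rw [pureTuple_right, slRep_ofDual_zero, zero_sub, Finset.sum_eq_zero, neg_zero, smul_zero]
    intro k _
    rw [gaugeBracket_ofDual, c.map_update_zero]
    rfl

end Restriction

/-! ### Restriction as an inverse of `χ` on the basic cochains. -/

section Retraction

variable {m : ℕ} {V : Type*} [NormedAddCommGroup V] [NormedSpace ℝ V]

/-- The component in `Λ^t(gl(m, ℝ), Λ^u(ℝ^{m*}, V))` of the restriction of an `n`-cochain. -/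
def restrComponent (m : ℕ) (V : Type*) [NormedAddCommGroup V] [NormedSpace ℝ V] (n t u : ℕ) :
    (ProjSl m [⋀^Fin n]→ₗ[ℝ] Smooth m V) →ₗ[ℝ]
    (Matrix (Fin m) (Fin m) ℝ [⋀^Fin t]→ₗ[ℝ] (Module.Dual ℝ (Fin m → ℝ) [⋀^Fin u]→ₗ[ℝ] V)) :=
  if h : t + u = n then restr m V h else 0

/-- The component of degree `t` of the restriction of an `n`-cochain. -/
def restrDegree (m : ℕ) (V : Type*) [NormedAddCommGroup V] [NormedSpace ℝ V] (n t : ℕ) :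
    (ProjSl m [⋀^Fin n]→ₗ[ℝ] Smooth m V) →ₗ[ℝ]
    (Matrix (Fin m) (Fin m) ℝ [⋀^Fin t]→ₗ[ℝ] ExtDual m V) where
  toFun c := AlternatingMap.pi fun u : Fin (m + 1) => restrComponent m V n t u c
  map_add' c c' := by
    refine AlternatingMap.ext fun A => funext fun u => ?_
    change restrComponent m V n t u (c + c') A = restrComponent m V n t u c A +
      restrComponent m V n t u c' A
    rw [map_add]
    rfl
  map_smul' r c := by
    refine AlternatingMap.ext fun A => funext fun u => ?_
    change restrComponent m V n t u (r • c) A = r • restrComponent m V n t u c A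
    rw [map_smul]
    rfl

theorem restrDegree_apply (n t : ℕ) (c : ProjSl m [⋀^Fin n]→ₗ[ℝ] Smooth m V)
    (A : Fin t → Matrix (Fin m) (Fin m) ℝ) (u : Fin (m + 1)) :
    restrDegree m V n t c A u = restrComponent m V n t u c A := rfl

/-- The retraction of `chi`. -/
def retraction (m : ℕ) (V : Type*) [NormedAddCommGroup V] [NormedSpace ℝ V] :
    Cochains (ProjSl m) (Smooth m V) →ₗ[ℝ] Cochains (Matrix (Fin m) (Fin m) ℝ) (ExtDual m V) :=
  Cochains.lift fun n => ∑ t ∈ Finset.range (n + 1),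
    Cochains.of (Matrix (Fin m) (Fin m) ℝ) (ExtDual m V) t ∘ₗ restrDegree m V n t

theorem retraction_of (n : ℕ) (c : ProjSl m [⋀^Fin n]→ₗ[ℝ] Smooth m V) :
    retraction m V (Cochains.of _ _ n c) = ∑ t ∈ Finset.range (n + 1),
      Cochains.of (Matrix (Fin m) (Fin m) ℝ) (ExtDual m V) t (restrDegree m V n t c) := by
  rw [retraction, Cochains.lift_of, LinearMap.sum_apply]
  rfl

theorem chi_of (t : ℕ) (γ : Matrix (Fin m) (Fin m) ℝ [⋀^Fin t]→ₗ[ℝ] ExtDual m V) :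
    chi m V (Cochains.of _ _ t γ) = ∑ u : Fin (m + 1),
      Cochains.of (ProjSl m) (Smooth m V) (t + u)
        (chiU m V t u ((LinearMap.proj u : ExtDual m V →ₗ[ℝ] _).compAlternatingMap γ)) := by
  rw [chi, Cochains.lift_of, LinearMap.sum_apply]
  rfl

/-- The image of bidegree `(t, u)` restricts to itself in that bidegree, by `restr_chiU`, and to
zero in the others, by `restr_chiU_of_ne` and comparison of total degrees. -/
theorem retraction_chi (γ : Cochains (Matrix (Fin m) (Fin m) ℝ) (ExtDual m V)) :
    retraction m V (chi m V γ) = γ := by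
  suffices h : retraction m V ∘ₗ chi m V = LinearMap.id from LinearMap.congr_fun h γ
  refine Cochains.hom_ext fun t γ => ?_
  rw [LinearMap.comp_apply, LinearMap.id_apply, chi_of, map_sum]
  have h1 : ∀ u : Fin (m + 1), ∀ δ : Matrix (Fin m) (Fin m) ℝ [⋀^Fin t]→ₗ[ℝ]
      (Module.Dual ℝ (Fin m → ℝ) [⋀^Fin u]→ₗ[ℝ] V),
      retraction m V (Cochains.of (ProjSl m) (Smooth m V) (t + u) (chiU m V t u δ)) =
      Cochains.of _ _ t (restrDegree m V (t + u) t (chiU m V t u δ)) := by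
    intro u δ
    rw [retraction_of, Finset.sum_eq_single t]
    · intro t' _ hne
      have : restrDegree m V (t + u) t' (chiU m V t u δ) = 0 := by
        refine AlternatingMap.ext fun A => funext fun u' => ?_
        rw [restrDegree_apply, restrComponent]
        split_ifs with h
        · rw [restr_chiU_of_ne h hne]
          rfl
        · rfl
      rw [this, map_zero]
    · intro h
      exact absurd (Finset.mem_range.2 (by omega)) h
  simp only [h1]
  rw [← map_sum]
  congr 1
  refine AlternatingMap.ext fun A => funext fun u => ?_
  rw [alternatingMap_sum_apply, Finset.sum_apply, Finset.sum_eq_single u]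
  · rw [restrDegree_apply, restrComponent, dif_pos rfl, restr_chiU]
    rfl
  · intro u' _ hne
    rw [restrDegree_apply, restrComponent, dif_neg]
    · rfl
    · intro h
      exact hne (Fin.ext (by omega))
  · intro h
    exact absurd (Finset.mem_univ u) h

/-- The projection on the basic cochains, on the space of all cochains. -/
def totalBasicPart (m : ℕ) (V : Type*) [NormedAddCommGroup V] [NormedSpace ℝ V] :
    Cochains (ProjSl m) (Smooth m V) →ₗ[ℝ] Cochains (ProjSl m) (Smooth m V) :=
  Cochains.lift fun n => Cochains.of _ _ n ∘ₗ basicPart m V n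

theorem totalBasicPart_of (n : ℕ) (c : ProjSl m [⋀^Fin n]→ₗ[ℝ] Smooth m V) :
    totalBasicPart m V (Cochains.of _ _ n c) = Cochains.of _ _ n (basicPart m V n c) :=
  Cochains.lift_of _ n c

theorem totalBasicPart_chi (γ : Cochains (Matrix (Fin m) (Fin m) ℝ) (ExtDual m V)) :
    totalBasicPart m V (chi m V γ) = chi m V γ := by
  suffices h : totalBasicPart m V ∘ₗ chi m V = chi m V from LinearMap.congr_fun h γ
  refine Cochains.hom_ext fun t γ => ?_
  rw [LinearMap.comp_apply, chi_of, map_sum]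
  simp only [totalBasicPart_of, basicPart_chiU]

theorem retraction_of_basicPart (n : ℕ) (c : ProjSl m [⋀^Fin n]→ₗ[ℝ] Smooth m V) :
    retraction m V (Cochains.of _ _ n (basicPart m V n c)) =
      retraction m V (Cochains.of _ _ n c) := by
  rw [retraction_of, retraction_of]
  refine Finset.sum_congr rfl fun t _ => ?_
  congr 1
  refine AlternatingMap.ext fun A => funext fun u => ?_
  rw [restrDegree_apply, restrDegree_apply, restrComponent]
  split_ifs with h
  · rw [restr_basicPart]
  · rfl

theorem chi_retraction_of_mem_range (n : ℕ) (c : ProjSl m [⋀^Fin n]→ₗ[ℝ] Smooth m V) :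
    chi m V (retraction m V (Cochains.of _ _ n c)) ∈
      LinearMap.range (Cochains.of (ProjSl m) (Smooth m V) n) := by
  rw [retraction_of, map_sum]
  refine Submodule.sum_mem _ fun t _ => ?_
  rw [chi_of]
  refine Submodule.sum_mem _ fun u _ => ?_
  by_cases h : t + u = n
  · subst h
    exact ⟨_, rfl⟩
  · have : (LinearMap.proj u : ExtDual m V →ₗ[ℝ] _).compAlternatingMap (restrDegree m V n t c) = 0 := by
      refine AlternatingMap.ext fun A => ?_
      change restrComponent m V n t u c A = 0
      rw [restrComponent, dif_neg h]
      rfl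
    rw [this, map_zero, map_zero]
    exact Submodule.zero_mem _

theorem eq_zero_of_retraction_eq_zero (n : ℕ) (c : ProjSl m [⋀^Fin n]→ₗ[ℝ] Smooth m V)
    (hc : basicPart m V n c = c) (hr : retraction m V (Cochains.of _ _ n c) = 0) : c = 0 := by
  refine basic_eq_zero c hc fun t u h hu => ?_
  have h1 := congrArg (Cochains.component (Matrix (Fin m) (Fin m) ℝ) (ExtDual m V) t) hr
  rw [retraction_of, map_sum, map_zero, Finset.sum_eq_single t, Cochains.component_of] at h1
  · refine AlternatingMap.ext fun A => ?_
    have h2 := congrFun (congrArg (fun γ => γ A) h1) ⟨u, Nat.lt_succ_of_le hu⟩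
    rw [restrDegree_apply, restrComponent, dif_pos h] at h2
    exact h2
  · intro k _ hk
    exact Cochains.component_of_ne hk _
  · intro ht
    exact absurd (Finset.mem_range.2 (by omega)) ht

/-- Both sides are basic, and `retraction` takes the same value on them because `retraction ∘ χ =
id` and it ignores the passage to the basic part. It is injective on the basic cochains of each
degree. -/
theorem chi_retraction (c : Cochains (ProjSl m) (Smooth m V)) :
    chi m V (retraction m V c) = totalBasicPart m V c := by
  suffices h : chi m V ∘ₗ retraction m V = totalBasicPart m V from LinearMap.congr_fun h c
  refine Cochains.hom_ext fun n c => ?_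
  obtain ⟨c', hc'⟩ := chi_retraction_of_mem_range n c
  rw [LinearMap.comp_apply, totalBasicPart_of, ← hc']
  have h1 : basicPart m V n c' = c' := by
    apply Cochains.of_injective n
    rw [← totalBasicPart_of, hc', totalBasicPart_chi]
  have h2 : c' + (-1 : ℝ) • basicPart m V n c = 0 := by
    apply eq_zero_of_retraction_eq_zero n
    · rw [map_add, map_smul, h1, basicPart_basicPart]
    · rw [map_add, map_smul, map_add, map_smul, hc', retraction_chi, retraction_of_basicPart,
        neg_one_smul, add_neg_cancel]
  have h3 : c' = basicPart m V n c := cochain_ext fun v x => by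
    have h4 : (c' v).1 x + (-1 : ℝ) • (basicPart m V n c v).1 x = 0 :=
      congrArg (fun e : ProjSl m [⋀^Fin n]→ₗ[ℝ] Smooth m V => (e v).1 x) h2
    rwa [neg_one_smul, add_neg_eq_zero] at h4
  rw [h3]

/-! ### Compatibility with the differentials and bijectivity in cohomology. -/

variable [FiniteDimensional ℝ V] (ρ : Matrix (Fin m) (Fin m) ℝ →ₗ⁅ℝ⁆ Module.End ℝ V)

theorem restrDegree_coboundary_zero (n : ℕ) (c : ProjSl m [⋀^Fin n]→ₗ[ℝ] Smooth m V) :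
    restrDegree m V (n + 1) 0 (coboundary (slRep ρ) n c) = 0 := by
  refine AlternatingMap.ext fun A => funext fun u => ?_
  rw [restrDegree_apply, restrComponent]
  split_ifs with h
  · rw [restr_coboundary_zero]
    rfl
  · rfl

theorem restrDegree_coboundary_succ (n t : ℕ) (c : ProjSl m [⋀^Fin n]→ₗ[ℝ] Smooth m V) :
    restrDegree m V (n + 1) (t + 1) (coboundary (slRep ρ) n c) =
      coboundary (glRep ρ) t (restrDegree m V n t c) := by
  refine AlternatingMap.ext fun A => funext fun u => ?_
  have h1 : coboundary (glRep ρ) t (restrDegree m V n t c) A u =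
      coboundary (altRep u (dualRep m) ρ) t (restrComponent m V n t u c) A := by
    rw [coboundary_apply, coboundary_apply, Pi.sub_apply, Finset.sum_apply, Finset.sum_apply]
    congr 1
    refine Finset.sum_congr rfl fun i _ => ?_
    rw [Finset.sum_apply]
    rfl
  rw [h1, restrDegree_apply, restrComponent, restrComponent]
  by_cases h : t + u = n
  · rw [dif_pos (by omega : t + 1 + u = n + 1), dif_pos h, restr_coboundary_succ ρ h]
  · rw [dif_neg (by omega : ¬ t + 1 + u = n + 1), dif_neg h, LinearMap.zero_apply,
      LinearMap.zero_apply, map_zero]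

theorem retraction_d (c : Cochains (ProjSl m) (Smooth m V)) :
    retraction m V (d (slRep ρ) c) = d (glRep ρ) (retraction m V c) := by
  suffices h : retraction m V ∘ₗ d (slRep ρ) = d (glRep ρ) ∘ₗ retraction m V from
    LinearMap.congr_fun h c
  refine Cochains.hom_ext fun n c => ?_
  rw [LinearMap.comp_apply, LinearMap.comp_apply, d_of, retraction_of, retraction_of, map_sum,
    -- The component of degree `0` in `gl(m, ℝ)` vanishes, and that of degree `t + 1` comes from
    -- degree `t`.
    Finset.sum_range_succ', restrDegree_coboundary_zero, map_zero, add_zero]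
  refine Finset.sum_congr rfl fun t _ => ?_
  rw [d_of, restrDegree_coboundary_succ]

/-- The homotopy operator on the space of all cochains. -/
def totalHomotopy (m : ℕ) (V : Type*) [NormedAddCommGroup V] [NormedSpace ℝ V] :
    Cochains (ProjSl m) (Smooth m V) →ₗ[ℝ] Cochains (ProjSl m) (Smooth m V) :=
  Cochains.lift fun
    | 0 => 0
    | n + 1 => Cochains.of _ _ n ∘ₗ homotopy m V n

theorem d_totalHomotopy (c : Cochains (ProjSl m) (Smooth m V)) :
    d (slRep ρ) (totalHomotopy m V c) + totalHomotopy m V (d (slRep ρ) c) =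
      c - chi m V (retraction m V c) := by
  suffices h : d (slRep ρ) ∘ₗ totalHomotopy m V + totalHomotopy m V ∘ₗ d (slRep ρ) =
      LinearMap.id - totalBasicPart m V by
    rw [chi_retraction]
    exact LinearMap.congr_fun h c
  have h1 : ∀ (n : ℕ) (c : ProjSl m [⋀^Fin (n + 1)]→ₗ[ℝ] Smooth m V),
      totalHomotopy m V (Cochains.of _ _ (n + 1) c) = Cochains.of _ _ n (homotopy m V n c) :=
    fun n c => Cochains.lift_of _ (n + 1) c
  have h0 : ∀ c : ProjSl m [⋀^Fin 0]→ₗ[ℝ] Smooth m V,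
      totalHomotopy m V (Cochains.of _ _ 0 c) = 0 := fun c => Cochains.lift_of _ 0 c
  refine Cochains.hom_ext fun n c => ?_
  rw [LinearMap.add_apply, LinearMap.sub_apply, LinearMap.comp_apply, LinearMap.comp_apply,
    LinearMap.id_apply, totalBasicPart_of, d_of, h1, ← map_sub]
  rcases n with _ | n
  · rw [h0, map_zero, zero_add, homotopy_zero]
  · rw [h1, d_of, ← map_add, homotopy_succ]

theorem d_totalBasicPart (c : Cochains (ProjSl m) (Smooth m V)) :
    d (slRep ρ) (totalBasicPart m V c) = totalBasicPart m V (d (slRep ρ) c) := by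
  suffices h : d (slRep ρ) ∘ₗ totalBasicPart m V = totalBasicPart m V ∘ₗ d (slRep ρ) from
    LinearMap.congr_fun h c
  refine Cochains.hom_ext fun n c => ?_
  rw [LinearMap.comp_apply, LinearMap.comp_apply, d_of, totalBasicPart_of, totalBasicPart_of, d_of,
    coboundary_basicPart]

/-- The image of `χ` is fixed by the basic projection, which commutes with `∂` and equals `χ ∘
retraction`. The statement thus follows from the one for `retraction`, with no computation on the
permutation formula. -/
theorem d_chi (γ : Cochains (Matrix (Fin m) (Fin m) ℝ) (ExtDual m V)) :
    d (slRep ρ) (chi m V γ) = chi m V (d (glRep ρ) γ) := by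
  calc d (slRep ρ) (chi m V γ) = d (slRep ρ) (totalBasicPart m V (chi m V γ)) := by
        rw [totalBasicPart_chi]
    _ = chi m V (retraction m V (d (slRep ρ) (chi m V γ))) := by
        rw [d_totalBasicPart, chi_retraction]
    _ = chi m V (d (glRep ρ) γ) := by rw [retraction_d, retraction_chi]

theorem cohomologyMap_chi_injective :
    Function.Injective (cohomologyMap (glRep ρ) (slRep ρ) (chi m V) (d_chi ρ)) := by
  rw [← LinearMap.ker_eq_bot, LinearMap.ker_eq_bot']
  intro x hx
  obtain ⟨⟨γ, hγ⟩, rfl⟩ := Submodule.Quotient.mk_surjective _ x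
  obtain ⟨b, hb⟩ : ∃ b, d (slRep ρ) b = chi m V γ := (Submodule.Quotient.mk_eq_zero _).1 hx
  refine (Submodule.Quotient.mk_eq_zero _).2 ⟨retraction m V b, ?_⟩
  rw [← retraction_d, hb, retraction_chi]
  rfl

theorem cohomologyMap_chi_surjective :
    Function.Surjective (cohomologyMap (glRep ρ) (slRep ρ) (chi m V) (d_chi ρ)) := by
  intro x
  obtain ⟨⟨c, hc⟩, rfl⟩ := Submodule.Quotient.mk_surjective _ x
  rw [LinearMap.mem_ker] at hc
  refine ⟨Submodule.Quotient.mk ⟨retraction m V c, ?_⟩, ?_⟩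
  · rw [LinearMap.mem_ker, ← retraction_d, hc, map_zero]
  -- For a cocycle the homotopy formula reads `∂(h c) = c - χ(retraction c)`; the sign accounts for
  -- the opposite order of the difference.
  · refine (Submodule.Quotient.eq _).2 ⟨-totalHomotopy m V c, ?_⟩
    have h := d_totalHomotopy ρ c
    rw [hc, map_zero, add_zero] at h
    rw [map_neg, h, neg_sub]
    rfl

end Retraction

end ProjCoh

end

theorem theorem3p3 (m : ℕ) {V : Type*} [NormedAddCommGroup V] [NormedSpace ℝ V]
    [FiniteDimensional ℝ V] (ρ : Matrix (Fin m) (Fin m) ℝ →ₗ⁅ℝ⁆ Module.End ℝ V) :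
    ∃ hχ : ∀ γ, ProjCoh.d (ProjCoh.slRep ρ) (ProjCoh.chi m V γ) =
        ProjCoh.chi m V (ProjCoh.d (ProjCoh.glRep ρ) γ),
      Function.Bijective
        (ProjCoh.cohomologyMap (ProjCoh.glRep ρ) (ProjCoh.slRep ρ) (ProjCoh.chi m V) hχ) :=
  ⟨ProjCoh.d_chi ρ, ProjCoh.cohomologyMap_chi_injective ρ, ProjCoh.cohomologyMap_chi_surjective ρ⟩
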